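/- **Conventions.** $2$-categories, $2$-functors, $2$-natural transformations, $2$-monads and $2$-adjunctions are strict. For a $2$-category $\mathbb S$, $\mathbb S^{\mathrm{op}}$ is obtained by reversing $1$-cells only. **Lax algebras.** Let $(\mathcal T,m,\eta)$ be a $2$-monad on a $2$-category $\mathbb B$. A *lax $\mathcal T$-algebra* is $\mathtt y=(Y,a_{\mathtt y},\overline{\mathtt y},\overline{\mathtt y}_0)$ with $Y$ an object, $a_{\mathtt y}:\mathcal TY\to Y$ a $1$-cell and $2$-cells $\overline{\mathtt y}:a_{\mathtt y}\,\mathcal T(a_{\mathtt y})\Rightarrow a_{\mathtt y}\,m_Y$, $\overline{\mathtt y}_0:\mathrm{id}_Y\Rightarrow a_{\mathtt y}\eta_Y$ such that $$(\overline{\mathtt y}\ast\mathcal T(m_Y))\cdot(a_{\mathtt y}\ast\mathcal T(\overline{\mathtt y}))=(\overline{\mathtt y}\ast m_{\mathcal TY})\cdot(\overline{\mathtt y}\ast\mathcal T^2(a_{\mathtt y})),$$ $$(\overline{\mathtt y}\ast\eta_{\mathcal TY})\cdot(\overline{\mathtt y}_0\ast a_{\mathtt y})=\mathrm{id}_{a_{\mathtt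 y}}=(\overline{\mathtt y}\ast\mathcal T(\eta_Y))\cdot(a_{\mathtt y}\ast\mathcal T(\overline{\mathtt y}_0)).$$ A *lax morphism* $\mathtt y\to\mathtt z$ is a pair $(f,\langle f\rangle)$ with $f:Y\to Z$ and $\langle f\rangle:a_{\mathtt z}\mathcal T(f)\Rightarrow f a_{\mathtt y}$ such that $$(\langle f\rangle\ast m_Y)\cdot(\overline{\mathtt z}\ast\mathcal T^2(f))=(f\ast\overline{\mathtt y})\cdot(\langle f\rangle\ast\mathcal T(a_{\mathtt y}))\cdot(a_{\mathtt z}\ast\mathcal T(\langle f\rangle)),\qquad (\langle f\rangle\ast\eta_Y)\cdot(\overline{\mathtt z}_0\ast f)=f\ast\overline{\mathtt y}_0 .$$ It is a *pseudomorphism* if $\langle f\rangle$ is invertible and a *strict morphism* if $\langle f\rangle$ is an identity. A *$\mathcal T$-transformation* $(f,\langle f\rangle)\Rightarrow(h,\langle h\rangle)$ is a $2$-cell $\mathfrak m:f\Rightarrow h$ with $\langle h\rangle\cdot(a_{\mathtt z}\ast\mathcal T(\mathfrak m))=(\mathfrak m\ast a_{\mathtt y})\cdot\langle f\rangle$. With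 $\mathcal T$-transformations as $2$-cells, lax algebras and lax morphisms, pseudomorphisms and strict morphisms form $2$-categories $\mathsf{Lax}\text{-}\mathcal T\text{-}\mathrm{Alg}_\ell$, $\mathsf{Lax}\text{-}\mathcal T\text{-}\mathrm{Alg}$ and $\mathsf{Lax}\text{-}\mathcal T\text{-}\mathrm{Alg}_{\mathrm s}$; let $\ell:\mathsf{Lax}\text{-}\mathcal T\text{-}\mathrm{Alg}\to\mathsf{Lax}\text{-}\mathcal T\text{-}\mathrm{Alg}_\ell$ be the inclusion and $U:\mathsf{Lax}\text{-}\mathcal T\text{-}\mathrm{Alg}\to\mathbb B$ the forgetful $2$-functor. **Codescent objects.** Let $\Delta_\ell$ be the $2$-category freely generated by objects $\mathsf 1,\mathsf 2,\mathsf 3$, arrows $d^0,d^1:\mathsf 1\to\mathsf 2$, $s^0:\mathsf 2\to\mathsf 1$, $\partial^0,\partial^1,\partial^2:\mathsf 2\to\mathsf 3$ and $2$-cells $\sigma_{00}:\partial^0d^0\Rightarrow\partial^1d^0$, $\sigma_{20}:\partial^2d^0\Rightarrow\partial^0d^1$, $\sigma_{21}:\partial^2d^1\Rightarrow\partial^1d^1$,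 $n_0:\mathrm{id}_{\mathsf 1}\Rightarrow s^0d^0$, $n_1:\mathrm{id}_{\mathsf 1}\Rightarrow s^0d^1$. The $2$-category $\dot\Delta_\ell$ is presented by these generators together with an object $\mathsf 0$, an arrow $d:\mathsf 0\to\mathsf 1$ and a $2$-cell $\vartheta:d^1d\Rightarrow d^0d$, subject to $$(\sigma_{00}\ast d)\cdot(\partial^0\ast\vartheta)\cdot(\sigma_{20}\ast d)\cdot(\partial^2\ast\vartheta)=(\partial^1\ast\vartheta)\cdot(\sigma_{21}\ast d),\qquad (s^0\ast\vartheta)\cdot(n_1\ast d)=n_0\ast d ;$$ $\dot\Delta$ is obtained from $\dot\Delta_\ell$ by freely adjoining an inverse of $\vartheta$. Write $t:\Delta_\ell\to\dot\Delta_\ell$ and $j:\Delta_\ell\to\dot\Delta$ for the inclusions. For a $2$-functor $\mathcal A:\Delta_\ell^{\mathrm{op}}\to\mathbb A$, the *strict lax codescent object* and the *strict codescent object* of $\mathcal A$ are, if they exist, the (strict) weighted colimits $\dot\Delta_\ell(\mathsf 0,t-)\ast\mathcal A$ and $\dot\Delta(\mathsf 0,j-)\ast\mathcal A$. (The weighted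 colimit $W\ast\mathcal A$ is an object $c$ with a $2$-natural transformation $W\to\mathbb A(\mathcal A-,c)$ that induces, for each object $X$, an isomorphism of categories $\mathbb A(c,X)\cong[\Delta_\ell,\mathrm{Cat}](W,\mathbb A(\mathcal A-,X))$.) **Setting.** Let $(E\dashv R,\rho,\varepsilon)$ be a $2$-adjunction with $R:\mathbb A\to\mathbb B$, let $(\mathcal T,m,\eta)$ be a $2$-monad on $\mathbb B$, and let $J:\mathbb A\to\mathsf{Lax}\text{-}\mathcal T\text{-}\mathrm{Alg}$ be a $2$-functor such that $UJ=R$ and such that $J$ is the composite of a $2$-functor $\widetilde J:\mathbb A\to\mathsf{Lax}\text{-}\mathcal T\text{-}\mathrm{Alg}_{\mathrm s}$ with the inclusion $\mathsf{Lax}\text{-}\mathcal T\text{-}\mathrm{Alg}_{\mathrm s}\to\mathsf{Lax}\text{-}\mathcal T\text{-}\mathrm{Alg}$. For an object $X$ of $\mathbb B$ put $b_X:=\varepsilon_{EX}\,E(a_{JEX}\,\mathcal T(\rho_X)):E\mathcal TX\to EX$. For each lax algebra $\mathtt y=(Y,a_{\mathtt y},\overline{\mathtt y},\overline{\mathtt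 y}_0)$ let $\mathcal A_{\mathtt y}:\Delta_\ell^{\mathrm{op}}\to\mathbb A$ be the $2$-functor with $\mathsf 1\mapsto EY$, $\mathsf 2\mapsto E\mathcal TY$, $\mathsf 3\mapsto E\mathcal T^2Y$, $$d^0\mapsto E(a_{\mathtt y}),\quad d^1\mapsto b_Y,\quad s^0\mapsto E(\eta_Y),\quad \partial^0\mapsto E(\mathcal T(a_{\mathtt y})),\quad \partial^1\mapsto E(m_Y),\quad \partial^2\mapsto b_{\mathcal TY},$$ $$\sigma_{00}\mapsto E(\overline{\mathtt y}),\quad \sigma_{21}\mapsto\varepsilon_{EY}\ast E(\overline{JEY}\ast\mathcal T^2(\rho_Y)),\quad n_0\mapsto E(\overline{\mathtt y}_0),\quad n_1\mapsto\varepsilon_{EY}\ast E(\overline{JEY}_0\ast\rho_Y),$$ and $\sigma_{20}$ sent to the identity of $E(a_{\mathtt y})\,b_{\mathcal TY}=b_Y\,E(\mathcal T(a_{\mathtt y}))$. **Theorem.** 1. The $2$-functor $\ell\circ J$ has a left $2$-adjoint if and only if $\mathbb A$ has the strict lax codescent object of $\mathcal A_{\mathtt y}$ for every lax $\mathcal T$-algebra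 $\mathtt y$. In this case the left $2$-adjoint $G$ is given by $G\mathtt y=\dot\Delta_\ell(\mathsf 0,t-)\ast\mathcal A_{\mathtt y}$: for every left $2$-adjoint $G$ of $\ell\circ J$, each $G\mathtt y$ is a strict lax codescent object of $\mathcal A_{\mathtt y}$, and every choice of strict lax codescent objects $C_{\mathtt y}$ of the $\mathcal A_{\mathtt y}$ is the object function of some left $2$-adjoint of $\ell\circ J$. 2. The $2$-functor $J$ has a left $2$-adjoint if and only if $\mathbb A$ has the strict codescent object of $\mathcal A_{\mathtt y}$ for every lax $\mathcal T$-algebra $\mathtt y$. -/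

import Mathlib

open CategoryTheory Bicategory Opposite

universe w v u w₁ v₁ u₁ w₂ v₂

namespace LaxAlgebras

section Computads

variable {V : Type} [Quiver.{0} V]

/-- A family of generating `2`-cells between parallel paths of a quiver; together with the quiver
it is a (small) computad. -/
abbrev GenCells (V : Type) [Quiver.{0} V] : Type 1 :=
  ∀ ⦃a b : V⦄, Quiver.Path a b → Quiver.Path a b → Type

/-- Formal pastings of generating `2`-cells. -/
inductive PreCell (C : GenCells V) : ∀ {a b : V}, Quiver.Path a b → Quiver.Path a b → Type
  | gen {a b : V} {f g : Quiver.Path a b} (x : C f g) : PreCell C f g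
  | ofEq {a b : V} {f g : Quiver.Path a b} (h : f = g) : PreCell C f g
  | vcomp {a b : V} {f g h : Quiver.Path a b} (x : PreCell C f g) (y : PreCell C g h) :
      PreCell C f h
  | wl {a b c : V} (f : Quiver.Path a b) {g h : Quiver.Path b c} (x : PreCell C g h) :
      PreCell C (f.comp g) (f.comp h)
  | wr {a b c : V} {f g : Quiver.Path a b} (x : PreCell C f g) (h : Quiver.Path b c) :
      PreCell C (f.comp h) (g.comp h)

/-- Relations to be imposed between parallel formal pastings. -/
abbrev CellRel (C : GenCells V) : Type :=
  ∀ ⦃a b : V⦄ ⦃f g : Quiver.Path a b⦄, PreCell C f g → PreCell C f g → Prop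

open PreCell in
/-- The congruence on formal pastings generated by the axioms of a (strict) `2`-category and by
the relations `E`. -/
inductive CellEq {C : GenCells V} (E : CellRel C) : ∀ {a b : V} {f g : Quiver.Path a b},
    PreCell C f g → PreCell C f g → Prop
  | rel {a b : V} {f g : Quiver.Path a b} {x y : PreCell C f g} (h : E x y) : CellEq E x y
  | refl {a b : V} {f g : Quiver.Path a b} (x : PreCell C f g) : CellEq E x x
  | symm {a b : V} {f g : Quiver.Path a b} {x y : PreCell C f g} (h : CellEq E x y) : CellEq E y x
  | trans {a b : V} {f g : Quiver.Path a b} {x y z : PreCell C f g} (h : CellEq E x y)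
      (h' : CellEq E y z) : CellEq E x z
  | vcomp_congr {a b : V} {f g h : Quiver.Path a b} {x x' : PreCell C f g} {y y' : PreCell C g h}
      (hx : CellEq E x x') (hy : CellEq E y y') : CellEq E (vcomp x y) (vcomp x' y')
  | wl_congr {a b c : V} (f : Quiver.Path a b) {g h : Quiver.Path b c} {x x' : PreCell C g h}
      (hx : CellEq E x x') : CellEq E (wl f x) (wl f x')
  | wr_congr {a b c : V} {f g : Quiver.Path a b} {x x' : PreCell C f g} (h : Quiver.Path b c)
      (hx : CellEq E x x') : CellEq E (wr x h) (wr x' h)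
  | id_comp {a b : V} {f g : Quiver.Path a b} (x : PreCell C f g) :
      CellEq E (vcomp (ofEq rfl) x) x
  | comp_id {a b : V} {f g : Quiver.Path a b} (x : PreCell C f g) :
      CellEq E (vcomp x (ofEq rfl)) x
  | assoc {a b : V} {f g h k : Quiver.Path a b} (x : PreCell C f g) (y : PreCell C g h)
      (z : PreCell C h k) : CellEq E (vcomp (vcomp x y) z) (vcomp x (vcomp y z))
  | wl_id {a b c : V} (f : Quiver.Path a b) (g : Quiver.Path b c) :
      CellEq E (wl f (ofEq (rfl : g = g))) (ofEq rfl)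
  | wl_comp {a b c : V} (f : Quiver.Path a b) {g h k : Quiver.Path b c} (x : PreCell C g h)
      (y : PreCell C h k) : CellEq E (wl f (vcomp x y)) (vcomp (wl f x) (wl f y))
  | id_wr {a b c : V} (f : Quiver.Path a b) (g : Quiver.Path b c) :
      CellEq E (wr (ofEq (rfl : f = f)) g) (ofEq rfl)
  | comp_wr {a b c : V} {f g h : Quiver.Path a b} (x : PreCell C f g)
      (y : PreCell C g h) (k : Quiver.Path b c) :
      CellEq E (wr (vcomp x y) k) (vcomp (wr x k) (wr y k))
  | nil_wl {a b : V} {f g : Quiver.Path a b} (x : PreCell C f g) :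
      CellEq E (wl Quiver.Path.nil x)
        (vcomp (ofEq (Quiver.Path.nil_comp f)) (vcomp x (ofEq (Quiver.Path.nil_comp g).symm)))
  | comp_wl {a b c d : V} (f : Quiver.Path a b) (g : Quiver.Path b c) {h k : Quiver.Path c d}
      (x : PreCell C h k) : CellEq E (wl (f.comp g) x)
        (vcomp (ofEq (Quiver.Path.comp_assoc f g h))
          (vcomp (wl f (wl g x)) (ofEq (Quiver.Path.comp_assoc f g k).symm)))
  | wr_nil {a b : V} {f g : Quiver.Path a b} (x : PreCell C f g) :
      CellEq E (wr x Quiver.Path.nil)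
        (vcomp (ofEq (Quiver.Path.comp_nil f)) (vcomp x (ofEq (Quiver.Path.comp_nil g).symm)))
  | wr_comp {a b c d : V} {f g : Quiver.Path a b} (x : PreCell C f g) (h : Quiver.Path b c)
      (k : Quiver.Path c d) : CellEq E (wr x (h.comp k))
        (vcomp (ofEq (Quiver.Path.comp_assoc f h k).symm)
          (vcomp (wr (wr x h) k) (ofEq (Quiver.Path.comp_assoc g h k))))
  | wl_wr {a b c d : V} (f : Quiver.Path a b) {g h : Quiver.Path b c} (x : PreCell C g h)
      (k : Quiver.Path c d) : CellEq E (wr (wl f x) k)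
        (vcomp (ofEq (Quiver.Path.comp_assoc f g k))
          (vcomp (wl f (wr x k)) (ofEq (Quiver.Path.comp_assoc f h k).symm)))
  | exchange {a b c : V} {f g : Quiver.Path a b} {h k : Quiver.Path b c} (x : PreCell C f g)
      (y : PreCell C h k) :
      CellEq E (vcomp (wl f y) (wr x k)) (vcomp (wr x h) (wl g y))

/-- The `2`-category presented by a computad and a family of relations `E` between its formal
pastings: its underlying category is the free category on the quiver. If `E` is empty, it is the
`2`-category freely generated by the computad. -/
def Presented {C : GenCells V} (_ : CellRel C) : Type := V

namespace Presented

variable {C : GenCells V} {E : CellRel C}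

instance : CategoryStruct.{0} (Presented E) where
  Hom a b := Quiver.Path (V := V) a b
  id a := Quiver.Path.nil (V := V) (a := a)
  comp f g := Quiver.Path.comp (V := V) f g

/-- `2`-cells: formal pastings modulo the axioms of a `2`-category and the relations. -/
abbrev Cell (E : CellRel C) {a b : V} (f g : Quiver.Path a b) : Type :=
  Quot (fun x y : PreCell C f g => CellEq E x y)

/-- The `2`-cell given by a formal pasting. -/
abbrev mk₂ {a b : V} {f g : Quiver.Path a b} (x : PreCell C f g) : Cell E f g :=
  Quot.mk _ x

/-- Whiskering on the left. -/
def wl₂ {a b c : V} (f : Quiver.Path a b) {g h : Quiver.Path b c} (x : Cell E g h) :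
    Cell E (f.comp g) (f.comp h) :=
  Quot.map (PreCell.wl f) (fun _ _ hx => CellEq.wl_congr f hx) x

/-- Whiskering on the right. -/
def wr₂ {a b c : V} {f g : Quiver.Path a b} (x : Cell E f g) (h : Quiver.Path b c) :
    Cell E (f.comp h) (g.comp h) :=
  Quot.map (fun y => PreCell.wr y h) (fun _ _ hx => CellEq.wr_congr h hx) x

instance homCategory (a b : Presented E) : Category.{0} (a ⟶ b) where
  Hom f g := Cell (V := V) E f g
  id f := mk₂ (V := V) (.ofEq rfl)
  comp x y := Quot.map₂ PreCell.vcomp (fun _ _ _ h => .vcomp_congr (.refl _) h)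
    (fun _ _ _ h => .vcomp_congr h (.refl _)) x y
  id_comp x := by
    induction x using Quot.inductionOn with | _ x => exact Quot.sound (.id_comp x)
  comp_id x := by
    induction x using Quot.inductionOn with | _ x => exact Quot.sound (.comp_id x)
  assoc x y z := by
    induction x using Quot.inductionOn with | _ x
    induction y using Quot.inductionOn with | _ y
    induction z using Quot.inductionOn with | _ z
    exact Quot.sound (.assoc x y z)

theorem eqToHom_eq {a b : Presented E} {f g : a ⟶ b} (h : f = g) :
    eqToHom h = (mk₂ (V := V) (.ofEq h) : f ⟶ g) := by
  subst h; rfl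

theorem wl₂_eqToHom {a b c : Presented E} (f : a ⟶ b) {g h : b ⟶ c} (e : g = h) :
    (wl₂ (V := V) f (eqToHom e : g ⟶ h) : f ≫ g ⟶ f ≫ h) =
      eqToHom (congrArg (f ≫ ·) e) := by
  subst e; exact Quot.sound (.wl_id (V := V) f g)

theorem wr₂_eqToHom {a b c : Presented E} {f g : a ⟶ b} (e : f = g) (h : b ⟶ c) :
    (wr₂ (V := V) (eqToHom e : f ⟶ g) h : f ≫ h ⟶ g ≫ h) =
      eqToHom (congrArg (· ≫ h) e) := by
  subst e; exact Quot.sound (.id_wr (V := V) f h)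

/-- Presented `2`-categories. -/
instance bicategory : Bicategory.{0, 0} (Presented E) where
  homCategory := homCategory
  whiskerLeft f _ _ x := wl₂ (V := V) f x
  whiskerRight x h := wr₂ (V := V) x h
  associator f g h := eqToIso (Quiver.Path.comp_assoc (V := V) f g h)
  leftUnitor f := eqToIso (Quiver.Path.nil_comp (V := V) f)
  rightUnitor f := eqToIso (Quiver.Path.comp_nil (V := V) f)
  whiskerLeft_id f g := Quot.sound (.wl_id (V := V) f g)
  whiskerLeft_comp f _ _ _ x y := by
    induction x using Quot.inductionOn with | _ x
    induction y using Quot.inductionOn with | _ y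
    exact Quot.sound (.wl_comp (V := V) f x y)
  id_whiskerLeft x := by
    induction x using Quot.inductionOn with | _ x
    rw [eqToIso.hom, eqToIso.inv, eqToHom_eq, eqToHom_eq]
    exact Quot.sound (.nil_wl (V := V) x)
  comp_whiskerLeft f g _ _ x := by
    induction x using Quot.inductionOn with | _ x
    rw [eqToIso.hom, eqToIso.inv, eqToHom_eq, eqToHom_eq]
    exact Quot.sound (.comp_wl (V := V) f g x)
  id_whiskerRight f g := Quot.sound (.id_wr (V := V) f g)
  comp_whiskerRight x y h := by
    induction x using Quot.inductionOn with | _ x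
    induction y using Quot.inductionOn with | _ y
    exact Quot.sound (.comp_wr (V := V) x y h)
  whiskerRight_id x := by
    induction x using Quot.inductionOn with | _ x
    rw [eqToIso.hom, eqToIso.inv, eqToHom_eq, eqToHom_eq]
    exact Quot.sound (.wr_nil (V := V) x)
  whiskerRight_comp x g h := by
    induction x using Quot.inductionOn with | _ x
    rw [eqToIso.hom, eqToIso.inv, eqToHom_eq, eqToHom_eq]
    exact Quot.sound (.wr_comp (V := V) x g h)
  whisker_assoc f _ _ x h := by
    induction x using Quot.inductionOn with | _ x
    rw [eqToIso.hom, eqToIso.inv, eqToHom_eq, eqToHom_eq]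
    exact Quot.sound (.wl_wr (V := V) f x h)
  whisker_exchange x y := by
    induction x using Quot.inductionOn with | _ x
    induction y using Quot.inductionOn with | _ y
    exact Quot.sound (.exchange (V := V) x y)
  pentagon f g h i := by
    simp only [eqToIso.hom, wl₂_eqToHom, wr₂_eqToHom]
    exact (congrArg _ (eqToHom_trans _ _)).trans ((eqToHom_trans _ _).trans (eqToHom_trans _ _).symm)
  triangle f g := by
    simp only [eqToIso.hom, wl₂_eqToHom, wr₂_eqToHom]
    exact eqToHom_trans _ _

instance : Bicategory.Strict (Presented E) where
  id_comp f := Quiver.Path.nil_comp (V := V) f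
  comp_id f := Quiver.Path.comp_nil (V := V) f
  assoc f g h := Quiver.Path.comp_assoc (V := V) f g h
  leftUnitor_eqToIso _ := rfl
  rightUnitor_eqToIso _ := rfl
  associator_eqToIso _ _ _ := rfl

end Presented

end Computads

section Lift

variable {V : Type} [Quiver.{0} V] {C : GenCells V} {E : CellRel C}
  {B : Type u} [Bicategory.{w, v} B]

/-- The value on paths of an assignment of `1`-cells to arrows. -/
def pathMap (F : V ⥤q B) {a : V} :
    ∀ {b : V}, Quiver.Path a b → (F.obj a ⟶ F.obj b)
  | _, .nil => 𝟙 (F.obj a)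
  | _, .cons p e => pathMap F p ≫ F.map e

theorem pathMap_comp [Bicategory.Strict B] (F : V ⥤q B) {a b c : V}
    (p : Quiver.Path a b) (q : Quiver.Path b c) :
    pathMap F (p.comp q) = pathMap F p ≫ pathMap F q := by
  induction q with
  | nil => exact (Bicategory.Strict.comp_id _).symm
  | cons q e ih =>
    change pathMap F (p.comp q) ≫ F.map e = _ ≫ pathMap F q ≫ F.map e
    rw [ih, Bicategory.Strict.assoc]

/-- The value on formal pastings of an assignment of `2`-cells to generating `2`-cells. -/
def cellMap [Bicategory.Strict B] (F : V ⥤q B)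
    (cell : ∀ ⦃a b : V⦄ ⦃f g : Quiver.Path a b⦄, C f g → (pathMap F f ⟶ pathMap F g)) :
    ∀ {a b : V} {f g : Quiver.Path a b}, PreCell C f g → (pathMap F f ⟶ pathMap F g)
  | _, _, _, _, .gen x => cell x
  | _, _, _, _, .ofEq h => eqToHom (congrArg _ h)
  | _, _, _, _, .vcomp x y => cellMap F cell x ≫ cellMap F cell y
  | _, _, _, _, .wl f x => eqToHom (pathMap_comp F _ _) ≫
      pathMap F f ◁ cellMap F cell x ≫ eqToHom (pathMap_comp F _ _).symm
  | _, _, _, _, .wr x h => eqToHom (pathMap_comp F _ _) ≫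
      cellMap F cell x ▷ pathMap F h ≫ eqToHom (pathMap_comp F _ _).symm

theorem cellMap_eq [Bicategory.Strict B] (F : V ⥤q B)
    (cell : ∀ ⦃a b : V⦄ ⦃f g : Quiver.Path a b⦄, C f g → (pathMap F f ⟶ pathMap F g))
    (hE : ∀ ⦃a b : V⦄ ⦃f g : Quiver.Path a b⦄ (x y : PreCell C f g), E x y →
      cellMap F cell x = cellMap F cell y)
    {a b : V} {f g : Quiver.Path a b} {x y : PreCell C f g} (h : CellEq E x y) :
    cellMap F cell x = cellMap F cell y := by
  induction h with
  | rel h => exact hE _ _ h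
  | refl x => rfl
  | symm _ ih => exact ih.symm
  | trans _ _ ih ih' => exact ih.trans ih'
  | vcomp_congr _ _ ih ih' => simp only [cellMap, ih, ih']
  | wl_congr _ _ ih => simp only [cellMap, ih]
  | wr_congr _ _ ih => simp only [cellMap, ih]
  | id_comp x => simp [cellMap]
  | comp_id x => simp [cellMap]
  | assoc x y z => simp [cellMap]
  | wl_id f g => simp [cellMap]
  | wl_comp f x y => simp [cellMap]
  | id_wr f g => simp [cellMap]
  | comp_wr x y k => simp [cellMap]
  | nil_wl x =>
    simp only [cellMap]
    rw [Bicategory.congr_whiskerLeft (show pathMap F Quiver.Path.nil = 𝟙 _ from rfl)]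
    simp [Bicategory.Strict.leftUnitor_eqToIso]
  | comp_wl f g x =>
    simp [cellMap, Bicategory.congr_whiskerLeft (pathMap_comp F f g),
      Bicategory.Strict.associator_eqToIso]
  | wr_nil x =>
    simp only [cellMap]
    rw [Bicategory.whiskerRight_congr (show pathMap F Quiver.Path.nil = 𝟙 _ from rfl)]
    simp only [whiskerRight_id, Bicategory.Strict.rightUnitor_eqToIso, eqToIso.hom, eqToIso.inv,
      Category.assoc, eqToHom_trans, eqToHom_trans_assoc]
  | wr_comp x h k =>
    simp [cellMap, Bicategory.whiskerRight_congr (pathMap_comp F h k),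
      Bicategory.Strict.associator_eqToIso]
  | wl_wr f x k =>
    simp [cellMap, Bicategory.Strict.associator_eqToIso]
  | exchange x y => simp [cellMap, whisker_exchange_assoc]

/-- The universal property of a presented `2`-category. -/
def Presented.lift [Bicategory.Strict B] (F : V ⥤q B)
    (cell : ∀ ⦃a b : V⦄ ⦃f g : Quiver.Path a b⦄, C f g → (pathMap F f ⟶ pathMap F g))
    (hE : ∀ ⦃a b : V⦄ ⦃f g : Quiver.Path a b⦄ (x y : PreCell C f g), E x y →
      cellMap F cell x = cellMap F cell y) :
    StrictPseudofunctor (Presented E) B :=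
  StrictPseudofunctor.mk''
    { obj := F.obj
      map := fun p => pathMap F p
      map₂ := fun x => Quot.lift (cellMap F cell)
        (fun _ _ h => cellMap_eq F cell hE h) x
      map₂_id := fun _ => rfl
      map₂_comp := fun x y => by
        induction x using Quot.inductionOn with | _ x
        induction y using Quot.inductionOn with | _ y
        rfl
      map_id := fun _ => rfl
      map_comp := fun p q => pathMap_comp F p q
      map₂_whisker_left := fun f _ _ x => by
        induction x using Quot.inductionOn with | _ x
        rfl
      map₂_whisker_right := fun x f => by
        induction x using Quot.inductionOn with | _ x
        rfl }

end Lift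

section Delta

/-- The objects `𝟣, 𝟤, 𝟥`. -/
inductive DObj : Type
  | one | two | three

/-- The arrows `d⁰, d¹ : 𝟣 ⟶ 𝟤`, `s⁰ : 𝟤 ⟶ 𝟣` and `∂⁰, ∂¹, ∂² : 𝟤 ⟶ 𝟥`. -/
inductive DArr : DObj → DObj → Type
  | d0 : DArr .one .two
  | d1 : DArr .one .two
  | s0 : DArr .two .one
  | p0 : DArr .two .three
  | p1 : DArr .two .three
  | p2 : DArr .two .three

instance : Quiver.{0} DObj := ⟨DArr⟩

/-- The path consisting of two consecutive arrows. -/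
abbrev path₂ {V : Type} [Quiver.{0} V] {a b c : V} (e : a ⟶ b) (e' : b ⟶ c) : Quiver.Path a c :=
  (Quiver.Path.nil.cons e).cons e'

/-- The generating `2`-cells `σ₀₀ : ∂⁰d⁰ ⇒ ∂¹d⁰`, `σ₂₀ : ∂²d⁰ ⇒ ∂⁰d¹`, `σ₂₁ : ∂²d¹ ⇒ ∂¹d¹`,
`n₀ : id ⇒ s⁰d⁰` and `n₁ : id ⇒ s⁰d¹` (paths are written in diagrammatic order). -/
inductive DCell : ∀ ⦃a b : DObj⦄, Quiver.Path a b → Quiver.Path a b → Type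
  | s00 : DCell (path₂ DArr.d0 DArr.p0) (path₂ DArr.d0 DArr.p1)
  | s20 : DCell (path₂ DArr.d0 DArr.p2) (path₂ DArr.d1 DArr.p0)
  | s21 : DCell (path₂ DArr.d1 DArr.p2) (path₂ DArr.d1 DArr.p1)
  | n0 : DCell (Quiver.Path.nil (a := DObj.one)) (path₂ DArr.d0 DArr.s0)
  | n1 : DCell (Quiver.Path.nil (a := DObj.one)) (path₂ DArr.d1 DArr.s0)

/-- The empty family of relations. -/
def noRel {V : Type} [Quiver.{0} V] (C : GenCells V) : CellRel C := fun _ _ _ _ _ _ => False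

/-- `Δ_ℓ`: the `2`-category freely generated by the computad on `𝟣, 𝟤, 𝟥`. -/
abbrev DeltaL : Type := Presented (noRel DCell)

/-- The objects `𝟢, 𝟣, 𝟤, 𝟥`. -/
inductive DotObj : Type
  | zero | of (x : DObj)

/-- The arrows of `Δ_ℓ` together with `d : 𝟢 ⟶ 𝟣`. -/
inductive DotArr : DotObj → DotObj → Type
  | d : DotArr .zero (.of .one)
  | of {x y : DObj} (e : DArr x y) : DotArr (.of x) (.of y)

instance : Quiver.{0} DotObj := ⟨DotArr⟩

/-- The inclusion of generators. -/
def dotIncl : DObj ⥤q DotObj where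
  obj := DotObj.of
  map e := DotArr.of e

/-- The generating `2`-cells of `Δ_ℓ`, together with `ϑ : d¹d ⇒ d⁰d` and, if `i` holds,
a `2`-cell `d⁰d ⇒ d¹d`. -/
inductive DotCell (i : Prop) : ∀ ⦃a b : DotObj⦄, Quiver.Path a b → Quiver.Path a b → Type
  | of {a b : DObj} {f g : Quiver.Path a b} (x : DCell f g) :
      DotCell i (dotIncl.mapPath f) (dotIncl.mapPath g)
  | theta : DotCell i (path₂ DotArr.d (DotArr.of DArr.d1)) (path₂ DotArr.d (DotArr.of DArr.d0))
  | thetaInv (h : i) :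
      DotCell i (path₂ DotArr.d (DotArr.of DArr.d0)) (path₂ DotArr.d (DotArr.of DArr.d1))

/-- The generating `2`-cells coming from `Δ_ℓ`, as formal pastings. -/
abbrev dotGen (i : Prop) {a b : DObj} {f g : Quiver.Path a b} (x : DCell f g) :
    PreCell (DotCell i) (dotIncl.mapPath f) (dotIncl.mapPath g) := .gen (.of x)

open PreCell in
/-- The associativity equation
`(∂¹ϑ) · (σ₂₁d) = (σ₀₀d) · (∂⁰ϑ) · (σ₂₀d) · (∂²ϑ)`, the identity equation
`(s⁰ϑ) · (n₁d) = n₀d` and, if `i` holds, the equations saying that `ϑ` is invertible. -/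
inductive DotRel (i : Prop) : CellRel (DotCell i)
  | assoc : DotRel i
      (vcomp (wl (Quiver.Hom.toPath DotArr.d) (dotGen i DCell.s21))
        (wr (gen DotCell.theta) (Quiver.Hom.toPath (DotArr.of DArr.p1))))
      (vcomp (wr (gen DotCell.theta) (Quiver.Hom.toPath (DotArr.of DArr.p2)))
        (vcomp (wl (Quiver.Hom.toPath DotArr.d) (dotGen i DCell.s20))
          (vcomp (wr (gen DotCell.theta) (Quiver.Hom.toPath (DotArr.of DArr.p0)))
            (wl (Quiver.Hom.toPath DotArr.d) (dotGen i DCell.s00)))))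
  | unit : DotRel i
      (vcomp (wl (Quiver.Hom.toPath DotArr.d) (dotGen i DCell.n1))
        (wr (gen DotCell.theta) (Quiver.Hom.toPath (DotArr.of DArr.s0))))
      (wl (Quiver.Hom.toPath DotArr.d) (dotGen i DCell.n0))
  | theta_inv (h : i) : DotRel i (vcomp (gen DotCell.theta) (gen (.thetaInv h))) (ofEq rfl)
  | inv_theta (h : i) : DotRel i (vcomp (gen (.thetaInv h)) (gen DotCell.theta)) (ofEq rfl)

/-- The `2`-category `Δ̇_ℓ` (for `i := False`) and the `2`-category `Δ̇` (for `i := True`). -/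
abbrev DeltaDot (i : Prop) : Type := Presented (DotRel i)

/-- The inclusion on objects and arrows, with values in the `2`-category `DeltaDot i`. -/
def deltaInclPre (i : Prop) : DObj ⥤q DeltaDot i where
  obj x := DotObj.of x
  map e := Quiver.Hom.toPath (V := DotObj) (DotArr.of e)

/-- The inclusions `t : Δ_ℓ ⟶ Δ̇_ℓ` and `j : Δ_ℓ ⟶ Δ̇`. -/
def deltaIncl (i : Prop) : StrictPseudofunctor DeltaL (DeltaDot i) :=
  Presented.lift (deltaInclPre i)
    (fun _ _ _ _ x => match x with
      | .s00 => Presented.mk₂ (E := DotRel i) (dotGen i DCell.s00)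
      | .s20 => Presented.mk₂ (E := DotRel i) (dotGen i DCell.s20)
      | .s21 => Presented.mk₂ (E := DotRel i) (dotGen i DCell.s21)
      | .n0 => Presented.mk₂ (E := DotRel i) (dotGen i DCell.n0)
      | .n1 => Presented.mk₂ (E := DotRel i) (dotGen i DCell.n1))
    (fun _ _ _ _ _ _ h => h.elim)

theorem postcomp_id {S : Type u} [Bicategory.{w, v} S] [Bicategory.Strict S] (x s : S) :
    postcomp x (𝟙 s) = 𝟭 (x ⟶ s) :=
  CategoryTheory.Functor.ext (fun f => Bicategory.Strict.comp_id f) (fun f g η => by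
    change η ▷ 𝟙 s = eqToHom _ ≫ η ≫ eqToHom _
    simp [Bicategory.Strict.rightUnitor_eqToIso])

theorem postcomp_comp {S : Type u} [Bicategory.{w, v} S] [Bicategory.Strict S] (x : S) {a b c : S}
    (f : a ⟶ b) (g : b ⟶ c) : postcomp x (f ≫ g) = postcomp x f ⋙ postcomp x g :=
  CategoryTheory.Functor.ext (fun h => (Bicategory.Strict.assoc h f g).symm) (fun h k η => by
    change η ▷ (f ≫ g) = eqToHom _ ≫ (η ▷ f) ▷ g ≫ eqToHom _
    simp [Bicategory.Strict.associator_eqToIso])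

theorem whiskerLeft_whiskerLeft_eq {S : Type u} [Bicategory.{w, v} S] [Bicategory.Strict S]
    {a b c d : S} (h : a ⟶ b) (f : b ⟶ c) {g k : c ⟶ d} (η : g ⟶ k)
    (e : h ≫ f ≫ g = (h ≫ f) ≫ g) (e' : (h ≫ f) ≫ k = h ≫ f ≫ k) :
    h ◁ f ◁ η = eqToHom e ≫ (h ≫ f) ◁ η ≫ eqToHom e' := by
  simp [Bicategory.Strict.associator_eqToIso]

theorem whiskerLeft_whiskerRight_eq {S : Type u} [Bicategory.{w, v} S] [Bicategory.Strict S]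
    {a b c d : S} (h : a ⟶ b) {f g : b ⟶ c} (η : f ⟶ g) (k : c ⟶ d)
    (e : h ≫ f ≫ k = (h ≫ f) ≫ k) (e' : (h ≫ g) ≫ k = h ≫ g ≫ k) :
    h ◁ η ▷ k = eqToHom e ≫ (h ◁ η) ▷ k ≫ eqToHom e' := by
  simp [Bicategory.Strict.associator_eqToIso]

/-- The representable `2`-functor `S(x, -) : S ⟶ Cat` of a `2`-category `S`. -/
def corepr {S : Type u} [Bicategory.{w, v} S] [Bicategory.Strict S] (x : S) :
    StrictPseudofunctor S Cat.{w, v} :=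
  StrictPseudofunctor.mk''
    { obj := fun s => Cat.of (x ⟶ s)
      map := fun f => (postcomp x f).toCatHom
      map₂ := fun η => NatTrans.toCatHom₂ ((postcomposing x _ _).map η)
      map₂_id := fun f => congrArg NatTrans.toCatHom₂ ((postcomposing x _ _).map_id f)
      map₂_comp := fun η θ => congrArg NatTrans.toCatHom₂ ((postcomposing x _ _).map_comp η θ)
      map_id := fun s => congrArg Functor.toCatHom (postcomp_id x s)
      map_comp := fun f g => congrArg Functor.toCatHom (postcomp_comp x f g)
      map₂_whisker_left := fun f _ _ η => by
        ext h
        simp only [Cat.Hom₂.comp_app, Cat.eqToHom_app]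
        exact whiskerLeft_whiskerLeft_eq h f η _ _
      map₂_whisker_right := fun η f => by
        ext h
        simp only [Cat.Hom₂.comp_app, Cat.eqToHom_app]
        exact whiskerLeft_whiskerRight_eq h η f _ _ }

/-- The weights `Δ̇_ℓ(𝟢, t-)` (for `i := False`) and `Δ̇(𝟢, j-)` (for `i := True`). -/
def descentWeight (i : Prop) : StrictPseudofunctor DeltaL Cat.{0, 0} :=
  (deltaIncl i).comp (corepr (S := DeltaDot i) DotObj.zero)

end Delta

section Op

variable {A : Type u} [Bicategory.{w, v} A]

theorem unop2_eqToHom {a b : Aᵒᵖ} {f g : a ⟶ b} (h : f = g) :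
    (eqToHom h).unop2 = eqToHom (congrArg Quiver.Hom.unop h) := by
  subst h; rfl

theorem hom2_ext {a b : Aᵒᵖ} {f g : a ⟶ b} {η θ : f ⟶ g} (h : η.unop2 = θ.unop2) : η = θ := by
  exact congrArg Bicategory.Opposite.Hom2.op2' h

/-- The `1`-cell dual of a `2`-category is a `2`-category. -/
instance opStrict [Bicategory.Strict A] : Bicategory.Strict Aᵒᵖ where
  id_comp f := congrArg Quiver.Hom.op (Bicategory.Strict.comp_id f.unop)
  comp_id f := congrArg Quiver.Hom.op (Bicategory.Strict.id_comp f.unop)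
  assoc f g h := congrArg Quiver.Hom.op (Bicategory.Strict.assoc h.unop g.unop f.unop).symm
  leftUnitor_eqToIso f := Iso.ext (hom2_ext (by
    rw [eqToIso.hom, unop2_eqToHom]
    exact congrArg Iso.hom (Bicategory.Strict.rightUnitor_eqToIso f.unop)))
  rightUnitor_eqToIso f := Iso.ext (hom2_ext (by
    rw [eqToIso.hom, unop2_eqToHom]
    exact congrArg Iso.hom (Bicategory.Strict.leftUnitor_eqToIso f.unop)))
  associator_eqToIso f g h := Iso.ext (hom2_ext (by
    rw [eqToIso.hom, unop2_eqToHom]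
    exact congrArg Iso.inv (Bicategory.Strict.associator_eqToIso h.unop g.unop f.unop)))

/-- A `2`-cell of the `1`-cell dual given by a `2`-cell, up to equalities of `1`-cells. -/
def opCell {a b : Aᵒᵖ} {p q : a ⟶ b} {k l : b.unop ⟶ a.unop} (η : k ⟶ l) (hk : p.unop = k)
    (hl : l = q.unop) : p ⟶ q :=
  Bicategory.Opposite.Hom2.op2' (eqToHom hk ≫ η ≫ eqToHom hl)

end Op

section Weighted

variable {S : Type u} [Bicategory.{w, v} S] [Bicategory.Strict S]
  {A : Type u₁} [Bicategory.{w₁, v₁} A] [Bicategory.Strict A]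

/-- For a weight `W : S ⟶ Cat` and a diagram `D : Sᵒᵖ ⟶ A` (regarded as a `2`-functor
`S ⟶ Aᵒᵖ`, where `ᵒᵖ` reverses only `1`-cells), the `2`-natural transformations
`W ⟶ A(D-, X)`. -/
structure WeightedCocone (W : StrictPseudofunctor S Cat.{w₂, v₂}) (D : StrictPseudofunctor S Aᵒᵖ)
    (X : A) where
  /-- the components -/
  app (s : S) : W.obj s ⥤ ((D.obj s).unop ⟶ X)
  naturality_obj {s t : S} (f : s ⟶ t) (x : W.obj s) :
    (app t).obj ((W.map f).toFunctor.obj x) = (D.map f).unop ≫ (app s).obj x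
  naturality_map {s t : S} (f : s ⟶ t) {x y : W.obj s} (k : x ⟶ y) :
    (app t).map ((W.map f).toFunctor.map k) =
      eqToHom (naturality_obj f x) ≫ (D.map f).unop ◁ (app s).map k ≫
        eqToHom (naturality_obj f y).symm
  naturality₂ {s t : S} {f g : s ⟶ t} (α : f ⟶ g) (x : W.obj s) :
    (app t).map ((W.map₂ α).toNatTrans.app x) =
      eqToHom (naturality_obj f x) ≫
        (D.map₂ α).unop2 ▷ (app s).obj x ≫
          eqToHom (naturality_obj g x).symm

theorem conj_whiskerRight_eq {a b c d : A} {p q : a ⟶ c} {f g : a ⟶ b} {k : b ⟶ c} (η : f ⟶ g)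
    (e : p = f ≫ k) (e' : g ≫ k = q) (h : c ⟶ d) (e₁ : p ≫ h = f ≫ k ≫ h)
    (e₂ : g ≫ k ≫ h = q ≫ h) :
    (eqToHom e ≫ η ▷ k ≫ eqToHom e') ▷ h = eqToHom e₁ ≫ η ▷ (k ≫ h) ≫ eqToHom e₂ := by
  subst e e'
  simp [Bicategory.Strict.associator_eqToIso]

namespace WeightedCocone

variable {W : StrictPseudofunctor S Cat.{w₂, v₂}} {D : StrictPseudofunctor S Aᵒᵖ}

/-- Modifications between `2`-natural transformations `W ⟶ A(D-, X)`. -/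
@[ext]
structure Hom {X : A} (φ ψ : WeightedCocone W D X) where
  /-- the components -/
  app (s : S) : φ.app s ⟶ ψ.app s
  comm {s t : S} (f : s ⟶ t) (x : W.obj s) :
    (app t).app ((W.map f).toFunctor.obj x) =
      eqToHom (φ.naturality_obj f x) ≫
        (D.map f).unop ◁ (app s).app x ≫
          eqToHom (ψ.naturality_obj f x).symm

/-- The category `[S, Cat](W, A(D-, X))`. -/
instance (X : A) : Category (WeightedCocone W D X) where
  Hom φ ψ := Hom φ ψ
  id φ := { app := fun s => 𝟙 (φ.app s), comm := fun f x => by simp }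
  comp Γ Θ := { app := fun s => Γ.app s ≫ Θ.app s, comm := fun f x => by simp [Γ.comm, Θ.comm] }
  id_comp Γ := Hom.ext (funext fun s => Category.id_comp _)
  comp_id Γ := Hom.ext (funext fun s => Category.comp_id _)
  assoc Γ Θ Λ := Hom.ext (funext fun s => Category.assoc _ _ _)

/-- Whiskering a cocone with vertex `c` by a `1`-cell `c ⟶ X`. -/
def post {c : A} (φ : WeightedCocone W D c) {X : A} (h : c ⟶ X) : WeightedCocone W D X where
  app s := φ.app s ⋙ postcomp _ h
  naturality_obj f x :=
    (congrArg (· ≫ h) (φ.naturality_obj f x)).trans (Bicategory.Strict.assoc _ _ _)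
  naturality_map {s t} f {x y} k := by
    change (φ.app t).map ((W.map f).toFunctor.map k) ▷ h =
      eqToHom _ ≫ (D.map f).unop ◁ ((φ.app s).map k ▷ h) ≫ eqToHom _
    rw [φ.naturality_map]
    simp [Bicategory.Strict.associator_eqToIso]
  naturality₂ {s t f g} α x := by
    change (φ.app t).map ((W.map₂ α).toNatTrans.app x) ▷ h =
      eqToHom _ ≫ (D.map₂ α).unop2 ▷ ((φ.app s).obj x ≫ h) ≫ eqToHom _
    rw [φ.naturality₂]
    exact conj_whiskerRight_eq _ _ _ _ _ _

/-- The functor `A(c, X) ⥤ [S, Cat](W, A(D-, X))` induced by a cocone with vertex `c`. -/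
def postFunctor {c : A} (φ : WeightedCocone W D c) (X : A) : (c ⟶ X) ⥤ WeightedCocone W D X where
  obj h := φ.post h
  map {h k} η :=
    { app := fun s => Functor.whiskerLeft (φ.app s) ((postcomposing _ _ _).map η)
      comm := fun {s t} f x => by
        change (φ.app t).obj ((W.map f).toFunctor.obj x) ◁ η =
          eqToHom _ ≫ (D.map f).unop ◁ ((φ.app s).obj x ◁ η) ≫ eqToHom _
        rw [Bicategory.congr_whiskerLeft (φ.naturality_obj f x)]
        simp [Bicategory.Strict.associator_eqToIso] }
  map_id h := Hom.ext (funext fun s => by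
    ext x; exact Bicategory.whiskerLeft_id _ _)
  map_comp η θ := Hom.ext (funext fun s => by
    ext x; exact Bicategory.whiskerLeft_comp _ _ _)

/-- A cocone is universal if, for every `X`, the induced functor
`A(c, X) ⥤ [S, Cat](W, A(D-, X))` is an isomorphism of categories. -/
def IsUniversal {c : A} (φ : WeightedCocone W D c) : Prop :=
  ∀ X : A, ∃ G : WeightedCocone W D X ⥤ (c ⟶ X),
    φ.postFunctor X ⋙ G = 𝟭 _ ∧ G ⋙ φ.postFunctor X = 𝟭 _

end WeightedCocone

/-- `c` is the (strict) weighted colimit of `D` with weight `W`. -/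
def IsWeightedColimit (W : StrictPseudofunctor S Cat.{w₂, v₂}) (D : StrictPseudofunctor S Aᵒᵖ)
    (c : A) : Prop :=
  ∃ φ : WeightedCocone W D c, φ.IsUniversal

/-- `c` is the strict lax codescent object of `D`. -/
def IsStrictLaxCodescentObject (D : StrictPseudofunctor DeltaL Aᵒᵖ) (c : A) : Prop :=
  IsWeightedColimit (descentWeight False) D c

/-- `c` is the strict codescent object of `D`. -/
def IsStrictCodescentObject (D : StrictPseudofunctor DeltaL Aᵒᵖ) (c : A) : Prop :=
  IsWeightedColimit (descentWeight True) D c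

end Weighted

section Strict

variable {B : Type u} [Bicategory.{w, v} B] {C : Type u₁} [Bicategory.{w₁, v₁} C]

theorem map_comp_whiskerLeft_eq (F : StrictPseudofunctor B C) [Bicategory.Strict C] {a b c : B}
    (f : a ⟶ b) (g : b ⟶ c) {d : C} {h k : F.obj c ⟶ d} (η : h ⟶ k) :
    F.map (f ≫ g) ◁ η = eqToHom (by rw [F.map_comp, Bicategory.Strict.assoc]) ≫
      F.map f ◁ F.map g ◁ η ≫ eqToHom (by rw [F.map_comp, Bicategory.Strict.assoc]) := by
  rw [Bicategory.congr_whiskerLeft (F.map_comp f g)]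
  simp [Bicategory.Strict.associator_eqToIso]

end Strict

/-- A `2`-monad on a `2`-category: a `2`-functor with `2`-natural multiplication and unit. -/
structure TwoMonad (B : Type u) [Bicategory.{w, v} B] [Bicategory.Strict B] where
  /-- the underlying `2`-functor -/
  T : StrictPseudofunctor B B
  /-- the multiplication -/
  mul (X : B) : T.obj (T.obj X) ⟶ T.obj X
  mul_naturality {X Y : B} (f : X ⟶ Y) : T.map (T.map f) ≫ mul Y = mul X ≫ T.map f
  mul_naturality₂ {X Y : B} {f g : X ⟶ Y} (η : f ⟶ g) :
    T.map₂ (T.map₂ η) ▷ mul Y =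
      eqToHom (mul_naturality f) ≫ mul X ◁ T.map₂ η ≫ eqToHom (mul_naturality g).symm
  /-- the unit -/
  unit (X : B) : X ⟶ T.obj X
  unit_naturality {X Y : B} (f : X ⟶ Y) : f ≫ unit Y = unit X ≫ T.map f
  unit_naturality₂ {X Y : B} {f g : X ⟶ Y} (η : f ⟶ g) :
    η ▷ unit Y =
      eqToHom (unit_naturality f) ≫ unit X ◁ T.map₂ η ≫ eqToHom (unit_naturality g).symm
  mul_assoc (X : B) : T.map (mul X) ≫ mul X = mul (T.obj X) ≫ mul X
  unit_mul (X : B) : unit (T.obj X) ≫ mul X = 𝟙 (T.obj X)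
  map_unit_mul (X : B) : T.map (unit X) ≫ mul X = 𝟙 (T.obj X)

/-- A `2`-adjunction `L ⊣ R`: `2`-natural unit and counit satisfying the triangle identities. -/
structure TwoAdjunction {A : Type u₁} [Bicategory.{w₁, v₁} A] [Bicategory.Strict A]
    {B : Type u} [Bicategory.{w, v} B] [Bicategory.Strict B]
    (L : StrictPseudofunctor B A) (R : StrictPseudofunctor A B) where
  /-- the unit -/
  unit (X : B) : X ⟶ R.obj (L.obj X)
  unit_naturality {X Y : B} (f : X ⟶ Y) : f ≫ unit Y = unit X ≫ R.map (L.map f)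
  unit_naturality₂ {X Y : B} {f g : X ⟶ Y} (η : f ⟶ g) :
    η ▷ unit Y =
      eqToHom (unit_naturality f) ≫ unit X ◁ R.map₂ (L.map₂ η) ≫ eqToHom (unit_naturality g).symm
  /-- the counit -/
  counit (X : A) : L.obj (R.obj X) ⟶ X
  counit_naturality {X Y : A} (f : X ⟶ Y) : L.map (R.map f) ≫ counit Y = counit X ≫ f
  counit_naturality₂ {X Y : A} {f g : X ⟶ Y} (η : f ⟶ g) :
    L.map₂ (R.map₂ η) ▷ counit Y =
      eqToHom (counit_naturality f) ≫ counit X ◁ η ≫ eqToHom (counit_naturality g).symm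
  left_triangle (X : B) : L.map (unit X) ≫ counit (L.obj X) = 𝟙 (L.obj X)
  right_triangle (X : A) : unit (R.obj X) ≫ R.map (counit X) = 𝟙 (R.obj X)

section LaxAlgebras

variable {B : Type u} [Bicategory.{w, v} B] [Bicategory.Strict B]

namespace TwoMonad

variable (M : TwoMonad B)

theorem map_map_comp {X Y Z : B} (f : X ⟶ Y) (g : Y ⟶ Z) {W : B} (k : M.T.obj Z ⟶ W) :
    M.T.map (f ≫ g) ≫ k = M.T.map f ≫ M.T.map g ≫ k := by
  rw [M.T.map_comp, Bicategory.Strict.assoc]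

theorem mul_naturality_assoc {X Y : B} (f : X ⟶ Y) {W : B} (k : M.T.obj Y ⟶ W) :
    M.T.map (M.T.map f) ≫ M.mul Y ≫ k = M.mul X ≫ M.T.map f ≫ k := by
  rw [← Bicategory.Strict.assoc, M.mul_naturality, Bicategory.Strict.assoc]

theorem unit_naturality_assoc {X Y : B} (f : X ⟶ Y) {W : B} (k : M.T.obj Y ⟶ W) :
    f ≫ M.unit Y ≫ k = M.unit X ≫ M.T.map f ≫ k := by
  rw [← Bicategory.Strict.assoc, M.unit_naturality, Bicategory.Strict.assoc]

theorem mul_assoc_assoc {X W : B} (k : M.T.obj X ⟶ W) :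
    M.T.map (M.mul X) ≫ M.mul X ≫ k = M.mul (M.T.obj X) ≫ M.mul X ≫ k := by
  rw [← Bicategory.Strict.assoc, M.mul_assoc, Bicategory.Strict.assoc]

theorem unit_mul_assoc {X W : B} (k : M.T.obj X ⟶ W) :
    M.unit (M.T.obj X) ≫ M.mul X ≫ k = k := by
  rw [← Bicategory.Strict.assoc, M.unit_mul, Bicategory.Strict.id_comp]

theorem map_unit_mul_assoc {X W : B} (k : M.T.obj X ⟶ W) :
    M.T.map (M.unit X) ≫ M.mul X ≫ k = k := by
  rw [← Bicategory.Strict.assoc, M.map_unit_mul, Bicategory.Strict.id_comp]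

theorem map_id_comp {X W : B} (k : M.T.obj X ⟶ W) : M.T.map (𝟙 X) ≫ k = k := by
  rw [M.T.map_id, Bicategory.Strict.id_comp]

theorem mul_swap {X Y : B} (f : X ⟶ Y) {W : B} {k l : M.T.obj Y ⟶ W} (η : k ⟶ l) :
    M.mul X ◁ M.T.map f ◁ η = eqToHom (M.mul_naturality_assoc f k).symm ≫
      M.T.map (M.T.map f) ◁ M.mul Y ◁ η ≫ eqToHom (M.mul_naturality_assoc f l) := by
  have h := Bicategory.congr_whiskerLeft (M.mul_naturality f) η
  simp only [comp_whiskerLeft, Bicategory.Strict.associator_eqToIso, eqToIso.hom, eqToIso.inv,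
    Category.assoc, eqToHom_trans, eqToHom_trans_assoc] at h
  rw [eqToHom_comp_iff, comp_eqToHom_iff] at h
  rw [h]
  simp

theorem unit_swap {X Y : B} (f : X ⟶ Y) {W : B} {k l : M.T.obj Y ⟶ W} (η : k ⟶ l) :
    M.unit X ◁ M.T.map f ◁ η = eqToHom (M.unit_naturality_assoc f k).symm ≫
      f ◁ M.unit Y ◁ η ≫ eqToHom (M.unit_naturality_assoc f l) := by
  have h := Bicategory.congr_whiskerLeft (M.unit_naturality f) η
  simp only [comp_whiskerLeft, Bicategory.Strict.associator_eqToIso, eqToIso.hom, eqToIso.inv,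
    Category.assoc, eqToHom_trans, eqToHom_trans_assoc] at h
  rw [eqToHom_comp_iff, comp_eqToHom_iff] at h
  rw [h]
  simp

end TwoMonad

/-- Lax algebras of a `2`-monad. Composites of `1`-cells are written in diagrammatic order. -/
structure LaxAlg (M : TwoMonad B) where
  /-- the underlying object `Z` -/
  carrier : B
  /-- the structure `1`-cell `a : T Z ⟶ Z` -/
  act : M.T.obj carrier ⟶ carrier
  /-- the `2`-cell `a T(a) ⇒ a m` -/
  mulCell : M.T.map act ≫ act ⟶ M.mul carrier ≫ act
  /-- the `2`-cell `id ⇒ a η` -/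
  unitCell : 𝟙 carrier ⟶ M.unit carrier ≫ act
  assoc :
    eqToHom (M.map_map_comp _ _ _).symm ≫ M.T.map₂ mulCell ▷ act ≫
        eqToHom (M.map_map_comp _ _ _) ≫ M.T.map (M.mul carrier) ◁ mulCell ≫
          eqToHom (M.mul_assoc_assoc act) =
      M.T.map (M.T.map act) ◁ mulCell ≫ eqToHom (M.mul_naturality_assoc act act) ≫
        M.mul (M.T.obj carrier) ◁ mulCell
  left_unit :
    eqToHom (Bicategory.Strict.comp_id act).symm ≫ act ◁ unitCell ≫
        eqToHom (M.unit_naturality_assoc act act) ≫ M.unit (M.T.obj carrier) ◁ mulCell ≫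
          eqToHom (M.unit_mul_assoc act) = 𝟙 act
  right_unit :
    eqToHom (M.map_id_comp act).symm ≫ M.T.map₂ unitCell ▷ act ≫
        eqToHom (M.map_map_comp _ _ _) ≫ M.T.map (M.unit carrier) ◁ mulCell ≫
          eqToHom (M.map_unit_mul_assoc act) = 𝟙 act

namespace LaxAlg

variable {M : TwoMonad B}

/-- Lax morphisms `(f, ⟨f⟩)` of lax algebras, with `⟨f⟩ : a_z T(f) ⇒ f a_y`. -/
structure Mor (y z : LaxAlg M) where
  /-- the underlying `1`-cell -/
  hom : y.carrier ⟶ z.carrier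
  /-- the structure `2`-cell -/
  cell : M.T.map hom ≫ z.act ⟶ y.act ≫ hom
  mul_cell :
    M.T.map (M.T.map hom) ◁ z.mulCell ≫ eqToHom (M.mul_naturality_assoc hom z.act) ≫
        M.mul y.carrier ◁ cell =
      eqToHom (M.map_map_comp _ _ _).symm ≫ M.T.map₂ cell ▷ z.act ≫
        eqToHom (M.map_map_comp _ _ _) ≫ M.T.map y.act ◁ cell ≫
          eqToHom (Bicategory.Strict.assoc _ _ _).symm ≫ y.mulCell ▷ hom ≫
            eqToHom (Bicategory.Strict.assoc _ _ _)
  unit_cell :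
    eqToHom (Bicategory.Strict.comp_id hom).symm ≫ hom ◁ z.unitCell ≫
        eqToHom (M.unit_naturality_assoc hom z.act) ≫ M.unit y.carrier ◁ cell =
      eqToHom (Bicategory.Strict.id_comp hom).symm ≫ y.unitCell ▷ hom ≫
        eqToHom (Bicategory.Strict.assoc _ _ _)

/-- `T`-transformations between lax morphisms. -/
@[ext]
structure Mor₂ {y z : LaxAlg M} (f h : Mor y z) where
  /-- the underlying `2`-cell -/
  hom : f.hom ⟶ h.hom
  comm : M.T.map₂ hom ▷ z.act ≫ h.cell = f.cell ≫ y.act ◁ hom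

/-- The identity morphism. -/
def Mor.id (y : LaxAlg M) : Mor y y where
  hom := 𝟙 y.carrier
  cell := eqToHom ((M.map_id_comp y.act).trans (Bicategory.Strict.comp_id y.act).symm)
  mul_cell := by
    rw [Bicategory.congr_whiskerLeft (show M.T.map (M.T.map (𝟙 y.carrier)) = 𝟙 _ by
      rw [M.T.map_id, M.T.map_id])]
    simp [PrelaxFunctor.map₂_eqToHom, Bicategory.Strict.leftUnitor_eqToIso,
      Bicategory.Strict.rightUnitor_eqToIso]
  unit_cell := by
    simp [Bicategory.Strict.leftUnitor_eqToIso, Bicategory.Strict.rightUnitor_eqToIso]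

/-- Composition of lax morphisms. -/
def Mor.comp {x y z : LaxAlg M} (f : Mor x y) (g : Mor y z) : Mor x z where
  hom := f.hom ≫ g.hom
  cell := eqToHom (M.map_map_comp _ _ _) ≫ M.T.map f.hom ◁ g.cell ≫
    eqToHom (Bicategory.Strict.assoc _ _ _).symm ≫ f.cell ▷ g.hom ≫
      eqToHom (Bicategory.Strict.assoc _ _ _)
  mul_cell := by
    have e₁ : M.T.map (M.T.map f.hom) ≫ M.mul y.carrier ≫ y.act ≫ g.hom =
        (M.mul x.carrier ≫ M.T.map f.hom ≫ y.act) ≫ g.hom := by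
      simp only [M.mul_naturality_assoc, Bicategory.Strict.assoc]
    have e₂ : (M.mul x.carrier ≫ x.act ≫ f.hom) ≫ g.hom =
        M.mul x.carrier ≫ x.act ≫ f.hom ≫ g.hom := by
      simp only [Bicategory.Strict.assoc]
    have e₃ : M.T.map (M.T.map (f.hom ≫ g.hom)) ≫ M.T.map z.act ≫ z.act =
        M.T.map (M.T.map f.hom) ≫ M.T.map (M.T.map g.hom ≫ z.act) ≫ z.act := by
      simp only [M.T.map_comp, Bicategory.Strict.assoc]
    have e₄ : M.T.map (M.T.map f.hom) ≫ M.T.map (y.act ≫ g.hom) ≫ z.act =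
        M.T.map (M.T.map f.hom ≫ y.act) ≫ M.T.map g.hom ≫ z.act := by
      simp only [M.T.map_comp, Bicategory.Strict.assoc]
    have e₅ : M.T.map (M.T.map f.hom ≫ y.act) ≫ y.act ≫ g.hom =
        (M.T.map (M.T.map f.hom) ≫ M.T.map y.act ≫ y.act) ≫ g.hom := by
      simp only [M.T.map_comp, Bicategory.Strict.assoc]
    have e₆ : M.T.map (x.act ≫ f.hom) ≫ y.act ≫ g.hom =
        (M.T.map x.act ≫ M.T.map f.hom ≫ y.act) ≫ g.hom := by
      simp only [M.T.map_comp, Bicategory.Strict.assoc]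
    have e₇ : (M.T.map x.act ≫ x.act ≫ f.hom) ≫ g.hom =
        ((M.T.map x.act ≫ x.act) ≫ f.hom) ≫ g.hom := by
      simp only [Bicategory.Strict.assoc]
    have e₈ : ((M.mul x.carrier ≫ x.act) ≫ f.hom) ≫ g.hom =
        M.mul x.carrier ≫ x.act ≫ f.hom ≫ g.hom := by
      simp only [Bicategory.Strict.assoc]
    have e₀ : M.T.map (M.T.map (f.hom ≫ g.hom)) =
        M.T.map (M.T.map f.hom) ≫ M.T.map (M.T.map g.hom) := by
      rw [M.T.map_comp, M.T.map_comp]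
    calc
      _ = eqToHom (by rw [e₀, Bicategory.Strict.assoc]) ≫
          (M.T.map (M.T.map f.hom) ◁ (M.T.map (M.T.map g.hom) ◁ z.mulCell ≫
            eqToHom (M.mul_naturality_assoc g.hom z.act) ≫ M.mul y.carrier ◁ g.cell)) ≫
          eqToHom e₁ ≫ (M.mul x.carrier ◁ f.cell) ▷ g.hom ≫ eqToHom e₂ := by
        rw [Bicategory.congr_whiskerLeft e₀]
        simp [Bicategory.Strict.associator_eqToIso, M.mul_swap]
      _ = eqToHom e₃ ≫ M.T.map (M.T.map f.hom) ◁ (M.T.map₂ g.cell ▷ z.act) ≫ eqToHom e₄ ≫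
          M.T.map (M.T.map f.hom ≫ y.act) ◁ g.cell ≫ eqToHom e₅ ≫
          (M.T.map (M.T.map f.hom) ◁ y.mulCell ≫
            eqToHom (M.mul_naturality_assoc f.hom y.act) ≫ M.mul x.carrier ◁ f.cell) ▷ g.hom ≫
          eqToHom e₂ := by
        rw [g.mul_cell]
        simp [Bicategory.Strict.associator_eqToIso, map_comp_whiskerLeft_eq]
      _ = eqToHom e₃ ≫ M.T.map (M.T.map f.hom) ◁ (M.T.map₂ g.cell ▷ z.act) ≫ eqToHom e₄ ≫
          (M.T.map (M.T.map f.hom ≫ y.act) ◁ g.cell ≫ M.T.map₂ f.cell ▷ (y.act ≫ g.hom)) ≫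
          eqToHom e₆ ≫ (M.T.map x.act ◁ f.cell) ▷ g.hom ≫ eqToHom e₇ ≫
          (x.mulCell ▷ f.hom) ▷ g.hom ≫ eqToHom e₈ := by
        rw [f.mul_cell]
        simp [Bicategory.Strict.associator_eqToIso]
      _ = _ := by
        rw [whisker_exchange]
        simp [Bicategory.Strict.associator_eqToIso, map_comp_whiskerLeft_eq,
          M.T.mapComp_eq_eqToIso, PrelaxFunctor.map₂_eqToHom]
  unit_cell := by
    calc
      _ = (f.hom ◁ (eqToHom (Bicategory.Strict.comp_id g.hom).symm ≫ g.hom ◁ z.unitCell ≫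
            eqToHom (M.unit_naturality_assoc g.hom z.act) ≫ M.unit y.carrier ◁ g.cell)) ≫
          eqToHom (by rw [M.unit_naturality_assoc, ← Bicategory.Strict.assoc (M.T.map _),
            ← Bicategory.Strict.assoc (M.unit _)]) ≫ (M.unit x.carrier ◁ f.cell) ▷ g.hom ≫
          eqToHom (by simp only [Bicategory.Strict.assoc]) := by
        simp [Bicategory.Strict.associator_eqToIso, M.unit_swap]
      _ = eqToHom rfl ≫ (eqToHom (Bicategory.Strict.comp_id f.hom).symm ≫ f.hom ◁ y.unitCell ≫
            eqToHom (M.unit_naturality_assoc f.hom y.act) ≫ M.unit x.carrier ◁ f.cell) ▷ g.hom ≫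
          eqToHom (by simp only [Bicategory.Strict.assoc]) := by
        rw [g.unit_cell]
        simp [Bicategory.Strict.associator_eqToIso]
      _ = _ := by
        rw [f.unit_cell]
        simp [Bicategory.Strict.associator_eqToIso]

instance : CategoryStruct (LaxAlg M) where
  Hom := Mor
  id := Mor.id
  comp := Mor.comp

instance homCategory (y z : LaxAlg M) : Category (y ⟶ z) where
  Hom f h := Mor₂ f h
  id f := { hom := 𝟙 f.hom, comm := by simp }
  comp η θ :=
    { hom := η.hom ≫ θ.hom
      comm := by
        rw [M.T.map₂_comp, comp_whiskerRight, Category.assoc, θ.comm, ← Category.assoc, η.comm,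
          Category.assoc, ← whiskerLeft_comp] }
  id_comp η := Mor₂.ext (Category.id_comp _)
  comp_id η := Mor₂.ext (Category.comp_id _)
  assoc η θ κ := Mor₂.ext (Category.assoc _ _ _)

/-- An equality of underlying `1`-cells compatible with the structure `2`-cells gives an equality
of morphisms. -/
theorem Mor.ext_of_eqToHom {y z : LaxAlg M} {f g : y ⟶ z} (h : f.hom = g.hom)
    (e : M.T.map₂ (eqToHom h) ▷ z.act ≫ g.cell = f.cell ≫ y.act ◁ eqToHom h) : f = g := by
  obtain ⟨f, c, _, _⟩ := f
  obtain ⟨g, c', _, _⟩ := g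
  obtain rfl : f = g := h
  obtain rfl : c' = c := by simpa using e
  rfl

/-- An invertible `T`-transformation from an invertible `2`-cell. -/
def isoMk {y z : LaxAlg M} {f g : y ⟶ z} (i : f.hom ≅ g.hom)
    (e : M.T.map₂ i.hom ▷ z.act ≫ g.cell = f.cell ≫ y.act ◁ i.hom) : f ≅ g where
  hom := ⟨i.hom, e⟩
  inv := ⟨i.inv, by
    have h : M.T.map₂ i.inv ▷ z.act ≫ M.T.map₂ i.hom ▷ z.act = 𝟙 _ := by
      rw [← comp_whiskerRight, ← M.T.map₂_comp, i.inv_hom_id]; simp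
    have h' : y.act ◁ i.hom ≫ y.act ◁ i.inv = 𝟙 _ := by
      rw [← whiskerLeft_comp, i.hom_inv_id]; simp
    calc
      _ = M.T.map₂ i.inv ▷ z.act ≫ (f.cell ≫ y.act ◁ i.hom) ≫ y.act ◁ i.inv := by
        rw [Category.assoc, h', Category.comp_id]
      _ = _ := by rw [← e, Category.assoc, ← Category.assoc, h, Category.id_comp]⟩
  hom_inv_id := Mor₂.ext i.hom_inv_id
  inv_hom_id := Mor₂.ext i.inv_hom_id

theorem assoc_comm {x y z t : LaxAlg M} (f : x ⟶ y) (g : y ⟶ z) (h : z ⟶ t) :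
    M.T.map₂ (α_ f.hom g.hom h.hom).hom ▷ t.act ≫ (Mor.comp f (Mor.comp g h)).cell =
      (Mor.comp (Mor.comp f g) h).cell ≫ x.act ◁ (α_ f.hom g.hom h.hom).hom := by
  simp [Mor.comp, Bicategory.Strict.associator_eqToIso, PrelaxFunctor.map₂_eqToHom,
    map_comp_whiskerLeft_eq]

theorem left_unit_comm {y z : LaxAlg M} (f : y ⟶ z) :
    M.T.map₂ (λ_ f.hom).hom ▷ z.act ≫ f.cell =
      (Mor.comp (Mor.id y) f).cell ≫ y.act ◁ (λ_ f.hom).hom := by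
  simp [Mor.comp, Mor.id, Bicategory.Strict.leftUnitor_eqToIso, PrelaxFunctor.map₂_eqToHom,
    Bicategory.congr_whiskerLeft (M.T.map_id y.carrier)]

theorem right_unit_comm {y z : LaxAlg M} (f : y ⟶ z) :
    M.T.map₂ (ρ_ f.hom).hom ▷ z.act ≫ f.cell =
      (Mor.comp f (Mor.id z)).cell ≫ y.act ◁ (ρ_ f.hom).hom := by
  simp [Mor.comp, Mor.id, Bicategory.Strict.rightUnitor_eqToIso, PrelaxFunctor.map₂_eqToHom]

theorem whiskerLeft_comm {x y z : LaxAlg M} (f : x ⟶ y) {g h : y ⟶ z} (η : g ⟶ h) :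
    M.T.map₂ (f.hom ◁ η.hom) ▷ z.act ≫ (Mor.comp f h).cell =
      (Mor.comp f g).cell ≫ x.act ◁ f.hom ◁ η.hom := by
  have e₁ : M.T.map (f.hom ≫ g.hom) ≫ z.act = M.T.map f.hom ≫ M.T.map g.hom ≫ z.act :=
    M.map_map_comp _ _ _
  have e₂ : M.T.map f.hom ≫ y.act ≫ h.hom = (M.T.map f.hom ≫ y.act) ≫ h.hom :=
    (Bicategory.Strict.assoc _ _ _).symm
  have e₃ : (x.act ≫ f.hom) ≫ h.hom = x.act ≫ f.hom ≫ h.hom := Bicategory.Strict.assoc _ _ _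
  have e₄ : M.T.map f.hom ≫ y.act ≫ g.hom = (M.T.map f.hom ≫ y.act) ≫ g.hom :=
    (Bicategory.Strict.assoc _ _ _).symm
  calc
    _ = eqToHom e₁ ≫ M.T.map f.hom ◁ (M.T.map₂ η.hom ▷ z.act ≫ h.cell) ≫ eqToHom e₂ ≫
        f.cell ▷ h.hom ≫ eqToHom e₃ := by
      simp [Mor.comp, Bicategory.Strict.associator_eqToIso, M.T.mapComp_eq_eqToIso]
    _ = eqToHom e₁ ≫ M.T.map f.hom ◁ g.cell ≫ eqToHom e₄ ≫
        ((M.T.map f.hom ≫ y.act) ◁ η.hom ≫ f.cell ▷ h.hom) ≫ eqToHom e₃ := by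
      rw [η.comm]
      simp [Bicategory.Strict.associator_eqToIso]
    _ = _ := by
      rw [whisker_exchange]
      simp [Mor.comp, Bicategory.Strict.associator_eqToIso]

theorem whiskerRight_comm {x y z : LaxAlg M} {f g : x ⟶ y} (η : f ⟶ g) (h : y ⟶ z) :
    M.T.map₂ (η.hom ▷ h.hom) ▷ z.act ≫ (Mor.comp g h).cell =
      (Mor.comp f h).cell ≫ x.act ◁ η.hom ▷ h.hom := by
  have e₁ : M.T.map (f.hom ≫ h.hom) ≫ z.act = M.T.map f.hom ≫ M.T.map h.hom ≫ z.act :=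
    M.map_map_comp _ _ _
  have e₂ : M.T.map g.hom ≫ y.act ≫ h.hom = (M.T.map g.hom ≫ y.act) ≫ h.hom :=
    (Bicategory.Strict.assoc _ _ _).symm
  have e₃ : (x.act ≫ g.hom) ≫ h.hom = x.act ≫ g.hom ≫ h.hom := Bicategory.Strict.assoc _ _ _
  have e₄ : M.T.map f.hom ≫ y.act ≫ h.hom = (M.T.map f.hom ≫ y.act) ≫ h.hom :=
    (Bicategory.Strict.assoc _ _ _).symm
  calc
    _ = eqToHom e₁ ≫ (M.T.map₂ η.hom ▷ (M.T.map h.hom ≫ z.act) ≫ M.T.map g.hom ◁ h.cell) ≫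
        eqToHom e₂ ≫ g.cell ▷ h.hom ≫ eqToHom e₃ := by
      simp [Mor.comp, Bicategory.Strict.associator_eqToIso, M.T.mapComp_eq_eqToIso]
    _ = eqToHom e₁ ≫ M.T.map f.hom ◁ h.cell ≫ eqToHom e₄ ≫
        (M.T.map₂ η.hom ▷ y.act ≫ g.cell) ▷ h.hom ≫ eqToHom e₃ := by
      rw [← whisker_exchange]
      simp [Bicategory.Strict.associator_eqToIso]
    _ = _ := by
      rw [η.comm]
      simp [Mor.comp, Bicategory.Strict.associator_eqToIso]

/-- The `2`-category `Lax-T-Alg_ℓ` of lax algebras, lax morphisms and `T`-transformations. -/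
instance bicategory : Bicategory (LaxAlg M) where
  homCategory := homCategory
  whiskerLeft f _ _ η :=
    { hom := f.hom ◁ η.hom
      comm := whiskerLeft_comm f η }
  whiskerRight η h :=
    { hom := η.hom ▷ h.hom
      comm := whiskerRight_comm η h }
  associator f g h := isoMk (α_ f.hom g.hom h.hom) (assoc_comm f g h)
  leftUnitor f := isoMk (λ_ f.hom) (left_unit_comm f)
  rightUnitor f := isoMk (ρ_ f.hom) (right_unit_comm f)
  whiskerLeft_id _ _ := Mor₂.ext (Bicategory.whiskerLeft_id _ _)
  whiskerLeft_comp _ _ _ _ _ _ := Mor₂.ext (Bicategory.whiskerLeft_comp _ _ _)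
  id_whiskerLeft _ := Mor₂.ext (Bicategory.id_whiskerLeft _)
  comp_whiskerLeft _ _ _ _ _ := Mor₂.ext (Bicategory.comp_whiskerLeft _ _ _)
  id_whiskerRight _ _ := Mor₂.ext (Bicategory.id_whiskerRight _ _)
  comp_whiskerRight _ _ _ := Mor₂.ext (Bicategory.comp_whiskerRight _ _ _)
  whiskerRight_id _ := Mor₂.ext (Bicategory.whiskerRight_id _)
  whiskerRight_comp _ _ _ := Mor₂.ext (Bicategory.whiskerRight_comp _ _ _)
  whisker_assoc _ _ _ _ _ := Mor₂.ext (Bicategory.whisker_assoc _ _ _)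
  whisker_exchange _ _ := Mor₂.ext (Bicategory.whisker_exchange _ _)
  pentagon _ _ _ _ := Mor₂.ext (Bicategory.pentagon _ _ _ _)
  triangle _ _ := Mor₂.ext (Bicategory.triangle _ _)

theorem eqToHom_hom {y z : LaxAlg M} {f g : y ⟶ z} (h : f = g) :
    (eqToHom h).hom = eqToHom (congrArg Mor.hom h) := by
  subst h; rfl

theorem strict_aux {y z : LaxAlg M} {f g : y ⟶ z} (i : f ≅ g) (h : f.hom = g.hom)
    (hi : i.hom.hom = eqToHom h) : ∃ e : f = g, i = eqToIso e := by
  have e : f = g := Mor.ext_of_eqToHom h (by rw [← hi]; exact i.hom.comm)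
  refine ⟨e, Iso.ext (Mor₂.ext ?_)⟩
  rw [hi, eqToIso.hom, eqToHom_hom]

theorem strict_assoc {x y z t : LaxAlg M} (f : x ⟶ y) (g : y ⟶ z) (h : z ⟶ t) :
    ∃ e : (f ≫ g) ≫ h = f ≫ g ≫ h, α_ f g h = eqToIso e :=
  strict_aux _ (Bicategory.Strict.assoc f.hom g.hom h.hom)
    (congrArg Iso.hom (Bicategory.Strict.associator_eqToIso f.hom g.hom h.hom))

theorem strict_id_comp {y z : LaxAlg M} (f : y ⟶ z) : ∃ e : 𝟙 y ≫ f = f, λ_ f = eqToIso e :=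
  strict_aux _ (Bicategory.Strict.id_comp f.hom)
    (congrArg Iso.hom (Bicategory.Strict.leftUnitor_eqToIso f.hom))

theorem strict_comp_id {y z : LaxAlg M} (f : y ⟶ z) : ∃ e : f ≫ 𝟙 z = f, ρ_ f = eqToIso e :=
  strict_aux _ (Bicategory.Strict.comp_id f.hom)
    (congrArg Iso.hom (Bicategory.Strict.rightUnitor_eqToIso f.hom))

instance : Bicategory.Strict (LaxAlg M) where
  id_comp f := (strict_id_comp f).1
  comp_id f := (strict_comp_id f).1
  assoc f g h := (strict_assoc f g h).1
  leftUnitor_eqToIso f := (strict_id_comp f).2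
  rightUnitor_eqToIso f := (strict_comp_id f).2
  associator_eqToIso f g h := (strict_assoc f g h).2

end LaxAlg

end LaxAlgebras

section LocallyFull

variable {B : Type u} [Bicategory.{w, v} B]

/-- A class of `1`-cells closed under identities and composition. -/
structure OneCells (B : Type u) [Bicategory.{w, v} B] where
  /-- membership -/
  mem : ∀ {a b : B}, (a ⟶ b) → Prop
  id_mem : ∀ a : B, mem (𝟙 a)
  comp_mem : ∀ {a b c : B} (f : a ⟶ b) (g : b ⟶ c), mem f → mem g → mem (f ≫ g)

/-- The locally full sub-`2`-category with all objects and the `1`-cells in the class `P`. -/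
@[ext]
structure LocallyFull (P : OneCells B) where
  /-- the underlying object -/
  obj : B

namespace LocallyFull

variable {P : OneCells B}

/-- The `1`-cells in `P`. -/
@[ext]
structure Mor (a b : LocallyFull P) where
  /-- the underlying `1`-cell -/
  hom : a.obj ⟶ b.obj
  mem : P.mem hom

instance : CategoryStruct (LocallyFull P) where
  Hom := Mor
  id a := ⟨𝟙 a.obj, P.id_mem _⟩
  comp f g := ⟨f.hom ≫ g.hom, P.comp_mem _ _ f.mem g.mem⟩

/-- All `2`-cells between `1`-cells in `P`. -/
@[ext]
structure Mor₂ {a b : LocallyFull P} (f g : a ⟶ b) where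
  /-- the underlying `2`-cell -/
  hom : f.hom ⟶ g.hom

instance homCategory (a b : LocallyFull P) : Category (a ⟶ b) where
  Hom f g := Mor₂ f g
  id f := ⟨𝟙 f.hom⟩
  comp η θ := ⟨η.hom ≫ θ.hom⟩
  id_comp _ := Mor₂.ext (Category.id_comp _)
  comp_id _ := Mor₂.ext (Category.comp_id _)
  assoc _ _ _ := Mor₂.ext (Category.assoc _ _ _)

/-- Invertible `2`-cells. -/
def isoMk {a b : LocallyFull P} {f g : a ⟶ b} (i : f.hom ≅ g.hom) : f ≅ g where
  hom := ⟨i.hom⟩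
  inv := ⟨i.inv⟩
  hom_inv_id := Mor₂.ext i.hom_inv_id
  inv_hom_id := Mor₂.ext i.inv_hom_id

instance bicategory : Bicategory (LocallyFull P) where
  homCategory := homCategory
  whiskerLeft f _ _ η := ⟨f.hom ◁ η.hom⟩
  whiskerRight η h := ⟨η.hom ▷ h.hom⟩
  associator f g h := isoMk (α_ f.hom g.hom h.hom)
  leftUnitor f := isoMk (λ_ f.hom)
  rightUnitor f := isoMk (ρ_ f.hom)
  whiskerLeft_id _ _ := Mor₂.ext (Bicategory.whiskerLeft_id _ _)
  whiskerLeft_comp _ _ _ _ _ _ := Mor₂.ext (Bicategory.whiskerLeft_comp _ _ _)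
  id_whiskerLeft _ := Mor₂.ext (Bicategory.id_whiskerLeft _)
  comp_whiskerLeft _ _ _ _ _ := Mor₂.ext (Bicategory.comp_whiskerLeft _ _ _)
  id_whiskerRight _ _ := Mor₂.ext (Bicategory.id_whiskerRight _ _)
  comp_whiskerRight _ _ _ := Mor₂.ext (Bicategory.comp_whiskerRight _ _ _)
  whiskerRight_id _ := Mor₂.ext (Bicategory.whiskerRight_id _)
  whiskerRight_comp _ _ _ := Mor₂.ext (Bicategory.whiskerRight_comp _ _ _)
  whisker_assoc _ _ _ _ _ := Mor₂.ext (Bicategory.whisker_assoc _ _ _)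
  whisker_exchange _ _ := Mor₂.ext (Bicategory.whisker_exchange _ _)
  pentagon _ _ _ _ := Mor₂.ext (Bicategory.pentagon _ _ _ _)
  triangle _ _ := Mor₂.ext (Bicategory.triangle _ _)

theorem comp_hom {a b : LocallyFull P} {f g h : a ⟶ b} (η : f ⟶ g) (θ : g ⟶ h) :
    (η ≫ θ).hom = η.hom ≫ θ.hom := rfl

theorem eqToHom_hom {a b : LocallyFull P} {f g : a ⟶ b} (h : f = g) :
    (eqToHom h).hom = eqToHom (congrArg Mor.hom h) := by
  subst h; rfl

instance [Bicategory.Strict B] : Bicategory.Strict (LocallyFull P) where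
  id_comp f := Mor.ext (Bicategory.Strict.id_comp f.hom)
  comp_id f := Mor.ext (Bicategory.Strict.comp_id f.hom)
  assoc f g h := Mor.ext (Bicategory.Strict.assoc f.hom g.hom h.hom)
  leftUnitor_eqToIso f := Iso.ext (Mor₂.ext (by
    rw [eqToIso.hom, eqToHom_hom]
    exact congrArg Iso.hom (Bicategory.Strict.leftUnitor_eqToIso f.hom)))
  rightUnitor_eqToIso f := Iso.ext (Mor₂.ext (by
    rw [eqToIso.hom, eqToHom_hom]
    exact congrArg Iso.hom (Bicategory.Strict.rightUnitor_eqToIso f.hom)))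
  associator_eqToIso f g h := Iso.ext (Mor₂.ext (by
    rw [eqToIso.hom, eqToHom_hom]
    exact congrArg Iso.hom (Bicategory.Strict.associator_eqToIso f.hom g.hom h.hom)))

/-- The inclusion of a locally full sub-`2`-category. -/
def incl (P : OneCells B) [Bicategory.Strict B] : StrictPseudofunctor (LocallyFull P) B :=
  StrictPseudofunctor.mk''
    { obj := fun a => a.obj
      map := fun f => f.hom
      map₂ := fun η => η.hom
      map₂_id := fun _ => rfl
      map₂_comp := fun _ _ => rfl
      map_id := fun _ => rfl
      map_comp := fun _ _ => rfl
      map₂_whisker_left := fun f _ _ η => by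
        exact ((Category.id_comp _).trans (Category.comp_id _)).symm
      map₂_whisker_right := fun η f => by
        exact ((Category.id_comp _).trans (Category.comp_id _)).symm }

/-- The inclusion between two locally full sub-`2`-categories. -/
def inclOfLE {P Q : OneCells B} [Bicategory.Strict B]
    (h : ∀ {a b : B} (f : a ⟶ b), P.mem f → Q.mem f) :
    StrictPseudofunctor (LocallyFull P) (LocallyFull Q) :=
  StrictPseudofunctor.mk''
    { obj := fun a => ⟨a.obj⟩
      map := fun f => ⟨f.hom, h _ f.mem⟩
      map₂ := fun η => ⟨η.hom⟩
      map₂_id := fun _ => rfl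
      map₂_comp := fun _ _ => rfl
      map_id := fun _ => rfl
      map_comp := fun _ _ => rfl
      map₂_whisker_left := fun f _ _ η => by
        exact Mor₂.ext (by
          rw [comp_hom, comp_hom, eqToHom_hom, eqToHom_hom]
          exact ((Category.id_comp _).trans (Category.comp_id _)).symm)
      map₂_whisker_right := fun η f => by
        exact Mor₂.ext (by
          rw [comp_hom, comp_hom, eqToHom_hom, eqToHom_hom]
          exact ((Category.id_comp _).trans (Category.comp_id _)).symm) }

end LocallyFull

end LocallyFull

section

variable {B : Type u} [Bicategory.{w, v} B] [Bicategory.Strict B] (M : TwoMonad B)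

/-- `T`-pseudomorphisms: lax morphisms with invertible structure `2`-cell. -/
def pseudoMor : OneCells (LaxAlg M) where
  mem f := IsIso f.cell
  id_mem y := by
    change IsIso (LaxAlg.Mor.id y).cell
    unfold LaxAlg.Mor.id
    infer_instance
  comp_mem f g hf hg := by
    have := hf
    have := hg
    change IsIso (LaxAlg.Mor.comp f g).cell
    unfold LaxAlg.Mor.comp
    infer_instance

/-- Strict `T`-morphisms: lax morphisms whose structure `2`-cell is an identity. -/
def strictMor : OneCells (LaxAlg M) where
  mem {y z} f := ∃ h : M.T.map f.hom ≫ z.act = y.act ≫ f.hom, f.cell = eqToHom h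
  id_mem y := ⟨(M.map_id_comp y.act).trans (Bicategory.Strict.comp_id y.act).symm, rfl⟩
  comp_mem {x y z} f g := by
    rintro ⟨h, hf⟩ ⟨k, hg⟩
    refine ⟨?_, ?_⟩
    · change M.T.map (f.hom ≫ g.hom) ≫ z.act = x.act ≫ f.hom ≫ g.hom
      rw [M.map_map_comp, k, ← Bicategory.Strict.assoc, h, Bicategory.Strict.assoc]
    · change (LaxAlg.Mor.comp f g).cell = _
      simp only [LaxAlg.Mor.comp, hf, hg, whiskerLeft_eqToHom, eqToHom_whiskerRight,
        eqToHom_trans]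
      rfl

theorem pseudoMor_of_strictMor {y z : LaxAlg M} (f : y ⟶ z) (hf : (strictMor M).mem f) :
    (pseudoMor M).mem f := by
  have h : ∃ h : M.T.map f.hom ≫ z.act = y.act ≫ f.hom, f.cell = eqToHom h := hf
  obtain ⟨h, hf⟩ := h
  change IsIso f.cell
  rw [hf]
  infer_instance

/-- `Lax-T-Alg`: lax algebras and `T`-pseudomorphisms. -/
abbrev LaxAlgPs : Type _ := LocallyFull (pseudoMor M)

/-- `Lax-T-Alg_s`: lax algebras and strict `T`-morphisms. -/
abbrev LaxAlgS : Type _ := LocallyFull (strictMor M)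

/-- The inclusion `ℓ : Lax-T-Alg ⟶ Lax-T-Alg_ℓ`. -/
abbrev ell : StrictPseudofunctor (LaxAlgPs M) (LaxAlg M) := LocallyFull.incl (pseudoMor M)

/-- The inclusion `Lax-T-Alg_s ⟶ Lax-T-Alg`. -/
abbrev strictIncl : StrictPseudofunctor (LaxAlgS M) (LaxAlgPs M) :=
  LocallyFull.inclOfLE (pseudoMor_of_strictMor M)

/-- The forgetful `2`-functor `U : Lax-T-Alg ⟶ B`. -/
def forgetPs : StrictPseudofunctor (LaxAlgPs M) B :=
  StrictPseudofunctor.mk''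
    { obj := fun z => z.obj.carrier
      map := fun f => f.hom.hom
      map₂ := fun η => η.hom.hom
      map₂_id := fun _ => rfl
      map₂_comp := fun _ _ => rfl
      map_id := fun _ => rfl
      map_comp := fun _ _ => rfl
      map₂_whisker_left := fun f _ _ η => by
        exact ((Category.id_comp _).trans (Category.comp_id _)).symm
      map₂_whisker_right := fun η f => by
        exact ((Category.id_comp _).trans (Category.comp_id _)).symm }

end

section Diagram

variable {A : Type u₁} [Bicategory.{w₁, v₁} A] [Bicategory.Strict A]
  {B : Type u} [Bicategory.{w, v} B] [Bicategory.Strict B] {M : TwoMonad B}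
  {Jt : StrictPseudofunctor A (LaxAlgS M)} {E : StrictPseudofunctor B A}
  (adj : TwoAdjunction E ((Jt.comp (strictIncl M)).comp (forgetPs M)))

/-- The lax algebra `J X`. -/
abbrev jAlg (Jt : StrictPseudofunctor A (LaxAlgS M)) (X : A) : LaxAlg M := (Jt.obj X).obj

/-- The underlying `1`-cell of `J f`. -/
abbrev jMap (Jt : StrictPseudofunctor A (LaxAlgS M)) {X Y : A} (f : X ⟶ Y) :
    (jAlg Jt X).carrier ⟶ (jAlg Jt Y).carrier := (Jt.map f).hom.hom

theorem jMap_act (Jt : StrictPseudofunctor A (LaxAlgS M)) {X Y : A} (f : X ⟶ Y) :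
    M.T.map (jMap Jt f) ≫ (jAlg Jt Y).act = (jAlg Jt X).act ≫ jMap Jt f := by
  obtain ⟨h, -⟩ := (Jt.map f).mem
  exact h

namespace TwoAdjunction

/-- The unit `ρ`. -/
def rho (X : B) : X ⟶ (jAlg Jt (E.obj X)).carrier := adj.unit X

/-- The counit `ε`. -/
def eps (X : A) : E.obj (jAlg Jt X).carrier ⟶ X := adj.counit X

theorem rho_naturality {X Y : B} (f : X ⟶ Y) : f ≫ adj.rho Y = adj.rho X ≫ jMap Jt (E.map f) :=
  adj.unit_naturality f

theorem eps_naturality {X Y : A} (f : X ⟶ Y) :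
    E.map (jMap Jt f) ≫ adj.eps Y = adj.eps X ≫ f :=
  adj.counit_naturality f

theorem rho_eps (X : B) : E.map (adj.rho X) ≫ adj.eps (E.obj X) = 𝟙 (E.obj X) :=
  adj.left_triangle X

theorem eps_rho (X : A) : adj.rho (jAlg Jt X).carrier ≫ jMap Jt (adj.eps X) = 𝟙 _ :=
  adj.right_triangle X

/-- The `1`-cell `ε_{EX} E(a_{JEX} T(ρ_X)) : E T X ⟶ E X`. -/
def actRho (X : B) : E.obj (M.T.obj X) ⟶ E.obj X :=
  E.map (M.T.map (adj.rho X) ≫ (jAlg Jt (E.obj X)).act) ≫ adj.eps (E.obj X)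

theorem actRho_naturality {X Y : B} (f : X ⟶ Y) :
    adj.actRho X ≫ E.map f = E.map (M.T.map f) ≫ adj.actRho Y := by
  unfold actRho
  rw [Bicategory.Strict.assoc, ← adj.eps_naturality, ← Bicategory.Strict.assoc, ← E.map_comp,
    Bicategory.Strict.assoc, ← jMap_act, ← Bicategory.Strict.assoc (M.T.map (adj.rho X)),
    ← M.T.map_comp, ← adj.rho_naturality, M.T.map_comp, Bicategory.Strict.assoc, E.map_comp,
    Bicategory.Strict.assoc]

theorem actRho_eps (X : A) :
    adj.actRho (jAlg Jt X).carrier ≫ adj.eps X = E.map (jAlg Jt X).act ≫ adj.eps X := by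
  unfold actRho
  rw [Bicategory.Strict.assoc, ← adj.eps_naturality, ← Bicategory.Strict.assoc, ← E.map_comp,
    Bicategory.Strict.assoc, ← jMap_act, ← Bicategory.Strict.assoc (M.T.map (adj.rho _)),
    ← M.T.map_comp, adj.eps_rho, M.T.map_id, Bicategory.Strict.id_comp]

theorem actRho_actRho (X : B) : adj.actRho (M.T.obj X) ≫ adj.actRho X =
    E.map (M.T.map (M.T.map (adj.rho X)) ≫ M.T.map (jAlg Jt (E.obj X)).act ≫
      (jAlg Jt (E.obj X)).act) ≫ adj.eps (E.obj X) := by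
  conv_lhs => rw [show adj.actRho X = E.map (M.T.map (adj.rho X) ≫
    (jAlg Jt (E.obj X)).act) ≫ adj.eps (E.obj X) from rfl]
  rw [← Bicategory.Strict.assoc, actRho_naturality, Bicategory.Strict.assoc, actRho_eps,
    ← Bicategory.Strict.assoc, ← E.map_comp, M.T.map_comp, Bicategory.Strict.assoc]

theorem mul_actRho (X : B) : E.map (M.T.map (M.T.map (adj.rho X)) ≫ M.mul _ ≫
      (jAlg Jt (E.obj X)).act) ≫ adj.eps (E.obj X) = E.map (M.mul X) ≫ adj.actRho X := by
  unfold actRho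
  rw [M.mul_naturality_assoc, E.map_comp, Bicategory.Strict.assoc]

theorem unit_actRho (X : B) : E.map (adj.rho X ≫ M.unit _ ≫
      (jAlg Jt (E.obj X)).act) ≫ adj.eps (E.obj X) = E.map (M.unit X) ≫ adj.actRho X := by
  unfold actRho
  rw [M.unit_naturality_assoc, E.map_comp, Bicategory.Strict.assoc]

/-- The objects and arrows of the diagram `𝒜_y`, in `Aᵒᵖ`:
`d⁰ ↦ E(a_y)`, `d¹ ↦ ε E(a_{JEY} T(ρ_Y))`, `s⁰ ↦ E(η_Y)`,
`∂⁰ ↦ E(T(a_y))`, `∂¹ ↦ E(m_Y)`, `∂² ↦ ε E(a_{JETY} T(ρ_{TY}))`. -/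
def diagramPre (y : LaxAlg M) : DObj ⥤q Aᵒᵖ where
  obj
    | .one => op (E.obj y.carrier)
    | .two => op (E.obj (M.T.obj y.carrier))
    | .three => op (E.obj (M.T.obj (M.T.obj y.carrier)))
  map
    | .d0 => (E.map y.act).op
    | .d1 => (adj.actRho y.carrier).op
    | .s0 => (E.map (M.unit y.carrier)).op
    | .p0 => (E.map (M.T.map y.act)).op
    | .p1 => (E.map (M.mul y.carrier)).op
    | .p2 => (adj.actRho (M.T.obj y.carrier)).op

theorem diagramPre_path₂ (y : LaxAlg M) {a b c : DObj} (e : a ⟶ b) (e' : b ⟶ c) :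
    (pathMap (adj.diagramPre y) (path₂ e e')).unop =
      ((adj.diagramPre y).map e').unop ≫ ((adj.diagramPre y).map e).unop := by
  change _ ≫ (_ ≫ 𝟙 _) = _
  rw [Bicategory.Strict.comp_id]

/-- The `2`-cells of the diagram `𝒜_y`. -/
def diagramCell (y : LaxAlg M) ⦃a b : DObj⦄ ⦃f g : Quiver.Path a b⦄ :
    DCell f g → (pathMap (adj.diagramPre y) f ⟶ pathMap (adj.diagramPre y) g)
  | .s00 => opCell (E.map₂ y.mulCell)
      ((adj.diagramPre_path₂ y DArr.d0 DArr.p0).trans (E.map_comp _ _).symm)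
      ((E.map_comp _ _).trans (adj.diagramPre_path₂ y DArr.d0 DArr.p1).symm)
  | .s20 => opCell (𝟙 (adj.actRho (M.T.obj y.carrier) ≫ E.map y.act))
      (adj.diagramPre_path₂ y DArr.d0 DArr.p2)
      ((adj.actRho_naturality y.act).trans (adj.diagramPre_path₂ y DArr.d1 DArr.p0).symm)
  | .s21 => opCell
      (E.map₂ (M.T.map (M.T.map (adj.rho y.carrier)) ◁ (jAlg Jt (E.obj y.carrier)).mulCell) ▷
        adj.eps (E.obj y.carrier))
      ((adj.diagramPre_path₂ y DArr.d1 DArr.p2).trans (adj.actRho_actRho y.carrier))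
      ((adj.mul_actRho y.carrier).trans (adj.diagramPre_path₂ y DArr.d1 DArr.p1).symm)
  | .n0 => opCell (E.map₂ y.unitCell) (E.map_id _).symm
      ((E.map_comp _ _).trans (adj.diagramPre_path₂ y DArr.d0 DArr.s0).symm)
  | .n1 => opCell
      (E.map₂ (adj.rho y.carrier ◁ (jAlg Jt (E.obj y.carrier)).unitCell) ▷
        adj.eps (E.obj y.carrier))
      ((adj.rho_eps y.carrier).symm.trans
        (congrArg (E.map · ≫ adj.eps _) (Bicategory.Strict.comp_id (adj.rho y.carrier)).symm))
      ((adj.unit_actRho y.carrier).trans (adj.diagramPre_path₂ y DArr.d1 DArr.s0).symm)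

/-- The diagram `𝒜_y`, for `J` the composite of `Jt` with the inclusion and `R` the composite of
`J` with the forgetful `2`-functor. -/
def diagram (y : LaxAlg M) : StrictPseudofunctor DeltaL Aᵒᵖ :=
  Presented.lift (adj.diagramPre y) (adj.diagramCell y) (fun _ _ _ _ _ _ h => h.elim)

/-- Transport of a `2`-adjunction along an equality of right adjoints. -/
def ofEq {R R' : StrictPseudofunctor A B} (adj : TwoAdjunction E R) (h : R = R') :
    TwoAdjunction E R' := h ▸ adj

end TwoAdjunction

/-- The diagram `𝒜_y : Δ_ℓᵒᵖ ⟶ A` (regarded as a `2`-functor `Δ_ℓ ⟶ Aᵒᵖ`) attached to a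
`2`-adjunction `E ⊣ R`, commutative triangles `J = incl ∘ Jt` and `R = U ∘ J`, and a lax
algebra `y`. -/
def codescentDiagram {R : StrictPseudofunctor A B} {J : StrictPseudofunctor A (LaxAlgPs M)}
    (hJ : Jt.comp (strictIncl M) = J) (hR : J.comp (forgetPs M) = R)
    (adj : TwoAdjunction E R) (y : LaxAlg M) : StrictPseudofunctor DeltaL Aᵒᵖ :=
  TwoAdjunction.diagram (Jt := Jt) (adj.ofEq ((congrArg (·.comp (forgetPs M)) hJ).trans hR).symm) y

end Diagram

end LaxAlgebras

/-! A strict left `2`-adjoint of a `2`-functor `P` amounts to a choice, for each object `y`, of a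
`1`-cell `u : y ⟶ P c` such that `k ↦ u ≫ P k` is an isomorphism of categories from `Hom(c, X)` to
`Hom(y, P X)` for all `X` (`isUniversalArrow_unit`, `IsUniversalArrow.exists_adjunction`). Since
factorisations through `u` are unique on the nose, any choice of the objects `c` is the object
function of a `2`-functor. It remains to match universal arrows out of `y` with universal cocones
under `𝒜_y`.

A cocone for the weight `Δ̇_ℓ(𝟢, t-)` is the same as its values at `d` and `ϑ`. Nothing enters `𝟢`,
and only `d` leaves it. Hence every path out of `𝟢` to an object of `Δ_ℓ` is `d` followed by a
unique path of `Δ_ℓ`, and every `2`-cell between objects of `Δ_ℓ` already lives in `Δ_ℓ`. This gives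
uniqueness (`ext_of_theta`, `hom_ext_of_pathD`) and extension of modifications (`exists_hom`).
Existence (`coconeOfDatum`) is the universal property of the presentation: a pair `(f, θ)`
satisfying the two equations extends the diagram to `Δ̇_ℓ`.

Transposition along `E ⊣ R` turns `f : EY ⟶ X` into `Y ⟶ RX`, and `θ` into a `2`-cell from `a_{JX}
T(f)` to `f a_y`, with `f` now the transpose. The equations on `(f, θ)` become exactly the two
axioms of a lax morphism `y ⟶ JX` (`isCodescentDatum_iff`), and modifications become
`T`-transformations (`transposeCell_comm_iff`). That `J` takes values in strict morphisms is what
carries the structure cells of `JEY` to those of `JX`.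

Thus cocones under `𝒜_y` with vertex `X` form a category isomorphic to the lax morphisms `y ⟶ JX`.
The isomorphism respects postcomposition with `k : X ⟶ X'` (`morOfCocone_post`), again because `Jk`
is strict, so a cocone is universal if and only if the corresponding lax morphism is a universal
arrow (`isUniversal_iff`). For `Δ̇` the same argument applies with `ϑ` invertible; transposition
preserves and reflects invertibility, so pseudomorphisms replace lax morphisms. Both cases are
treated together through the parameter `i`. -/

namespace LaxAlgebras

/-! ### Whiskering in a strict `2`-category up to heterogeneous equality -/

section StrictHEq

variable {B : Type u} [Bicategory.{w, v} B]

/-- In a strict `2`-category all coherence cells are `eqToHom`s. Comparing `2`-cells heterogeneously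
makes these invisible, at the price of supplying the equalities of the `1`-cells at the ends. -/
theorem whiskerLeft_heq {a b c : B} {f f' : a ⟶ b} {g g' h h' : b ⟶ c} {η : g ⟶ h} {η' : g' ⟶ h'}
    (hf : f = f') (hg : g = g') (hh : h = h') (e : η ≍ η') : f ◁ η ≍ f' ◁ η' := by
  subst hf hg hh; cases e; rfl

theorem whiskerRight_heq {a b c : B} {f f' : b ⟶ c} {g g' h h' : a ⟶ b} {η : g ⟶ h} {η' : g' ⟶ h'}
    (hf : f = f') (hg : g = g') (hh : h = h') (e : η ≍ η') : η ▷ f ≍ η' ▷ f' := by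
  subst hf hg hh; cases e; rfl

variable [Bicategory.Strict B]

theorem comp_whiskerLeft_heq {a b c d : B} (f : a ⟶ b) (g : b ⟶ c) {h h' : c ⟶ d} (η : h ⟶ h') :
    (f ≫ g) ◁ η ≍ f ◁ g ◁ η := by
  simp [Bicategory.Strict.associator_eqToIso]

theorem id_whiskerLeft_heq {a b : B} {f g : a ⟶ b} (η : f ⟶ g) : 𝟙 a ◁ η ≍ η := by
  simp [Bicategory.Strict.leftUnitor_eqToIso]

theorem whiskerRight_comp_heq {a b c d : B} {f f' : a ⟶ b} (η : f ⟶ f') (g : b ⟶ c) (h : c ⟶ d) :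
    η ▷ (g ≫ h) ≍ (η ▷ g) ▷ h := by
  simp [Bicategory.Strict.associator_eqToIso]

theorem whiskerRight_id_heq {a b : B} {f g : a ⟶ b} (η : f ⟶ g) : η ▷ 𝟙 b ≍ η := by
  simp [Bicategory.Strict.rightUnitor_eqToIso]

theorem whisker_assoc_heq {a b c d : B} (f : a ⟶ b) {g g' : b ⟶ c} (η : g ⟶ g') (h : c ⟶ d) :
    (f ◁ η) ▷ h ≍ f ◁ η ▷ h := by
  simp [Bicategory.Strict.associator_eqToIso]

end StrictHEq

/-! ### `2`-functors and whiskering -/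

section

variable {B : Type u} [Bicategory.{w, v} B] {C : Type u₁} [Bicategory.{w₁, v₁} C]
  (F : StrictPseudofunctor B C)

theorem map₂_heq {a b : B} {f g f' g' : a ⟶ b} {η : f ⟶ g} {η' : f' ⟶ g'} (hf : f = f')
    (hg : g = g') (e : η ≍ η') : F.map₂ η ≍ F.map₂ η' := by
  subst hf hg; cases e; rfl

theorem map₂_whiskerLeft_heq {a b c : B} (f : a ⟶ b) {g h : b ⟶ c} (η : g ⟶ h) :
    F.map₂ (f ◁ η) ≍ F.map f ◁ F.map₂ η := by
  simp [F.mapComp_eq_eqToIso]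

theorem map₂_whiskerRight_heq {a b c : B} {f g : a ⟶ b} (η : f ⟶ g) (h : b ⟶ c) :
    F.map₂ (η ▷ h) ≍ F.map₂ η ▷ F.map h := by
  simp [F.mapComp_eq_eqToIso]

end

/-! ### Isomorphisms of categories -/

section IsoOfCategories

variable {C : Type u} [Category.{v} C] {D : Type u₁} [Category.{v₁} D]

theorem functor_map_heq (F : C ⥤ D) {a b a' b' : C} {f : a ⟶ b} {f' : a' ⟶ b'} (ha : a = a')
    (hb : b = b') (e : f ≍ f') : F.map f ≍ F.map f' := by
  subst ha hb; cases e; rfl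

/-- A functor is an isomorphism of categories. -/
def IsIsoOfCats (F : C ⥤ D) : Prop := ∃ G : D ⥤ C, F ⋙ G = 𝟭 _ ∧ G ⋙ F = 𝟭 _

theorem map_heq_of_eq {F G : C ⥤ D} (h : F = G) {a b : C} (f : a ⟶ b) : F.map f ≍ G.map f := by
  subst h; rfl

namespace IsIsoOfCats

variable {F : C ⥤ D}

theorem bijective (h : IsIsoOfCats F) : Function.Bijective F.obj := by
  obtain ⟨G, h₁, h₂⟩ := h
  exact Function.bijective_iff_has_inverse.2
    ⟨G.obj, fun x => congrArg (·.obj x) h₁, fun x => congrArg (·.obj x) h₂⟩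

theorem map_injective (h : IsIsoOfCats F) {a b : C} {f g : a ⟶ b} (e : F.map f = F.map g) :
    f = g := by
  obtain ⟨G, h₁, -⟩ := h
  have hf := map_heq_of_eq h₁ f
  have hg := map_heq_of_eq h₁ g
  have : (F ⋙ G).map f = (F ⋙ G).map g := congrArg G.map e
  exact eq_of_heq (hf.symm.trans ((heq_of_eq this).trans hg))

theorem map_surjective (h : IsIsoOfCats F) {a b : C} (g : F.obj a ⟶ F.obj b) :
    ∃ f : a ⟶ b, F.map f = g := by
  obtain ⟨G, h₁, h₂⟩ := h
  have ha : G.obj (F.obj a) = a := congrArg (·.obj a) h₁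
  have hb : G.obj (F.obj b) = b := congrArg (·.obj b) h₁
  -- The inverse functor returns to `a` and `b` only up to a propositional equality, so its value at
  -- `g` is conjugated.
  refine ⟨eqToHom ha.symm ≫ G.map g ≫ eqToHom hb, eq_of_heq ?_⟩
  refine HEq.trans ?_ (map_heq_of_eq h₂ g)
  exact functor_map_heq F ha.symm hb.symm (by simp)

theorem map_heq_injective (h : IsIsoOfCats F) {a b a' b' : C} {f : a ⟶ b} {g : a' ⟶ b'}
    (ha : a = a') (hb : b = b') (e : F.map f ≍ F.map g) : f ≍ g := by
  subst ha hb
  exact heq_of_eq (h.map_injective (eq_of_heq e))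

/-- A fully faithful functor that is bijective on objects has a strict inverse. On arrows the
inverse is the unique preimage of the arrow conjugated so that its ends are literally in the image
of `F`. -/
theorem of_bijective (hF : Function.Bijective F.obj)
    (hF' : ∀ a b : C, Function.Bijective (F.map : (a ⟶ b) → (F.obj a ⟶ F.obj b))) :
    IsIsoOfCats F := by
  choose g hg using hF.2
  choose p hp using fun a b => (hF' a b).2
  have hp' : ∀ {a b} (f : a ⟶ b), p a b (F.map f) = f := fun f => (hF' _ _).1 (hp _ _ _)
  have hg' : ∀ a, g (F.obj a) = a := fun a => hF.1 (hg _)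
  let G : D ⥤ C :=
    { obj := g
      map := fun {a b} f => p _ _ (eqToHom (hg a) ≫ f ≫ eqToHom (hg b).symm)
      map_id := fun a => (hF' _ _).1 (by simp [hp])
      map_comp := fun f f' => (hF' _ _).1 (by simp [hp]) }
  refine ⟨G, ?_, ?_⟩
  · refine CategoryTheory.Functor.ext hg' fun a b f => (hF' _ _).1 ?_
    simp [G, hp, eqToHom_map]
  · refine CategoryTheory.Functor.ext hg fun a b f => ?_
    simp [G, hp]

theorem comp {E : Type u₂} [Category.{v₂} E] {G : D ⥤ E} (hF : IsIsoOfCats F)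
    (hG : IsIsoOfCats G) : IsIsoOfCats (F ⋙ G) := by
  obtain ⟨F', h₁, h₂⟩ := hF
  obtain ⟨G', h₃, h₄⟩ := hG
  refine ⟨G' ⋙ F', ?_, ?_⟩
  · calc (F ⋙ G) ⋙ G' ⋙ F' = F ⋙ (G ⋙ G') ⋙ F' := rfl
      _ = 𝟭 _ := by rw [h₃, Functor.id_comp, h₁]
  · calc (G' ⋙ F') ⋙ F ⋙ G = G' ⋙ (F' ⋙ F) ⋙ G := rfl
      _ = 𝟭 _ := by rw [h₂, Functor.id_comp, h₄]

/-- Cancellation of an isomorphism on the right; it gives the converse direction in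
`isUniversal_iff`, where the composite is the functor of a universal arrow. -/
theorem of_comp {E : Type u₂} [Category.{v₂} E] {G : D ⥤ E} (hF : IsIsoOfCats (F ⋙ G))
    (hG : IsIsoOfCats G) : IsIsoOfCats F := by
  obtain ⟨G', h₃, h₄⟩ := id hG
  have h : IsIsoOfCats ((F ⋙ G) ⋙ G') := hF.comp ⟨G, h₄, h₃⟩
  rwa [show (F ⋙ G) ⋙ G' = F from (congrArg (F ⋙ ·) h₃).trans (Functor.comp_id F)] at h

end IsIsoOfCats

end IsoOfCategories

/-! ### Strict universal arrows and left `2`-adjoints -/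

section UniversalArrow

variable {A : Type u₁} [Bicategory.{w₁, v₁} A] [Bicategory.Strict A]
  {B : Type u} [Bicategory.{w, v} B] [Bicategory.Strict B] {P : StrictPseudofunctor A B}

/-- The functor `A(c, X) ⥤ B(y, P X)` induced by a `1`-cell `u : y ⟶ P c`. -/
@[simps]
def arrowFunctor (P : StrictPseudofunctor A B) {y : B} {c : A} (u : y ⟶ P.obj c) (X : A) :
    (c ⟶ X) ⥤ (y ⟶ P.obj X) where
  obj k := u ≫ P.map k
  map η := u ◁ P.map₂ η

/-- A `1`-cell `u : y ⟶ P c` is a (strict) universal arrow from `y` to `P`. -/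
def IsUniversalArrow (P : StrictPseudofunctor A B) {y : B} {c : A} (u : y ⟶ P.obj c) : Prop :=
  ∀ X : A, IsIsoOfCats (arrowFunctor P u X)

section

variable {y : B} {c : A} (u : y ⟶ P.obj c)

theorem arrowFunctor_obj_comp {X Y : A} (k : c ⟶ X) (l : X ⟶ Y) :
    (arrowFunctor P u Y).obj (k ≫ l) = (arrowFunctor P u X).obj k ≫ P.map l := by
  simp only [arrowFunctor_obj, P.map_comp, Bicategory.Strict.assoc]

theorem arrowFunctor_map_whiskerRight {X Y : A} {k k' : c ⟶ X} (η : k ⟶ k') (l : X ⟶ Y) :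
    (arrowFunctor P u Y).map (η ▷ l) ≍ (arrowFunctor P u X).map η ▷ P.map l :=
  (whiskerLeft_heq rfl (P.map_comp _ _) (P.map_comp _ _) (map₂_whiskerRight_heq P η l)).trans
    (whisker_assoc_heq _ _ _).symm

theorem arrowFunctor_map_whiskerLeft {X Y : A} (k : c ⟶ X) {l l' : X ⟶ Y} (η : l ⟶ l') :
    (arrowFunctor P u Y).map (k ◁ η) ≍ (arrowFunctor P u X).obj k ◁ P.map₂ η :=
  (whiskerLeft_heq rfl (P.map_comp _ _) (P.map_comp _ _) (map₂_whiskerLeft_heq P k η)).trans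
    (comp_whiskerLeft_heq _ _ _).symm

end

/-- The inverse of transposition is `f ↦ G f ≫ ε` on `1`-cells and `η ↦ G η ▷ ε` on `2`-cells. The
triangle identities together with `2`-naturality of unit and counit show that both composites are
identities. -/
theorem TwoAdjunction.isUniversalArrow_unit {G : StrictPseudofunctor B A}
    (adj : TwoAdjunction G P) (y : B) : IsUniversalArrow P (adj.unit y) := by
  intro X
  have hl : ∀ k : G.obj y ⟶ X, G.map (adj.unit y ≫ P.map k) ≫ adj.counit X = k := fun k => by
    rw [G.map_comp, Bicategory.Strict.assoc, adj.counit_naturality, ← Bicategory.Strict.assoc,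
      adj.left_triangle, Bicategory.Strict.id_comp]
  have hr : ∀ f : y ⟶ P.obj X, adj.unit y ≫ P.map (G.map f ≫ adj.counit X) = f := fun f => by
    rw [P.map_comp, ← Bicategory.Strict.assoc, ← adj.unit_naturality, Bicategory.Strict.assoc,
      adj.right_triangle, Bicategory.Strict.comp_id]
  -- The same two identities for `2`-cells; here the ends agree only by `hl` and `hr`.
  have hl₂ : ∀ {k l : G.obj y ⟶ X} (η : k ⟶ l),
      G.map₂ (adj.unit y ◁ P.map₂ η) ▷ adj.counit X ≍ η := fun {k l} η => by
    refine (whiskerRight_heq rfl (G.map_comp _ _) (G.map_comp _ _)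
      (map₂_whiskerLeft_heq G _ _)).trans ((whisker_assoc_heq _ _ _).trans ?_)
    rw [adj.counit_naturality₂]
    refine (whiskerLeft_heq (g' := adj.counit _ ≫ k) (h' := adj.counit _ ≫ l)
      (η' := adj.counit _ ◁ η) rfl (adj.counit_naturality k) (adj.counit_naturality l)
      (by simp)).trans ((comp_whiskerLeft_heq _ _ _).symm.trans ?_)
    exact (whiskerLeft_heq (adj.left_triangle y) rfl rfl .rfl).trans (id_whiskerLeft_heq _)
  have hr₂ : ∀ {f g : y ⟶ P.obj X} (η : f ⟶ g),
      adj.unit y ◁ P.map₂ (G.map₂ η ▷ adj.counit X) ≍ η := fun {f g} η => by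
    have e : adj.unit y ◁ P.map₂ (G.map₂ η) ≍ η ▷ adj.unit (P.obj X) := by
      rw [adj.unit_naturality₂]; simp
    refine (whiskerLeft_heq rfl (P.map_comp _ _) (P.map_comp _ _)
      (map₂_whiskerRight_heq P _ _)).trans ((whisker_assoc_heq _ _ _).symm.trans ?_)
    refine (whiskerRight_heq rfl (adj.unit_naturality f).symm (adj.unit_naturality g).symm
      e).trans ((whiskerRight_comp_heq _ _ _).symm.trans ?_)
    exact (whiskerRight_heq (adj.right_triangle X) rfl rfl .rfl).trans (whiskerRight_id_heq _)
  refine .of_bijective (Function.bijective_iff_has_inverse.2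
    ⟨fun f => G.map f ≫ adj.counit X, hl, hr⟩) fun k l => ⟨?_, ?_⟩
  · intro η θ h
    have h : adj.unit y ◁ P.map₂ η = adj.unit y ◁ P.map₂ θ := h
    exact eq_of_heq ((hl₂ η).symm.trans ((heq_of_eq (by rw [h])).trans (hl₂ θ)))
  · intro η
    refine ⟨eqToHom (hl k).symm ≫ G.map₂ η ▷ adj.counit X ≫ eqToHom (hl l), eq_of_heq ?_⟩
    refine HEq.trans ?_ (hr₂ η)
    exact whiskerLeft_heq rfl (congrArg P.map (hl k).symm) (congrArg P.map (hl l).symm)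
      (map₂_heq P (hl k).symm (hl l).symm
        ((eqToHom_comp_heq _ _).trans (comp_eqToHom_heq _ _)))

/-- `G f` is the unique factorisation of `f ≫ u z` through `u y`, and likewise on `2`-cells.
Uniqueness on the nose makes all functoriality and naturality laws strict, whichever objects `C y`
were chosen. -/
theorem IsUniversalArrow.exists_adjunction {C : B → A} (u : ∀ y, y ⟶ P.obj (C y))
    (hu : ∀ y, IsUniversalArrow P (u y)) :
    ∃ G : StrictPseudofunctor B A, (∀ y, G.obj y = C y) ∧ Nonempty (TwoAdjunction G P) := by
  choose g hg using fun y X => (hu y X).bijective.2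
  -- All laws below are verified after whiskering with `u`: `inj` for `1`-cells and `inj₂` for
  -- `2`-cells whose ends are only propositionally equal.
  have inj : ∀ {y X} {k l : C y ⟶ X}, u y ≫ P.map k = u y ≫ P.map l → k = l :=
    fun {y X k l} h => (hu y X).bijective.1 h
  have inj₂ : ∀ {y X} {k l k' l' : C y ⟶ X} (hk : k = k') (hl : l = l') {η : k ⟶ l}
      {θ : k' ⟶ l'}, u y ◁ P.map₂ η ≍ u y ◁ P.map₂ θ → η ≍ θ :=
    fun {y X k l k' l'} hk hl η θ h => (hu y X).map_heq_injective hk hl h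
  replace hg : ∀ {y X} (f : y ⟶ P.obj X), u y ≫ P.map (g y X f) = f := fun f => hg _ _ f
  -- The value of `G` on `η` is the `2`-cell whose image is `η ▷ u z`, conjugated so as to run
  -- between the chosen factorisations.
  choose s hs using fun (y z : B) (f f' : y ⟶ z) (η : f ⟶ f') =>
    (hu y (C z)).map_surjective (a := g y (C z) (f ≫ u z)) (b := g y (C z) (f' ≫ u z))
      (eqToHom (hg _) ≫ η ▷ u z ≫ eqToHom (hg _).symm)
  replace hs : ∀ {y z : B} {f f' : y ⟶ z} (η : f ⟶ f'), u y ◁ P.map₂ (s y z f f' η) ≍ η ▷ u z :=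
    fun η => (heq_of_eq (hs _ _ _ _ η)).trans
      ((eqToHom_comp_heq _ _).trans (comp_eqToHom_heq _ _))
  have map_comp : ∀ {x y z : B} (f : x ⟶ y) (h : y ⟶ z),
      g x (C z) ((f ≫ h) ≫ u z) = g x (C y) (f ≫ u y) ≫ g y (C z) (h ≫ u z) := fun f h => inj (by
    rw [hg, P.map_comp, ← Bicategory.Strict.assoc (u _), hg, Bicategory.Strict.assoc f,
      Bicategory.Strict.assoc f, hg])
  let G : StrictPseudofunctor B A := StrictPseudofunctor.mk''
    { obj := C
      map := fun {y z} f => g y (C z) (f ≫ u z)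
      map₂ := fun {y z f f'} η => s y z f f' η
      map₂_id := fun {y z} f => eq_of_heq (inj₂ rfl rfl ((hs _).trans (by
        simp only [id_whiskerRight, PrelaxFunctor.map₂_id, Bicategory.whiskerLeft_id]; rw [hg])))
      map₂_comp := fun {y z f f' f''} η θ => eq_of_heq (inj₂ rfl rfl ((hs _).trans (by
        simp only [comp_whiskerRight, PrelaxFunctor.map₂_comp, Bicategory.whiskerLeft_comp]
        exact heq_comp (hg _).symm (hg _).symm (hg _).symm (hs _).symm (hs _).symm)))
      map_id := fun y => inj (by
        rw [hg, P.map_id, Bicategory.Strict.id_comp, Bicategory.Strict.comp_id])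
      map_comp := map_comp
      map₂_whisker_left := fun {x y z} f h h' η => by
        refine (conj_eqToHom_iff_heq _ _ _ (map_comp _ _)).2 ?_
        refine inj₂ (map_comp _ _) (map_comp _ _) ((hs _).trans ?_)
        refine HEq.trans ?_ (arrowFunctor_map_whiskerLeft (P := P) (u x) _ _).symm
        refine (whisker_assoc_heq _ _ _).trans ?_
        refine (whiskerLeft_heq rfl (hg _).symm (hg _).symm (hs η).symm).trans ?_
        refine (comp_whiskerLeft_heq _ _ _).symm.trans ?_
        exact whiskerLeft_heq (hg _).symm rfl rfl .rfl
      map₂_whisker_right := fun {x y z f f'} η h => by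
        refine (conj_eqToHom_iff_heq _ _ _ (map_comp _ _)).2 ?_
        refine inj₂ (map_comp _ _) (map_comp _ _) ((hs _).trans ?_)
        refine HEq.trans ?_ (arrowFunctor_map_whiskerRight (P := P) (u x) _ _).symm
        refine (whiskerRight_comp_heq _ _ _).symm.trans ?_
        refine (whiskerRight_heq (hg (h ≫ u z)).symm rfl rfl .rfl).trans ?_
        refine (whiskerRight_comp_heq _ _ _).trans ?_
        exact whiskerRight_heq rfl (hg _).symm (hg _).symm (hs η).symm }
  -- The counit at `X` is the factorisation of the identity of `P X` through `u`.
  have counit_naturality : ∀ {X Y : A} (f : X ⟶ Y),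
      g (P.obj X) (C (P.obj Y)) (P.map f ≫ u _) ≫ g (P.obj Y) Y (𝟙 _) =
        g (P.obj X) X (𝟙 _) ≫ f := fun f => inj (by
    rw [P.map_comp, ← Bicategory.Strict.assoc, hg, Bicategory.Strict.assoc, hg, P.map_comp,
      ← Bicategory.Strict.assoc, hg, Bicategory.Strict.comp_id, Bicategory.Strict.id_comp])
  refine ⟨G, fun _ => rfl, ⟨?_⟩⟩
  exact
    { unit := u
      unit_naturality := fun f => (hg _).symm
      unit_naturality₂ := fun η => by
        refine (conj_eqToHom_iff_heq _ _ _ (hg _).symm).2 ?_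
        exact (hs η).symm
      counit := fun X => g (P.obj X) X (𝟙 _)
      counit_naturality := counit_naturality
      counit_naturality₂ := fun {X Y f f'} η => by
        refine (conj_eqToHom_iff_heq _ _ _ (counit_naturality f')).2 ?_
        refine inj₂ (counit_naturality f) (counit_naturality f') ?_
        refine (arrowFunctor_map_whiskerRight (P := P) (u (P.obj X)) _ _).trans ?_
        refine HEq.trans ?_ (arrowFunctor_map_whiskerLeft (P := P) (u (P.obj X)) _ _).symm
        refine (whiskerRight_heq rfl (hg _) (hg _) (hs _)).trans ?_
        refine (whiskerRight_comp_heq _ _ _).symm.trans ?_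
        refine (whiskerRight_heq (hg _) rfl rfl .rfl).trans ?_
        refine (whiskerRight_id_heq _).trans ?_
        exact (id_whiskerLeft_heq _).symm.trans (whiskerLeft_heq (hg _).symm rfl rfl .rfl)
      left_triangle := fun y => inj (by
        change u y ≫ P.map (g y _ (u y ≫ u _) ≫ g _ _ (𝟙 _)) = u y ≫ P.map (𝟙 (C y))
        rw [P.map_comp, ← Bicategory.Strict.assoc, hg, Bicategory.Strict.assoc, hg, P.map_id])
      right_triangle := fun X => hg _ }

end UniversalArrow

/-- Vertical composition. -/
abbrev Presented.comp₂ {V : Type} [Quiver.{0} V] {C : GenCells V} {E : CellRel C} {a b : V}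
    {f g h : Quiver.Path a b} (x : Cell E f g) (y : Cell E g h) : Cell E f h :=
  (Presented.homCategory (E := E) a b).comp x y

/-! ### Paths in the computad of `Δ̇` -/

section DotPaths

/-- No generating arrow has target `𝟢`. This excludes all pastings that would leave `Δ_ℓ` and come
back through `𝟢`. -/
theorem isEmpty_path_of_zero (a : DObj) (p : Quiver.Path (DotObj.of a) DotObj.zero) : False := by
  cases p with | cons _ e => exact nomatch (e : DotArr _ _)

theorem path_zero_zero (p : Quiver.Path DotObj.zero DotObj.zero) : p = Quiver.Path.nil := by
  cases p with
  | nil => rfl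
  | cons _ e => exact nomatch (e : DotArr _ _)

/-- The restriction to `Δ_ℓ` of a path between objects of `Δ_ℓ`. -/
def unPath {a : DObj} : ∀ {b : DotObj}, Quiver.Path (DotObj.of a) b →
    (match b with
      | .zero => PEmpty
      | .of b => Quiver.Path a b)
  | _, .nil => Quiver.Path.nil
  | _, .cons (b := .of _) p (.of e) => (unPath p).cons e
  | _, .cons (b := .zero) p _ => (unPath p).elim

theorem unPath_mapPath {a b : DObj} (p : Quiver.Path a b) : unPath (dotIncl.mapPath p) = p := by
  induction p with
  | nil => rfl
  | cons p e ih => exact congrArg (·.cons e) ih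

theorem mapPath_injective {a b : DObj} {p q : Quiver.Path a b}
    (h : dotIncl.mapPath p = dotIncl.mapPath q) : p = q := by
  rw [← unPath_mapPath p, ← unPath_mapPath q, h]

theorem exists_mapPath {a : DObj} : ∀ {b : DObj} (p : Quiver.Path (DotObj.of a) (DotObj.of b)),
    ∃ q : Quiver.Path a b, dotIncl.mapPath q = p
  | _, .nil => ⟨Quiver.Path.nil, rfl⟩
  | _, .cons (b := .of _) p (.of e) => by
    obtain ⟨q, rfl⟩ := exists_mapPath p
    exact ⟨q.cons e, rfl⟩

/-- The only generating arrow out of `𝟢` is `d`, and after it a path cannot return to `𝟢`. -/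
theorem exists_path_zero : ∀ {b : DObj} (p : Quiver.Path DotObj.zero (DotObj.of b)),
    ∃ q : Quiver.Path DObj.one b, (Quiver.Hom.toPath DotArr.d).comp (dotIncl.mapPath q) = p
  | _, .cons (b := .of _) p (.of e) => by
    obtain ⟨q, rfl⟩ := exists_path_zero p
    exact ⟨q.cons e, rfl⟩
  | _, .cons (b := .zero) p .d => by
    obtain rfl := path_zero_zero p
    exact ⟨Quiver.Path.nil, rfl⟩

variable (i : Prop)

/-- Reconciles the two forms of the inclusion: the `2`-functor obtained from the universal property
and the map of paths appearing in the generators of `DotCell`. -/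
theorem deltaIncl_map {a b : DObj} (p : Quiver.Path a b) :
    ((deltaIncl i).map (X := a) (Y := b) p : Quiver.Path (DotObj.of a) (DotObj.of b)) =
      dotIncl.mapPath p := by
  induction p with
  | nil => rfl
  | cons p e ih => exact congrArg (·.cons (DotArr.of e)) ih

end DotPaths

/-! ### Fullness of the inclusion of `Δ_ℓ` on `2`-cells -/

section DotCells

variable {i : Prop}

/-- The formal pasting `x` represents a `2`-cell in the image of `Δ_ℓ`. -/
def FromDelta (a b : DeltaL) (f g : Quiver.Path (DotObj.of a) (DotObj.of b))
    (x : PreCell (DotCell i) f g) : Prop :=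
  ∃ (f' g' : a ⟶ b) (α : f' ⟶ g'), (deltaIncl i).map f' = f ∧ (deltaIncl i).map g' = g ∧
    (deltaIncl i).map₂ α ≍ Presented.mk₂ (E := DotRel i) x

/-- If both ends of the formal pasting `x` lie in `Δ_ℓ`, then `x` represents a `2`-cell in the
image of `Δ_ℓ`. -/
def ComesFromDelta : ∀ {a b : DotObj} {f g : Quiver.Path a b}, PreCell (DotCell i) f g → Prop
  | .of a, .of b, f, g, x => FromDelta a b f g x
  | .zero, _, _, _, _ => True
  | .of _, .zero, _, _, _ => True

theorem deltaIncl_map_injective {a b : DeltaL} {f g : a ⟶ b}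
    (h : (deltaIncl i).map f = (deltaIncl i).map g) : f = g :=
  mapPath_injective ((deltaIncl_map i f).symm.trans (h.trans (deltaIncl_map i g)))

theorem exists_deltaIncl_map (i : Prop) {a b : DeltaL}
    (p : Quiver.Path (DotObj.of a) (DotObj.of b)) : ∃ q : a ⟶ b, (deltaIncl i).map q = p := by
  obtain ⟨q, h⟩ := exists_mapPath p
  exact ⟨q, (deltaIncl_map i q).trans h⟩

theorem FromDelta.gen {a b : DObj} {f g : Quiver.Path a b} (x : DCell f g) :
    FromDelta a b _ _ (dotGen i x) :=
  ⟨f, g, Presented.mk₂ (.gen x), deltaIncl_map i f, deltaIncl_map i g, by cases x <;> rfl⟩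

theorem FromDelta.refl {a b : DeltaL} (f : Quiver.Path (DotObj.of a) (DotObj.of b)) :
    FromDelta a b f f (.ofEq rfl : PreCell (DotCell i) f f) := by
  obtain ⟨q, rfl⟩ := exists_deltaIncl_map i f
  exact ⟨q, q, 𝟙 q, rfl, rfl, .rfl⟩

theorem FromDelta.vcomp {a b : DeltaL} {f g h : Quiver.Path (DotObj.of a) (DotObj.of b)}
    {x : PreCell (DotCell i) f g} {y : PreCell (DotCell i) g h} (hx : FromDelta a b _ _ x)
    (hy : FromDelta a b _ _ y) : FromDelta a b _ _ (x.vcomp y) := by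
  obtain ⟨f, g, α, rfl, rfl, hα⟩ := hx
  obtain ⟨g', h, β, hg, rfl, hβ⟩ := hy
  obtain rfl := deltaIncl_map_injective hg
  refine ⟨f, h, α ≫ β, rfl, rfl, ?_⟩
  rw [PrelaxFunctor.map₂_comp, eq_of_heq hα, eq_of_heq hβ]
  rfl

theorem FromDelta.wl {a b c : DeltaL} (f : Quiver.Path (DotObj.of a) (DotObj.of b))
    {g h : Quiver.Path (DotObj.of b) (DotObj.of c)} {x : PreCell (DotCell i) g h}
    (hx : FromDelta b c _ _ x) : FromDelta a c _ _ (x.wl f) := by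
  obtain ⟨g, h, α, rfl, rfl, hα⟩ := hx
  obtain ⟨f, rfl⟩ := exists_deltaIncl_map i f
  refine ⟨f ≫ g, f ≫ h, f ◁ α, (deltaIncl i).map_comp _ _, (deltaIncl i).map_comp _ _, ?_⟩
  refine (map₂_whiskerLeft_heq _ _ _).trans ?_
  rw [eq_of_heq hα]
  rfl

theorem FromDelta.wr {a b c : DeltaL} {f g : Quiver.Path (DotObj.of a) (DotObj.of b)}
    {x : PreCell (DotCell i) f g} (hx : FromDelta a b _ _ x)
    (h : Quiver.Path (DotObj.of b) (DotObj.of c)) : FromDelta a c _ _ (x.wr h) := by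
  obtain ⟨f, g, α, rfl, rfl, hα⟩ := hx
  obtain ⟨h, rfl⟩ := exists_deltaIncl_map i h
  refine ⟨f ≫ h, g ≫ h, α ▷ h, (deltaIncl i).map_comp _ _, (deltaIncl i).map_comp _ _, ?_⟩
  refine (map₂_whiskerRight_heq _ _ _).trans ?_
  rw [eq_of_heq hα]
  rfl

/-- By induction on pastings. The new generators `ϑ` and its inverse start at `𝟢`, so between
objects of `Δ_ℓ` only old generators occur; a whiskering whose middle object is `𝟢` cannot occur
because no path leads there. -/
theorem comesFromDelta {a b : DotObj} {f g : Quiver.Path a b} (x : PreCell (DotCell i) f g) :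
    ComesFromDelta x := by
  induction x with
  | gen x =>
    cases x with
    | of x => exact FromDelta.gen x
    | theta => exact True.intro
    | thetaInv h => exact True.intro
  | @ofEq a b f g h =>
    subst h
    match a, b with
    | .of a, .of b => exact FromDelta.refl f
    | .zero, _ => exact True.intro
    | .of _, .zero => exact True.intro
  | @vcomp a b f g h x y ihx ihy =>
    match a, b with
    | .of a, .of b => exact FromDelta.vcomp ihx ihy
    | .zero, _ => exact True.intro
    | .of _, .zero => exact True.intro
  | @wl a b c f g h x ih =>
    match a, b, c with
    | .of a, .of b, .of c => exact FromDelta.wl f ih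
    | .of a, .zero, _ => exact (isEmpty_path_of_zero a f).elim
    | .zero, _, _ => exact True.intro
    | .of _, .of _, .zero => exact True.intro
  | @wr a b c f g x h ih =>
    match a, b, c with
    | .of a, .of b, .of c => exact FromDelta.wr ih h
    | .of a, .zero, _ => exact (isEmpty_path_of_zero a f).elim
    | .zero, _, _ => exact True.intro
    | .of _, .of _, .zero => exact True.intro

/-- A formal pasting from `𝟢` to `𝟢` represents an identity. -/
def TrivialAtZero : ∀ {a b : DotObj} {f g : Quiver.Path a b}, PreCell (DotCell i) f g → Prop
  | .zero, .zero, f, g, x => ∃ h : f = g, Presented.mk₂ (E := DotRel i) x = Presented.mk₂ (.ofEq h)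
  | .zero, .of _, _, _, _ => True
  | .of _, _, _, _, _ => True

/-- The only path from `𝟢` to itself is empty and no generating `2`-cell lies there. Such pastings
must still be handled, since a formal pasting may whisker one of them by a path out of `𝟢`. -/
theorem trivialAtZero {a b : DotObj} {f g : Quiver.Path a b} (x : PreCell (DotCell i) f g) :
    TrivialAtZero x := by
  induction x with
  | gen x =>
    cases x with
    | of x => exact True.intro
    | theta => exact True.intro
    | thetaInv h => exact True.intro
  | @ofEq a b f g h =>
    match a, b with
    | .zero, .zero => exact ⟨h, rfl⟩
    | .zero, .of _ => exact True.intro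
    | .of _, _ => exact True.intro
  | @vcomp a b f g h x y ihx ihy =>
    match a, b with
    | .zero, .zero =>
      obtain ⟨rfl, hx⟩ := ihx
      obtain ⟨rfl, hy⟩ := ihy
      refine ⟨rfl, ?_⟩
      exact (congrArg₂ Presented.comp₂ hx hy).trans (Quot.sound (.id_comp _))
    | .zero, .of _ => exact True.intro
    | .of _, _ => exact True.intro
  | @wl a b c f g h x ih =>
    match a, b, c with
    | .zero, .zero, .zero =>
      obtain ⟨rfl, hx⟩ := ih
      exact ⟨rfl, (congrArg (Presented.wl₂ f) hx).trans (Quot.sound (.wl_id _ _))⟩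
    | .zero, .of b, .zero => exact (isEmpty_path_of_zero b g).elim
    | .zero, _, .of _ => exact True.intro
    | .of _, _, _ => exact True.intro
  | @wr a b c f g x h ih =>
    match a, b, c with
    | .zero, .zero, .zero =>
      obtain ⟨rfl, hx⟩ := ih
      exact ⟨rfl, (congrArg (Presented.wr₂ · h) hx).trans (Quot.sound (.id_wr _ _))⟩
    | .zero, .of b, .zero => exact (isEmpty_path_of_zero b h).elim
    | .zero, _, .of _ => exact True.intro
    | .of _, _, _ => exact True.intro

end DotCells

theorem heq_of_eq_id {C : Type u} [Category.{v} C] {a b : C} (h : a = b) : 𝟙 a ≍ 𝟙 b := by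
  subst h; rfl

/-- The arrow `d : 𝟢 ⟶ 𝟣`, as a path. -/
abbrev pathD : Quiver.Path DotObj.zero (DotObj.of .one) := Quiver.Hom.toPath DotArr.d

/-- A generating arrow of `Δ_ℓ`, as a `1`-cell. -/
abbrev arr {a b : DObj} (e : DArr a b) : Quiver.Hom (V := DeltaL) a b :=
  Quiver.Hom.toPath (V := DObj) e

/-- A generating `2`-cell of `Δ_ℓ`. -/
abbrev cell {a b : DObj} {f g : Quiver.Path a b} (x : DCell f g) :
    Presented.Cell (noRel DCell) f g := Presented.mk₂ (.gen x)

/-- The `2`-cell `ϑ`. -/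
abbrev theta (i : Prop) : Presented.Cell (DotRel i) (path₂ DotArr.d (DotArr.of DArr.d1))
    (path₂ DotArr.d (DotArr.of DArr.d0)) :=
  Presented.mk₂ (.gen .theta)

variable {A : Type u₁} [Bicategory.{w₁, v₁} A] [Bicategory.Strict A]

/-! ### Cocones and modifications are determined at `d` and `ϑ` -/

namespace WeightedCocone

variable {i : Prop} {D : StrictPseudofunctor DeltaL Aᵒᵖ} {X : A}

/-- The value of a cocone on a path. -/
def onPath (φ : WeightedCocone (descentWeight i) D X) {b : DeltaL}
    (p : Quiver.Path DotObj.zero (DotObj.of b)) : (D.obj b).unop ⟶ X :=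
  (φ.app b).obj p

/-- The value of a cocone on a `2`-cell. -/
def onCell (φ : WeightedCocone (descentWeight i) D X) {b : DeltaL}
    {p q : Quiver.Path DotObj.zero (DotObj.of b)} (x : Presented.Cell (DotRel i) p q) :
    φ.onPath p ⟶ φ.onPath q :=
  (φ.app b).map x

variable (φ ψ : WeightedCocone (descentWeight i) D X)

theorem onPath_comp {b c : DeltaL} (p : Quiver.Path DotObj.zero (DotObj.of b)) (f : b ⟶ c) :
    φ.onPath (p.comp ((deltaIncl i).map f)) = (D.map f).unop ≫ φ.onPath p :=
  φ.naturality_obj f p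

theorem onCell_id {b : DeltaL} (p : Quiver.Path DotObj.zero (DotObj.of b)) :
    φ.onCell (Presented.mk₂ (.ofEq (rfl : p = p))) = 𝟙 (φ.onPath p) :=
  (φ.app b).map_id p

theorem onCell_comp {b : DeltaL} {p q r : Quiver.Path DotObj.zero (DotObj.of b)}
    (x : Presented.Cell (DotRel i) p q) (y : Presented.Cell (DotRel i) q r) :
    φ.onCell (Presented.comp₂ x y) = φ.onCell x ≫ φ.onCell y :=
  (φ.app b).map_comp x y

theorem onCell_wr {b c : DeltaL} {p q : Quiver.Path DotObj.zero (DotObj.of b)}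
    (x : Presented.Cell (DotRel i) p q) (f : b ⟶ c) :
    φ.onCell (Presented.wr₂ x ((deltaIncl i).map f)) ≍ (D.map f).unop ◁ φ.onCell x :=
  (heq_of_eq (φ.naturality_map f (x := p) (y := q) x)).trans
    ((eqToHom_comp_heq _ _).trans (comp_eqToHom_heq _ _))

/-- Naturality in `2`-cells speaks only about cells in the image of `Δ_ℓ`; `comesFromDelta` is what
makes it applicable to every left whiskering by a path out of `𝟢` to an object of `Δ_ℓ`. -/
theorem onCell_wl {b c : DeltaL} (p : Quiver.Path DotObj.zero (DotObj.of b)) {f g : b ⟶ c}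
    (α : f ⟶ g) :
    φ.onCell (Presented.wl₂ p ((deltaIncl i).map₂ α)) ≍ (D.map₂ α).unop2 ▷ φ.onPath p :=
  (heq_of_eq (φ.naturality₂ α p)).trans ((eqToHom_comp_heq _ _).trans (comp_eqToHom_heq _ _))

variable {φ ψ}

/-- A family of `2`-cells is natural at the `2`-cell `x`. -/
def NatSquare (τ : ∀ (b : DeltaL) (p : Quiver.Path DotObj.zero (DotObj.of b)),
    φ.onPath p ⟶ ψ.onPath p) {b : DeltaL} {p q : Quiver.Path DotObj.zero (DotObj.of b)}
    (x : Presented.Cell (DotRel i) p q) : Prop :=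
  φ.onCell x ≫ τ b q = τ b p ≫ ψ.onCell x

namespace NatSquare

variable {τ : ∀ (b : DeltaL) (p : Quiver.Path DotObj.zero (DotObj.of b)),
    φ.onPath p ⟶ ψ.onPath p}

theorem id {b : DeltaL} (p : Quiver.Path DotObj.zero (DotObj.of b)) :
    NatSquare τ (Presented.mk₂ (.ofEq (rfl : p = p))) := by
  unfold NatSquare
  rw [onCell_id, onCell_id, Category.id_comp, Category.comp_id]

theorem comp {b : DeltaL} {p q r : Quiver.Path DotObj.zero (DotObj.of b)}
    {x : Presented.Cell (DotRel i) p q} {y : Presented.Cell (DotRel i) q r}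
    (hx : NatSquare τ x) (hy : NatSquare τ y) : NatSquare τ (Presented.comp₂ x y) := by
  unfold NatSquare at *
  rw [onCell_comp, onCell_comp, Category.assoc, hy, ← Category.assoc, hx, Category.assoc]

/-- Needed for the generator inverse to `ϑ`, so that no separate hypothesis is required when `i`
holds. -/
theorem inv {b : DeltaL} {p q : Quiver.Path DotObj.zero (DotObj.of b)}
    {x : Presented.Cell (DotRel i) p q} {y : Presented.Cell (DotRel i) q p}
    (hx : NatSquare τ x) (h₁ : Presented.comp₂ x y = Presented.mk₂ (.ofEq rfl))
    (h₂ : Presented.comp₂ y x = Presented.mk₂ (.ofEq rfl)) : NatSquare τ y := by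
  have hφ := φ.onCell_comp y x
  have hψ := ψ.onCell_comp x y
  rw [h₂, onCell_id] at hφ
  rw [h₁, onCell_id] at hψ
  unfold NatSquare at *
  rw [← Category.comp_id (φ.onCell _ ≫ _), hψ, Category.assoc, ← Category.assoc (τ _ _),
    ← hx, Category.assoc, ← Category.assoc, ← hφ, Category.id_comp]

theorem of_heq {b : DeltaL} {p q p' q' : Quiver.Path DotObj.zero (DotObj.of b)}
    {x : Presented.Cell (DotRel i) p q} {x' : Presented.Cell (DotRel i) p' q'} (hx : NatSquare τ x)
    (hp : p = p') (hq : q = q') (h : x ≍ x') : NatSquare τ x' := by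
  subst hp hq; cases h; exact hx

/-- The whiskered cell comes from `Δ_ℓ`, so both cocones send it to a right whiskering of a value of
`D`, while `τ` becomes a left whiskering; the square is then the interchange law and needs nothing
about `ϑ`. -/
theorem wl (hτ : ∀ {b c : DeltaL} (p : Quiver.Path DotObj.zero (DotObj.of b)) (f : b ⟶ c),
      τ c (p.comp ((deltaIncl i).map f)) ≍ (D.map f).unop ◁ τ b p)
    {b c : DeltaL} (f : Quiver.Path DotObj.zero (DotObj.of b))
    {g h : Quiver.Path (DotObj.of b) (DotObj.of c)} (x : PreCell (DotCell i) g h) :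
    NatSquare τ (Presented.mk₂ (x.wl f)) := by
  obtain ⟨g, h, α, rfl, rfl, hα⟩ := comesFromDelta x
  have e : Presented.mk₂ (E := DotRel i) (x.wl f) =
    Presented.wl₂ f ((deltaIncl i).map₂ α) := by rw [eq_of_heq hα]; rfl
  rw [e]
  have h₁ := heq_comp (φ.onPath_comp f g) (φ.onPath_comp f h) (ψ.onPath_comp f h)
    (φ.onCell_wl f α) (hτ f h)
  have h₂ := heq_comp (φ.onPath_comp f g) (ψ.onPath_comp f g) (ψ.onPath_comp f h)
    (hτ f g) (ψ.onCell_wl f α)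
  exact eq_of_heq (h₁.trans ((heq_of_eq (whisker_exchange _ _).symm).trans h₂.symm))

theorem nil_wl {b : DeltaL} {p q : Quiver.Path DotObj.zero (DotObj.of b)}
    {x : PreCell (DotCell i) p q} (hx : NatSquare τ (Presented.mk₂ x)) :
    NatSquare τ (Presented.mk₂ (x.wl Quiver.Path.nil)) := by
  refine hx.of_heq (Quiver.Path.nil_comp p).symm (Quiver.Path.nil_comp q).symm ?_
  exact (id_whiskerLeft_heq (B := DeltaDot i) (a := DotObj.zero) (b := DotObj.of b) (f := p) (g := q)
    (Presented.mk₂ x)).symm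

/-- Both cocones and `τ` turn composition with a path of `Δ_ℓ` into left whiskering by the same
`1`-cell, so the square is a whiskering of the one for `x`. -/
theorem wr (hτ : ∀ {b c : DeltaL} (p : Quiver.Path DotObj.zero (DotObj.of b)) (f : b ⟶ c),
      τ c (p.comp ((deltaIncl i).map f)) ≍ (D.map f).unop ◁ τ b p)
    {b c : DeltaL} {f g : Quiver.Path DotObj.zero (DotObj.of b)} {x : PreCell (DotCell i) f g}
    (hx : NatSquare τ (Presented.mk₂ x)) (h : Quiver.Path (DotObj.of b) (DotObj.of c)) :
    NatSquare τ (Presented.mk₂ (x.wr h)) := by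
  obtain ⟨h, rfl⟩ := exists_deltaIncl_map i h
  have h₁ := heq_comp (φ.onPath_comp f h) (φ.onPath_comp g h) (ψ.onPath_comp g h)
    (φ.onCell_wr (Presented.mk₂ x) h) (hτ g h)
  have h₂ := heq_comp (φ.onPath_comp f h) (ψ.onPath_comp f h) (ψ.onPath_comp g h)
    (hτ f h) (ψ.onCell_wr (Presented.mk₂ x) h)
  refine eq_of_heq (h₁.trans (HEq.trans (heq_of_eq ?_) h₂.symm))
  rw [← Bicategory.whiskerLeft_comp, ← Bicategory.whiskerLeft_comp]
  exact congrArg _ hx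

theorem zero_wr {b : DeltaL} {f g : Quiver.Path DotObj.zero DotObj.zero}
    (x : PreCell (DotCell i) f g) (h : Quiver.Path DotObj.zero (DotObj.of b)) :
    NatSquare τ (Presented.mk₂ (x.wr h)) := by
  obtain ⟨rfl, hx⟩ := trivialAtZero x
  have e : Presented.mk₂ (E := DotRel i) (x.wr h) = Presented.mk₂ (.ofEq rfl) :=
    (congrArg (Presented.wr₂ · h) hx).trans (Quot.sound (.id_wr _ _))
  rw [e]
  exact NatSquare.id _

end NatSquare

/-- A family of `2`-cells is natural at the `2`-cell represented by `x`, if the latter goes from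
`𝟢` to an object of `Δ_ℓ`. -/
def NaturalAt (τ : ∀ (b : DeltaL) (p : Quiver.Path DotObj.zero (DotObj.of b)),
    φ.onPath p ⟶ ψ.onPath p) :
    ∀ {a b : DotObj} {f g : Quiver.Path a b}, PreCell (DotCell i) f g → Prop
  | .zero, .of b, _, _, x => NatSquare τ (b := b) (Presented.mk₂ x)
  | .zero, .zero, _, _, _ => True
  | .of _, _, _, _, _ => True

/-- Naturality on all `2`-cells out of `𝟢` reduces to the single generator `ϑ`. The induction runs
over pastings with arbitrary ends, because a subpasting of a pasting out of `𝟢` need not itself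
start there. -/
theorem naturalAt (τ : ∀ (b : DeltaL) (p : Quiver.Path DotObj.zero (DotObj.of b)),
      φ.onPath p ⟶ ψ.onPath p)
    (hτ : ∀ {b c : DeltaL} (p : Quiver.Path DotObj.zero (DotObj.of b)) (f : b ⟶ c),
      τ c (p.comp ((deltaIncl i).map f)) ≍ (D.map f).unop ◁ τ b p)
    (hθ : NatSquare τ (b := DObj.two) (theta i))
    {a b : DotObj} {f g : Quiver.Path a b} (x : PreCell (DotCell i) f g) :
    NaturalAt τ x := by
  induction x with
  | gen x =>
    cases x with
    | of x => exact True.intro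
    | theta => exact hθ
    | thetaInv h =>
      exact NatSquare.inv hθ (Quot.sound (.rel (.theta_inv h))) (Quot.sound (.rel (.inv_theta h)))
  | @ofEq a b f g h =>
    subst h
    match a, b with
    | .zero, .of b => exact NatSquare.id f
    | .zero, .zero => exact True.intro
    | .of _, _ => exact True.intro
  | @vcomp a b f g h x y ihx ihy =>
    match a, b with
    | .zero, .of b => exact NatSquare.comp ihx ihy
    | .zero, .zero => exact True.intro
    | .of _, _ => exact True.intro
  | @wl a b c f g h x ih =>
    match a, b, c with
    | .zero, .of b, .of c => exact NatSquare.wl hτ f x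
    | .zero, .zero, .of c =>
      obtain rfl := path_zero_zero f
      exact NatSquare.nil_wl ih
    | .zero, _, .zero => exact True.intro
    | .of _, _, _ => exact True.intro
  | @wr a b c f g x h ih =>
    match a, b, c with
    | .zero, .of b, .of c => exact NatSquare.wr hτ ih h
    | .zero, .zero, .of c => exact NatSquare.zero_wr x h
    | .zero, _, .zero => exact True.intro
    | .of _, _, _ => exact True.intro

theorem natSquare {τ : ∀ (b : DeltaL) (p : Quiver.Path DotObj.zero (DotObj.of b)),
      φ.onPath p ⟶ ψ.onPath p}
    (hτ : ∀ {b c : DeltaL} (p : Quiver.Path DotObj.zero (DotObj.of b)) (f : b ⟶ c),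
      τ c (p.comp ((deltaIncl i).map f)) ≍ (D.map f).unop ◁ τ b p)
    (hθ : NatSquare τ (b := DObj.two) (theta i)) {b : DeltaL}
    {p q : Quiver.Path DotObj.zero (DotObj.of b)} (x : Presented.Cell (DotRel i) p q) :
    NatSquare τ x := by
  induction x using Quot.inductionOn with | _ x
  exact naturalAt τ hτ hθ x

theorem exists_path_comp (i : Prop) {b : DeltaL} (p : Quiver.Path DotObj.zero (DotObj.of b)) :
    ∃ f : Quiver.Hom (V := DeltaL) DObj.one b, pathD.comp ((deltaIncl i).map f) = p := by
  obtain ⟨q, rfl⟩ := exists_path_zero p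
  exact ⟨q, congrArg pathD.comp (deltaIncl_map i q)⟩

/-- A cocone is determined by its values at `d` and `ϑ`. -/
theorem ext_of_theta (h : φ.onPath (b := DObj.one) pathD = ψ.onPath (b := DObj.one) pathD)
    (hθ : φ.onCell (b := DObj.two) (theta i) ≍ ψ.onCell (b := DObj.two) (theta i)) : φ = ψ := by
  have hobj : ∀ {b : DeltaL} (p : Quiver.Path DotObj.zero (DotObj.of b)),
      φ.onPath p = ψ.onPath p := fun {b} p => by
    obtain ⟨f, rfl⟩ := exists_path_comp i p
    exact (φ.onPath_comp _ f).trans ((congrArg _ h).trans (ψ.onPath_comp _ f).symm)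
  -- Naturality of the family of identities `eqToHom` says exactly that the two cocones agree on
  -- `2`-cells, so checking it at `ϑ` suffices.
  have key : ∀ {b : DeltaL} {p q : Quiver.Path DotObj.zero (DotObj.of b)}
      (x : Presented.Cell (DotRel i) p q),
      NatSquare (φ := φ) (ψ := ψ) (fun b p => eqToHom (hobj p)) x := by
    refine natSquare (fun {b c} p f => ?_) ?_
    · rw [whiskerLeft_eqToHom]
      exact (eqToHom_heq_id_dom _ _ _).trans
        ((heq_of_eq_id (φ.onPath_comp p f)).trans (eqToHom_heq_id_dom _ _ _).symm)
    · refine eq_of_heq ((comp_eqToHom_heq _ _).trans (hθ.trans (eqToHom_comp_heq _ _).symm))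
  have happ : φ.app = ψ.app := by
    funext b
    refine CategoryTheory.Functor.ext (fun p => hobj p) fun p q x => ?_
    have := key (b := b) (p := p) (q := q) x
    refine (conj_eqToHom_iff_heq _ _ _ (hobj (b := b) q)).2 ?_
    exact (comp_eqToHom_heq _ _).symm.trans ((heq_of_eq this).trans (eqToHom_comp_heq _ _))
  -- The remaining fields are propositions, so equality of `app` is enough.
  cases φ; cases ψ; cases happ; rfl

/-- A modification is determined by its component at `d`. -/
theorem hom_ext_of_pathD {Γ Θ : φ ⟶ ψ}
    (h : (Γ.app DObj.one).app pathD = (Θ.app DObj.one).app pathD) : Γ = Θ := by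
  refine Hom.ext (funext fun b => ?_)
  ext p
  obtain ⟨f, rfl⟩ := exists_path_comp i p
  have h₁ := Γ.comm f pathD
  have h₂ := Θ.comm f pathD
  rw [h] at h₁
  exact h₁.trans h₂.symm

/-- The factorisation of a path through `d` is unique, so the choice of factorisations in
`exists_hom` is harmless. -/
theorem path_comp_injective {b : DeltaL} {f g : Quiver.Hom (V := DeltaL) DObj.one b}
    (h : pathD.comp ((deltaIncl i).map f) = pathD.comp ((deltaIncl i).map g)) : f = g :=
  deltaIncl_map_injective (i := i) (Quiver.Path.comp_injective_right _ h)

/-- A `2`-cell compatible with the values at `ϑ` extends to a modification. -/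
theorem exists_hom (η : φ.onPath (b := DObj.one) pathD ⟶ ψ.onPath (b := DObj.one) pathD)
    (hη : φ.onCell (b := DObj.two) (theta i) ≫
          eqToHom (φ.onPath_comp (b := DObj.one) pathD (arr .d0)) ≫ (D.map (arr .d0)).unop ◁ η =
      eqToHom (φ.onPath_comp (b := DObj.one) pathD (arr .d1)) ≫
        (D.map (arr .d1)).unop ◁ η ≫ eqToHom (ψ.onPath_comp (b := DObj.one) pathD (arr .d1)).symm ≫
        ψ.onCell (b := DObj.two) (theta i) ≫
          eqToHom (ψ.onPath_comp (b := DObj.one) pathD (arr .d0))) :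
    ∃ Γ : φ ⟶ ψ, (Γ.app DObj.one).app pathD = η := by
  -- Writing each path out of `𝟢` as `d` followed by a path of `Δ_ℓ` forces the component there to
  -- be the whiskering of `η` by the value of `D`.
  choose F hF using fun (b : DeltaL) (p : Quiver.Path DotObj.zero (DotObj.of b)) =>
    exists_path_comp i p
  have hobj : ∀ (χ : WeightedCocone (descentWeight i) D X) (b : DeltaL)
      (p : Quiver.Path DotObj.zero (DotObj.of b)),
      χ.onPath p = (D.map (F b p)).unop ≫ χ.onPath (b := DObj.one) pathD := fun χ b p => by
    conv_lhs => rw [← hF b p]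
    exact χ.onPath_comp _ _
  let τ : ∀ (b : DeltaL) (p : Quiver.Path DotObj.zero (DotObj.of b)),
      φ.onPath p ⟶ ψ.onPath p := fun b p =>
    eqToHom (hobj φ b p) ≫ (D.map (F b p)).unop ◁ η ≫ eqToHom (hobj ψ b p).symm
  have τ_heq : ∀ {b : DeltaL} (f : Quiver.Hom (V := DeltaL) DObj.one b),
      τ b (pathD.comp ((deltaIncl i).map f)) ≍ (D.map f).unop ◁ η := fun {b} f => by
    refine (eqToHom_comp_heq _ _).trans ((comp_eqToHom_heq _ _).trans ?_)
    rw [path_comp_injective (hF b (pathD.comp ((deltaIncl i).map f)))]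
  have hτ : ∀ {b c : DeltaL} (p : Quiver.Path DotObj.zero (DotObj.of b)) (f : b ⟶ c),
      τ c (p.comp ((deltaIncl i).map f)) ≍ (D.map f).unop ◁ τ b p := fun {b c} p f => by
    obtain ⟨g, rfl⟩ := exists_path_comp i p
    have e : (pathD.comp ((deltaIncl i).map g)).comp ((deltaIncl i).map f) =
        pathD.comp ((deltaIncl i).map (g ≫ f)) :=
      (Quiver.Path.comp_assoc _ _ _).trans (congrArg pathD.comp ((deltaIncl i).map_comp g f).symm)
    refine (congr_arg_heq (τ c) e).trans ((τ_heq (g ≫ f)).trans ?_)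
    refine (whiskerLeft_heq (congrArg Quiver.Hom.unop (D.map_comp g f)) rfl rfl .rfl).trans ?_
    refine (comp_whiskerLeft_heq _ _ _).trans ?_
    exact whiskerLeft_heq rfl (φ.onPath_comp pathD g).symm (ψ.onPath_comp pathD g).symm
      (τ_heq g).symm
  -- Once the components of `τ` at `d⁰d` and `d¹d` are identified with whiskerings of `η`, the
  -- square at `ϑ` is the hypothesis `hη`.
  have hθ : NatSquare τ (b := DObj.two) (theta i) := by
    refine eq_of_heq (((heq_comp rfl rfl (ψ.onPath_comp (b := DObj.one) pathD (arr .d0)) .rfl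
      ((τ_heq (arr .d0)).trans (eqToHom_comp_heq _ (φ.onPath_comp (b := DObj.one) pathD
        (arr .d0))).symm)).trans (heq_of_eq hη)).trans ?_)
    refine (eqToHom_comp_heq _ _).trans ?_
    refine heq_comp (φ.onPath_comp (b := DObj.one) pathD (arr .d1)).symm
      (ψ.onPath_comp (b := DObj.one) pathD (arr .d1)).symm
      (ψ.onPath_comp (b := DObj.one) pathD (arr .d0)).symm (τ_heq (arr .d1)).symm ?_
    exact (eqToHom_comp_heq _ _).trans (comp_eqToHom_heq _ _)
  refine ⟨⟨fun b => ⟨fun p => τ b p, fun p q x => natSquare hτ hθ (b := b) x⟩, fun {b c} f p => ?_⟩,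
    ?_⟩
  · exact (conj_eqToHom_iff_heq _ _ _ (ψ.onPath_comp p f)).2 (hτ p f)
  · refine eq_of_heq ((τ_heq (𝟙 _)).trans ?_)
    exact (whiskerLeft_heq (congrArg Quiver.Hom.unop (D.map_id _)) rfl rfl .rfl).trans
      (id_whiskerLeft_heq _)

end WeightedCocone

/-! ### Codescent data: the equations at `d` and `ϑ` -/

/-- Replaces the six cells of the associativity equation by heterogeneously equal ones, with
`eqToHom`s filling the gaps. It is used in one direction to extract the equation from a cocone and
in the other to verify the relation when a datum is extended. -/
theorem comp₄_eq_iff {C : Type u} [Category.{v} C] {a b z p q r a' b' b'' z' a'' p' p'' q' q'' r'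
    r'' z'' : C} {c₁ : a ⟶ b} {c₂ : b ⟶ z} {c₃ : a ⟶ p} {c₄ : p ⟶ q} {c₅ : q ⟶ r} {c₆ : r ⟶ z}
    {c₁' : a' ⟶ b'} {c₂' : b'' ⟶ z'} {c₃' : a'' ⟶ p'} {c₄' : p'' ⟶ q'} {c₅' : q'' ⟶ r'}
    {c₆' : r'' ⟶ z''} (ha : a = a') (hb : b = b') (hz : z = z') (hp : p = p') (hq : q = q')
    (hr : r = r') (e₁ : b' = b'') (e₂ : a' = a'') (e₃ : p' = p'') (e₄ : q' = q'') (e₅ : r' = r'')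
    (e₆ : z'' = z') (h₁ : c₁ ≍ c₁') (h₂ : c₂ ≍ c₂') (h₃ : c₃ ≍ c₃') (h₄ : c₄ ≍ c₄') (h₅ : c₅ ≍ c₅')
    (h₆ : c₆ ≍ c₆') :
    c₁ ≫ c₂ = c₃ ≫ c₄ ≫ c₅ ≫ c₆ ↔
      c₁' ≫ eqToHom e₁ ≫ c₂' = eqToHom e₂ ≫ c₃' ≫ eqToHom e₃ ≫ c₄' ≫ eqToHom e₄ ≫ c₅' ≫
        eqToHom e₅ ≫ c₆' ≫ eqToHom e₆ := by
  subst ha hb hz hp hq hr e₁ e₂ e₃ e₄ e₅ e₆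
  cases h₁; cases h₂; cases h₃; cases h₄; cases h₅; cases h₆
  simp

theorem conj_comp_conj {C : Type u} [Category.{v} C] {a b c d : C} {x : b ⟶ c} {y : c ⟶ b}
    (h : x ≫ y = 𝟙 b) (e : a = b) (e' : c = d) :
    (eqToHom e ≫ x ≫ eqToHom e') ≫ (eqToHom e'.symm ≫ y ≫ eqToHom e.symm) = 𝟙 a := by
  subst e e'; simpa using h

theorem comp_eq_iff {C : Type u} [Category.{v} C] {a b z a' b' b'' z' z'' : C} {c₁ : a ⟶ b}
    {c₂ : b ⟶ z} {c₃ : a ⟶ z} {c₁' : a' ⟶ b'} {c₂' : b'' ⟶ z'} {c₃' : a' ⟶ z''} (ha : a = a')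
    (hb : b = b') (hz : z = z') (e₁ : b' = b'') (e₂ : z'' = z') (h₁ : c₁ ≍ c₁') (h₂ : c₂ ≍ c₂')
    (h₃ : c₃ ≍ c₃') : c₁ ≫ c₂ = c₃ ↔ c₁' ≫ eqToHom e₁ ≫ c₂' = c₃' ≫ eqToHom e₂ := by
  subst ha hb hz e₁ e₂
  cases h₁; cases h₂; cases h₃
  simp

variable {A : Type u₁} [Bicategory.{w₁, v₁} A]

theorem unop2_heq {a b : Aᵒᵖ} {f g f' g' : a ⟶ b} {η : f ⟶ g} {η' : f' ⟶ g'} (hf : f = f')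
    (hg : g = g') (h : η ≍ η') : η.unop2 ≍ η'.unop2 := by
  subst hf hg; cases h; rfl

theorem op_heq {a b : Aᵒᵖ} {f g f' g' : a ⟶ b} {η : f ⟶ g} {η' : f' ⟶ g'} (hf : f = f')
    (hg : g = g') (h : η.unop2 ≍ η'.unop2) : η ≍ η' := by
  subst hf hg; exact heq_of_eq (hom2_ext (eq_of_heq h))

variable [Bicategory.Strict A] {D : StrictPseudofunctor DeltaL Aᵒᵖ} {X : A}

theorem map_path₂_comp (D : StrictPseudofunctor DeltaL Aᵒᵖ) {a b c : DObj} (e : DArr a b)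
    (e' : DArr b c) (f : (D.obj a).unop ⟶ X) :
    (D.map (X := a) (Y := c) (path₂ (V := DObj) e e')).unop ≫ f =
      (D.map (arr e')).unop ≫ (D.map (arr e)).unop ≫ f :=
  (congrArg (·.unop ≫ f) (D.map_comp (arr e) (arr e'))).trans (Bicategory.Strict.assoc _ _ _)

/-- The `2`-cell of `A` assigned to a generating `2`-cell. -/
abbrev genCell (D : StrictPseudofunctor DeltaL Aᵒᵖ) {a b : DObj} {f g : Quiver.Path a b}
    (x : DCell f g) : (D.map (X := a) (Y := b) f).unop ⟶ (D.map (X := a) (Y := b) g).unop :=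
  (D.map₂ (a := a) (b := b) (f := f) (g := g) (cell x)).unop2

/-- The `2`-cell `θ` satisfies the equations imposed on `ϑ`. -/
structure IsCodescentDatum (D : StrictPseudofunctor DeltaL Aᵒᵖ) {X : A}
    (f : (D.obj DObj.one).unop ⟶ X)
    (θ : (D.map (arr .d1)).unop ≫ f ⟶ (D.map (arr .d0)).unop ≫ f) : Prop where
  assoc : genCell D .s21 ▷ f ≫ eqToHom (map_path₂_comp D .d1 .p1 f) ≫
        (D.map (arr .p1)).unop ◁ θ =
      eqToHom (map_path₂_comp D .d1 .p2 f) ≫ (D.map (arr .p2)).unop ◁ θ ≫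
        eqToHom (map_path₂_comp D .d0 .p2 f).symm ≫ genCell D .s20 ▷ f ≫
          eqToHom (map_path₂_comp D .d1 .p0 f) ≫ (D.map (arr .p0)).unop ◁ θ ≫
            eqToHom (map_path₂_comp D .d0 .p0 f).symm ≫ genCell D .s00 ▷ f ≫
              eqToHom (map_path₂_comp D .d0 .p1 f)
  unit : genCell D .n1 ▷ f ≫ eqToHom (map_path₂_comp D .d1 .s0 f) ≫ (D.map (arr .s0)).unop ◁ θ =
      genCell D .n0 ▷ f ≫ eqToHom (map_path₂_comp D .d0 .s0 f)

namespace WeightedCocone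

variable {i : Prop} (φ : WeightedCocone (descentWeight i) D X)

/-- The value at `d` of a cocone. -/
abbrev leg : (D.obj DObj.one).unop ⟶ X := φ.onPath (b := DObj.one) pathD

/-- The value at `ϑ` of a cocone. -/
abbrev legCell : (D.map (arr .d1)).unop ≫ φ.leg ⟶ (D.map (arr .d0)).unop ≫ φ.leg :=
  eqToHom (φ.onPath_comp (b := DObj.one) pathD (arr .d1)).symm ≫
    φ.onCell (b := DObj.two) (theta i) ≫ eqToHom (φ.onPath_comp (b := DObj.one) pathD (arr .d0))

theorem legCell_heq : φ.onCell (b := DObj.two) (theta i) ≍ φ.legCell :=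
  ((eqToHom_comp_heq _ _).trans (comp_eqToHom_heq _ _)).symm

theorem onCell_gen {a b : DObj} {f g : Quiver.Path a b} (x : DCell f g)
    (p : Quiver.Path DotObj.zero (DotObj.of a)) :
    φ.onCell (b := b) (Presented.mk₂ (.wl p (dotGen i x))) ≍ genCell D x ▷ φ.onPath (b := a) p := by
  have h := φ.onCell_wl p (Presented.mk₂ (.gen x) : Presented.Cell (noRel DCell) f g)
  cases x <;> exact h

theorem onCell_theta_wr {b : DObj} (e : DArr .two b) :
    φ.onCell (b := b) (Presented.mk₂ (.wr (.gen .theta)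
      (Quiver.Hom.toPath (DotArr.of e)))) ≍ (D.map (arr e)).unop ◁ φ.legCell :=
  (φ.onCell_wr (b := DObj.two) (theta i) (arr e)).trans
    (whiskerLeft_heq rfl (φ.onPath_comp (b := DObj.one) pathD (arr .d1))
      (φ.onPath_comp (b := DObj.one) pathD (arr .d0)) φ.legCell_heq)

theorem onPath_of_path₂ {a b c : DObj} (p : Quiver.Path DotObj.zero (DotObj.of a))
    (e : DArr a b) (e' : DArr b c) :
    φ.onPath (b := c) (p.comp (path₂ (DotArr.of e) (DotArr.of e'))) =
      (D.map (X := a) (Y := c) (path₂ (V := DObj) e e')).unop ≫ φ.onPath (b := a) p :=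
  φ.onPath_comp p (path₂ (V := DObj) e e')

theorem onCell_eq_comp₄ {b : DeltaL} {a p q r s z : Quiver.Path DotObj.zero (DotObj.of b)}
    {x₁ : PreCell (DotCell i) a p} {x₂ : PreCell (DotCell i) p z} {x₃ : PreCell (DotCell i) a q}
    {x₄ : PreCell (DotCell i) q r} {x₅ : PreCell (DotCell i) r s} {x₆ : PreCell (DotCell i) s z}
    (h : Presented.mk₂ (E := DotRel i) (x₁.vcomp x₂) =
      Presented.mk₂ (x₃.vcomp (x₄.vcomp (x₅.vcomp x₆)))) :
    φ.onCell (Presented.mk₂ x₁) ≫ φ.onCell (Presented.mk₂ x₂) =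
      φ.onCell (Presented.mk₂ x₃) ≫ φ.onCell (Presented.mk₂ x₄) ≫ φ.onCell (Presented.mk₂ x₅) ≫
        φ.onCell (Presented.mk₂ x₆) := by
  rw [← onCell_comp, ← onCell_comp, ← onCell_comp, ← onCell_comp]
  exact congrArg φ.onCell h

theorem onCell_eq_comp {b : DeltaL} {a p z : Quiver.Path DotObj.zero (DotObj.of b)}
    {x₁ : PreCell (DotCell i) a p} {x₂ : PreCell (DotCell i) p z} {x₃ : PreCell (DotCell i) a z}
    (h : Presented.mk₂ (E := DotRel i) (x₁.vcomp x₂) = Presented.mk₂ x₃) :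
    φ.onCell (Presented.mk₂ x₁) ≫ φ.onCell (Presented.mk₂ x₂) = φ.onCell (Presented.mk₂ x₃) := by
  rw [← onCell_comp]
  exact congrArg φ.onCell h

/-- Both equations are the images under the cocone of the relations imposed on `ϑ`, each whiskered
piece being rewritten by naturality. -/
theorem isCodescentDatum : IsCodescentDatum D φ.leg φ.legCell where
  assoc := by
    refine (comp₄_eq_iff (φ.onPath_of_path₂ pathD .d1 .p2) (φ.onPath_of_path₂ pathD .d1 .p1)
      ((φ.onPath_of_path₂ pathD .d0 .p1).trans (map_path₂_comp D _ _ _))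
      ((φ.onPath_of_path₂ pathD .d0 .p2).trans (map_path₂_comp D _ _ _))
      (φ.onPath_of_path₂ pathD .d1 .p0)
      ((φ.onPath_of_path₂ pathD .d0 .p0).trans (map_path₂_comp D _ _ _)) _ _ _ _ _ _
      (φ.onCell_gen .s21 pathD) (φ.onCell_theta_wr .p1) (φ.onCell_theta_wr .p2)
      (φ.onCell_gen .s20 pathD) (φ.onCell_theta_wr .p0) (φ.onCell_gen .s00 pathD)).1 ?_
    exact φ.onCell_eq_comp₄ (b := DObj.three) (Quot.sound (.rel (DotRel.assoc (i := i))))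
  unit := by
    refine (comp_eq_iff (φ.onPath_comp (b := DObj.one) (c := DObj.one) pathD (𝟙 _))
      (φ.onPath_of_path₂ pathD .d1 .s0)
      ((φ.onPath_of_path₂ pathD .d0 .s0).trans (map_path₂_comp D _ _ _)) _ _
      (φ.onCell_gen .n1 pathD) (φ.onCell_theta_wr .s0) (φ.onCell_gen .n0 pathD)).1 ?_
    exact φ.onCell_eq_comp (b := DObj.one) (Quot.sound (.rel (DotRel.unit (i := i))))

end WeightedCocone

/-! ### Extending a codescent datum to a cocone -/

section Extension

variable (D) {X : A} (f : (D.obj DObj.one).unop ⟶ X)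
    (θ : (D.map (arr .d1)).unop ≫ f ⟶ (D.map (arr .d0)).unop ≫ f)

/-- The extension to `Δ̇` of the action of `D` on objects and arrows. -/
def extPre : DotObj ⥤q Aᵒᵖ where
  obj
    | .zero => op X
    | .of b => D.obj b
  map
    | .d => f.op
    | .of e => D.map (arr e)

theorem pathMap_extPre {a b : DObj} (p : Quiver.Path a b) :
    pathMap (extPre D f) (dotIncl.mapPath p) = D.map (X := a) (Y := b) p := by
  induction p with
  | nil => exact (D.map_id a).symm
  | cons p e ih =>
    exact (congrArg (· ≫ D.map (arr e)) ih).trans (D.map_comp (b := _) p (arr e)).symm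

theorem pathMap_extPre_d {b : DObj} (e : DArr .one b) :
    (pathMap (extPre D f) (path₂ DotArr.d (DotArr.of e))).unop = (D.map (arr e)).unop ≫ f :=
  congrArg ((D.map (arr e)).unop ≫ ·) (Bicategory.Strict.comp_id f)

variable {i : Prop}

/-- The extension to `Δ̇` of the action of `D` on generating `2`-cells. -/
noncomputable def extCell (hθ : i → IsIso θ) ⦃a b : DotObj⦄ ⦃p q : Quiver.Path a b⦄ :
    DotCell i p q → (pathMap (extPre D f) p ⟶ pathMap (extPre D f) q)
  | .of (a := a) (b := b) (f := p) (g := q) x => eqToHom (pathMap_extPre D f p) ≫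
      D.map₂ (a := a) (b := b) (f := p) (g := q) (cell x) ≫ eqToHom (pathMap_extPre D f q).symm
  | .theta => opCell θ (pathMap_extPre_d D f .d1) (pathMap_extPre_d D f .d0).symm
  | .thetaInv h =>
      opCell (@inv _ _ _ _ θ (hθ h)) (pathMap_extPre_d D f .d0) (pathMap_extPre_d D f .d1).symm

theorem pathMap_extPre_path₂ {a b : DObj} (e : DArr .one a) (e' : DArr a b) :
    (pathMap (extPre D f) (path₂ DotArr.d (DotArr.of e) |>.cons (DotArr.of e'))).unop =
      (D.map (arr e')).unop ≫ (D.map (arr e)).unop ≫ f :=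
  congrArg ((D.map (arr e')).unop ≫ ·) (pathMap_extPre_d D f e)

theorem cellMap_ext_gen (hθ : i → IsIso θ) {b : DObj} {p q : Quiver.Path DObj.one b}
    (x : DCell p q) :
    (cellMap (extPre D f) (extCell D f θ hθ) (.wl pathD (dotGen i x))).unop2 ≍
      genCell D x ▷ f := by
  have h : pathMap (extPre D f) pathD = f.op := Bicategory.Strict.id_comp (B := Aᵒᵖ) f.op
  refine unop2_heq (η' := f.op ◁ D.map₂ (f := p) (g := q) (cell x)) ?_ ?_ ?_
  · exact (pathMap_comp _ _ _).trans (congrArg₂ (· ≫ ·) h (pathMap_extPre D f p))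
  · exact (pathMap_comp _ _ _).trans (congrArg₂ (· ≫ ·) h (pathMap_extPre D f q))
  · refine (eqToHom_comp_heq _ _).trans ((comp_eqToHom_heq _ _).trans ?_)
    exact whiskerLeft_heq h (pathMap_extPre D f p) (pathMap_extPre D f q)
      ((eqToHom_comp_heq _ _).trans (comp_eqToHom_heq _ _))

theorem cellMap_ext_theta (hθ : i → IsIso θ) {b : DObj} (e : DArr .two b) :
    (cellMap (extPre D f) (extCell D f θ hθ)
      (.wr (.gen .theta) (Quiver.Hom.toPath (DotArr.of e)))).unop2 ≍
      (D.map (arr e)).unop ◁ θ := by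
  have h : pathMap (extPre D f) (Quiver.Hom.toPath (DotArr.of e)) = D.map (arr e) :=
    Bicategory.Strict.id_comp (B := Aᵒᵖ) _
  refine unop2_heq (η' := Bicategory.Opposite.op2 θ ▷ D.map (arr e)) ?_ ?_ ?_
  · exact congrArg Quiver.Hom.op (pathMap_extPre_path₂ D f .d1 e)
  · exact congrArg Quiver.Hom.op (pathMap_extPre_path₂ D f .d0 e)
  · refine (eqToHom_comp_heq _ _).trans ((comp_eqToHom_heq _ _).trans ?_)
    refine whiskerRight_heq h (congrArg Quiver.Hom.op (pathMap_extPre_d D f .d1))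
      (congrArg Quiver.Hom.op (pathMap_extPre_d D f .d0)) ?_
    refine op_heq (congrArg Quiver.Hom.op (pathMap_extPre_d D f .d1))
      (congrArg Quiver.Hom.op (pathMap_extPre_d D f .d0)) ?_
    exact (eqToHom_comp_heq _ _).trans (comp_eqToHom_heq _ _)

/-- The hypotheses on `(f, θ)` are the defining relations of `Δ̇` read in `Aᵒᵖ`: the two codescent
equations and, when `i` holds, invertibility of `θ`. -/
theorem extCell_rel (hθ : i → IsIso θ) (h : IsCodescentDatum D f θ) ⦃a b : DotObj⦄
    ⦃p q : Quiver.Path a b⦄ (x y : PreCell (DotCell i) p q) (hxy : DotRel i x y) :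
    cellMap (extPre D f) (extCell D f θ hθ) x = cellMap (extPre D f) (extCell D f θ hθ) y := by
  cases hxy with
  | assoc =>
    have e := fun {a b : DObj} (e : DArr .one a) (e' : DArr a b) =>
      (pathMap_extPre_path₂ D f e e').trans (map_path₂_comp D e e' f).symm
    refine hom2_ext ((comp₄_eq_iff (e .d1 .p2) (e .d1 .p1) (pathMap_extPre_path₂ D f _ _)
      (pathMap_extPre_path₂ D f _ _) (e .d1 .p0) (pathMap_extPre_path₂ D f _ _) _ _ _ _ _ _
      (cellMap_ext_gen D f θ hθ .s21) (cellMap_ext_theta D f θ hθ .p1)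
      (cellMap_ext_theta D f θ hθ .p2) (cellMap_ext_gen D f θ hθ .s20)
      (cellMap_ext_theta D f θ hθ .p0) (cellMap_ext_gen D f θ hθ .s00)).2 h.assoc)
  | unit =>
    refine hom2_ext ((comp_eq_iff ?_ ((pathMap_extPre_path₂ D f _ _).trans
      (map_path₂_comp D .d1 .s0 f).symm) (pathMap_extPre_path₂ D f _ _) _ _
      (cellMap_ext_gen D f θ hθ .n1) (cellMap_ext_theta D f θ hθ .s0)
      (cellMap_ext_gen D f θ hθ .n0)).2 h.unit)
    exact (Bicategory.Strict.comp_id f).trans ((Bicategory.Strict.id_comp f).symm.trans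
      (congrArg (·.unop ≫ f) (D.map_id DObj.one).symm))
  | theta_inv hi =>
    have := hθ hi
    exact hom2_ext (conj_comp_conj (IsIso.hom_inv_id θ) _ _)
  | inv_theta hi =>
    have := hθ hi
    exact hom2_ext (conj_comp_conj (IsIso.inv_hom_id θ) _ _)

/-- The extension of `D` to `Δ̇` given by a codescent datum. -/
noncomputable def extension (hθ : i → IsIso θ) (h : IsCodescentDatum D f θ) :
    StrictPseudofunctor (DeltaDot i) Aᵒᵖ :=
  Presented.lift (extPre D f) (extCell D f θ hθ) (extCell_rel D f θ hθ h)

variable (hθ : i → IsIso θ) (h : IsCodescentDatum D f θ)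

theorem extension_map {a b : DeltaL} (p : a ⟶ b) :
    (extension D f θ hθ h).map ((deltaIncl i).map p) = D.map p :=
  (congrArg (pathMap (extPre D f)) (deltaIncl_map i p)).trans (pathMap_extPre D f p)

theorem extension_map₂_gen {a b : DObj} {p q : Quiver.Path a b} (x : DCell p q) :
    (extension D f θ hθ h).map₂ ((deltaIncl i).map₂ (a := a) (b := b) (f := p) (g := q)
      (cell x)) ≍ D.map₂ (a := a) (b := b) (f := p) (g := q) (cell x) := by
  have h' : (eqToHom (pathMap_extPre D f p) ≫ D.map₂ (a := a) (b := b) (f := p) (g := q) (cell x) ≫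
      eqToHom (pathMap_extPre D f q).symm) ≍
      D.map₂ (a := a) (b := b) (f := p) (g := q) (cell x) :=
    (eqToHom_comp_heq _ _).trans (comp_eqToHom_heq _ _)
  -- The inclusion is defined by cases on the generator, so it computes only at each constructor.
  cases x <;> exact h'

variable {a b c : DeltaL}

theorem extension_map₂_id (p : a ⟶ b) :
    (extension D f θ hθ h).map₂ ((deltaIncl i).map₂ (𝟙 p)) ≍ D.map₂ (𝟙 p) := by
  rw [PrelaxFunctor.map₂_id, PrelaxFunctor.map₂_id, PrelaxFunctor.map₂_id]
  exact heq_of_eq_id (extension_map D f θ hθ h p)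

theorem extension_map₂_comp {p q r : a ⟶ b} {x : p ⟶ q} {y : q ⟶ r}
    (hx : (extension D f θ hθ h).map₂ ((deltaIncl i).map₂ x) ≍ D.map₂ x)
    (hy : (extension D f θ hθ h).map₂ ((deltaIncl i).map₂ y) ≍ D.map₂ y) :
    (extension D f θ hθ h).map₂ ((deltaIncl i).map₂ (x ≫ y)) ≍ D.map₂ (x ≫ y) := by
  rw [PrelaxFunctor.map₂_comp, PrelaxFunctor.map₂_comp, PrelaxFunctor.map₂_comp]
  exact heq_comp (extension_map D f θ hθ h p) (extension_map D f θ hθ h q)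
    (extension_map D f θ hθ h r) hx hy

theorem extension_map₂_whiskerLeft (p : a ⟶ b) {q r : b ⟶ c} {x : q ⟶ r}
    (hx : (extension D f θ hθ h).map₂ ((deltaIncl i).map₂ x) ≍ D.map₂ x) :
    (extension D f θ hθ h).map₂ ((deltaIncl i).map₂ (p ◁ x)) ≍ D.map₂ (p ◁ x) := by
  refine (map₂_heq _ ((deltaIncl i).map_comp _ _) ((deltaIncl i).map_comp _ _)
    (map₂_whiskerLeft_heq (deltaIncl i) p x)).trans ?_
  refine (map₂_whiskerLeft_heq _ _ _).trans (HEq.trans ?_ (map₂_whiskerLeft_heq D p x).symm)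
  exact whiskerLeft_heq (extension_map D f θ hθ h p) (extension_map D f θ hθ h q)
    (extension_map D f θ hθ h r) hx

theorem extension_map₂_whiskerRight {p q : a ⟶ b} {x : p ⟶ q} (r : b ⟶ c)
    (hx : (extension D f θ hθ h).map₂ ((deltaIncl i).map₂ x) ≍ D.map₂ x) :
    (extension D f θ hθ h).map₂ ((deltaIncl i).map₂ (x ▷ r)) ≍ D.map₂ (x ▷ r) := by
  refine (map₂_heq _ ((deltaIncl i).map_comp _ _) ((deltaIncl i).map_comp _ _)
    (map₂_whiskerRight_heq (deltaIncl i) x r)).trans ?_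
  refine (map₂_whiskerRight_heq _ _ _).trans (HEq.trans ?_ (map₂_whiskerRight_heq D x r).symm)
  exact whiskerRight_heq (extension_map D f θ hθ h r) (extension_map D f θ hθ h p)
    (extension_map D f θ hθ h q) hx

/-- Restricting the extension along the inclusion gives back `D`, by induction on pastings: two
`2`-functors agreeing on generators agree. -/
theorem extension_map₂ {p q : a ⟶ b} (x : p ⟶ q) :
    (extension D f θ hθ h).map₂ ((deltaIncl i).map₂ x) ≍ D.map₂ x := by
  induction x using Quot.inductionOn with | _ x
  induction x with
  | gen x => exact extension_map₂_gen D f θ hθ h x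
  | ofEq e => subst e; exact extension_map₂_id D f θ hθ h _
  | vcomp x y ihx ihy => exact extension_map₂_comp D f θ hθ h ihx ihy
  | wl p x ih => exact extension_map₂_whiskerLeft D f θ hθ h p ih
  | wr x r ih => exact extension_map₂_whiskerRight D f θ hθ h r ih

/-- The object `𝟢` of `Δ̇`. -/
abbrev dotZero (i : Prop) : DeltaDot i := DotObj.zero

/-- The extension sends `𝟢` to `X` and restricts to `D`, so its action on the hom-categories out of
`𝟢` is a cocone. This lemma and the next two are the naturality conditions of that cocone. -/
theorem extension_map_comp (x : dotZero i ⟶ (deltaIncl i).obj b) (p : b ⟶ c) :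
    (extension D f θ hθ h).map (x ≫ (deltaIncl i).map p) =
      CategoryStruct.comp (Y := D.obj b) ((extension D f θ hθ h).map x) (D.map p) :=
  ((extension D f θ hθ h).map_comp x ((deltaIncl i).map p)).trans
    (congrArg ((extension D f θ hθ h).map x ≫ ·) (extension_map D f θ hθ h p))

theorem extension_map₂_wr {x y : dotZero i ⟶ (deltaIncl i).obj b} (k : x ⟶ y) (p : b ⟶ c) :
    ((extension D f θ hθ h).map₂ (k ▷ (deltaIncl i).map p)).unop2 ≍
      (D.map p).unop ◁ ((extension D f θ hθ h).map₂ k).unop2 :=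
  unop2_heq (η' := Bicategory.whiskerRight (b := D.obj b) ((extension D f θ hθ h).map₂ k) (D.map p))
    (extension_map_comp D f θ hθ h x p) (extension_map_comp D f θ hθ h y p)
    ((map₂_whiskerRight_heq _ k _).trans
      (whiskerRight_heq (extension_map D f θ hθ h p) rfl rfl .rfl))

theorem extension_map₂_wl (x : dotZero i ⟶ (deltaIncl i).obj b) {p q : b ⟶ c} (α : p ⟶ q) :
    ((extension D f θ hθ h).map₂ (x ◁ (deltaIncl i).map₂ α)).unop2 ≍
      (D.map₂ α).unop2 ▷ ((extension D f θ hθ h).map x).unop :=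
  unop2_heq (η' := Bicategory.whiskerLeft (b := D.obj b) ((extension D f θ hθ h).map x) (D.map₂ α))
    (extension_map_comp D f θ hθ h x p) (extension_map_comp D f θ hθ h x q)
    ((map₂_whiskerLeft_heq _ x _).trans
      (whiskerLeft_heq rfl (extension_map D f θ hθ h p) (extension_map D f θ hθ h q)
        (extension_map₂ D f θ hθ h α)))

/-- The cocone given by a codescent datum. -/
noncomputable def coconeOfDatum : WeightedCocone (descentWeight i) D X where
  app b :=
    { obj := fun p => ((extension D f θ hθ h).map (X := DotObj.zero) (Y := DotObj.of b) p).unop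
      map := fun {p q} x => ((extension D f θ hθ h).map₂ (a := DotObj.zero) (b := DotObj.of b)
        (f := p) (g := q) x).unop2
      map_id := fun p => congrArg (·.unop2) ((extension D f θ hθ h).map₂_id
        (a := DotObj.zero) (b := DotObj.of b) p)
      map_comp := fun {p q r} x y => congrArg (·.unop2) ((extension D f θ hθ h).map₂_comp
        (a := DotObj.zero) (b := DotObj.of b) (f := p) (g := q) (h := r) x y) }
  naturality_obj p x := congrArg Quiver.Hom.unop (extension_map_comp D f θ hθ h x p)
  naturality_map {_ _} p {x y} k :=
    (conj_eqToHom_iff_heq _ _ _ (congrArg Quiver.Hom.unop (extension_map_comp D f θ hθ h y p))).2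
      (extension_map₂_wr D f θ hθ h (x := x) (y := y) k p)
  naturality₂ {_ _ _ q} α x :=
    (conj_eqToHom_iff_heq _ _ _ (congrArg Quiver.Hom.unop (extension_map_comp D f θ hθ h x q))).2
      (extension_map₂_wl D f θ hθ h x α)

theorem coconeOfDatum_leg : (coconeOfDatum D f θ hθ h).leg = f :=
  Bicategory.Strict.comp_id f

theorem coconeOfDatum_legCell : (coconeOfDatum D f θ hθ h).legCell ≍ θ :=
  (coconeOfDatum D f θ hθ h).legCell_heq.symm.trans
    ((eqToHom_comp_heq _ _).trans (comp_eqToHom_heq _ _))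

end Extension

/-! ### Carrying equations across an isomorphism of categories -/

section Transfer

variable {C : Type u} [Category.{v} C] {D : Type u₁} [Category.{v₁} D] (F : C ⥤ D)

/-- A functor preserves the equation, and an isomorphism of categories also reflects it. The cell
`c₄` is an identity up to transport, as is the image of `σ₂₀`, so it disappears from the transported
equation. -/
theorem transfer_comp₄ (hF : IsIsoOfCats F)
    {a b b' z a' p p' q q' r r' z' : C} {c₁ : a ⟶ b} {c₂ : b' ⟶ z} {c₃ : a' ⟶ p} {c₄ : p' ⟶ q}
    {c₅ : q' ⟶ r} {c₆ : r' ⟶ z'} {e₁ : b = b'} {e₂ : a = a'} {e₃ : p = p'} {e₄ : q = q'}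
    {e₅ : r = r'} {e₆ : z' = z} (e : p' = q) (h₄ : c₄ = eqToHom e)
    {a₁ b₁ b₁' z₁ a₁' p₁ q₁' r₁ r₁' z₁' : D} {d₁ : a₁ ⟶ b₁} {d₂ : b₁' ⟶ z₁} {d₃ : a₁' ⟶ p₁}
    {d₅ : q₁' ⟶ r₁} {d₆ : r₁' ⟶ z₁'} {k₁ : b₁ = b₁'} {k₂ : a₁ = a₁'} {k₃ : p₁ = q₁'}
    {k₅ : r₁ = r₁'} {k₆ : z₁' = z₁} (ha : F.obj a = a₁) (hb : F.obj b = b₁) (hz : F.obj z = z₁)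
    (hp : F.obj p = p₁) (hr : F.obj r = r₁) (h₁ : F.map c₁ ≍ d₁)
    (h₂ : F.map c₂ ≍ d₂) (h₃ : F.map c₃ ≍ d₃) (h₅ : F.map c₅ ≍ d₅) (h₆ : F.map c₆ ≍ d₆) :
    c₁ ≫ eqToHom e₁ ≫ c₂ = eqToHom e₂ ≫ c₃ ≫ eqToHom e₃ ≫ c₄ ≫ eqToHom e₄ ≫ c₅ ≫
        eqToHom e₅ ≫ c₆ ≫ eqToHom e₆ ↔
      d₁ ≫ eqToHom k₁ ≫ d₂ = eqToHom k₂ ≫ d₃ ≫ eqToHom k₃ ≫ d₅ ≫ eqToHom k₅ ≫ d₆ ≫ eqToHom k₆ := by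
  subst ha hb hz hp hr k₁ k₂ k₃ k₅ k₆ e e₁ e₂ e₃ e₄ e₅ e₆ h₄
  cases h₁; cases h₂; cases h₃; cases h₅; cases h₆
  simp only [eqToHom_refl, Category.id_comp, Category.comp_id, ← F.map_comp]
  exact ⟨congrArg F.map, hF.map_injective⟩

theorem transfer_comp (hF : IsIsoOfCats F) {a b b' z z' : C} {c₁ : a ⟶ b} {c₂ : b' ⟶ z}
    {c₃ : a ⟶ z'} {e₁ : b = b'} {e₂ : z' = z} {a₀ a₁ b₁ b₁' z₁ a₁' z₁' : D} {d₁ : a₁ ⟶ b₁}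
    {d₂ : b₁' ⟶ z₁} {d₃ : a₁' ⟶ z₁'} {k₀ : a₀ = a₁} {k₁ : b₁ = b₁'} {k₂ : a₀ = a₁'} {k₃ : z₁' = z₁}
    (ha : F.obj a = a₁) (hb : F.obj b = b₁) (hz : F.obj z = z₁) (h₁ : F.map c₁ ≍ d₁)
    (h₂ : F.map c₂ ≍ d₂) (h₃ : F.map c₃ ≍ d₃) :
    c₁ ≫ eqToHom e₁ ≫ c₂ = c₃ ≫ eqToHom e₂ ↔
      eqToHom k₀ ≫ d₁ ≫ eqToHom k₁ ≫ d₂ = eqToHom k₂ ≫ d₃ ≫ eqToHom k₃ := by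
  subst ha hb hz k₁ k₀ k₂ k₃ e₁ e₂
  cases h₁; cases h₂; cases h₃
  simp only [eqToHom_refl, Category.id_comp, Category.comp_id, ← F.map_comp]
  exact ⟨congrArg F.map, hF.map_injective⟩

end Transfer

/-! ### Consequences of the strictness of `J` -/

section StrictMorphisms

variable {A : Type u₁} [Bicategory.{w₁, v₁} A] [Bicategory.Strict A]
  {B : Type u} [Bicategory.{w, v} B] [Bicategory.Strict B] {M : TwoMonad B}
  (Jt : StrictPseudofunctor A (LaxAlgS M))

/-- The underlying `2`-cell of `J η`. -/
abbrev jMap₂ {X Y : A} {f g : X ⟶ Y} (η : f ⟶ g) : jMap Jt f ⟶ jMap Jt g := (Jt.map₂ η).hom.hom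

/-- The axiom of a `T`-transformation, in which both structure cells are identities. -/
theorem jMap₂_act {X Y : A} {f g : X ⟶ Y} (η : f ⟶ g) :
    M.T.map₂ (jMap₂ Jt η) ▷ (jAlg Jt Y).act ≍ (jAlg Jt X).act ◁ jMap₂ Jt η := by
  obtain ⟨hf, hf'⟩ := (Jt.map f).mem
  obtain ⟨hg, hg'⟩ := (Jt.map g).mem
  have h := (Jt.map₂ η).hom.comm
  rw [hf', hg'] at h
  exact (comp_eqToHom_heq _ _).symm.trans ((heq_of_eq h).trans (eqToHom_comp_heq _ _))

/-- With an identity as structure cell, the multiplication axiom of a lax morphism says that the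
algebra cells correspond. This is what later replaces the cells of `JEY` by those of `JX`. -/
theorem jMap_mulCell {X Y : A} (f : X ⟶ Y) :
    M.T.map (M.T.map (jMap Jt f)) ◁ (jAlg Jt Y).mulCell ≍ (jAlg Jt X).mulCell ▷ jMap Jt f := by
  obtain ⟨hf, hf'⟩ := (Jt.map f).mem
  have h := (Jt.map f).hom.mul_cell
  rw [hf'] at h
  simp only [whiskerLeft_eqToHom, eqToHom_trans, PrelaxFunctor.map₂_eqToHom,
    eqToHom_whiskerRight, eqToHom_trans_assoc] at h
  exact (comp_eqToHom_heq _ _).symm.trans ((heq_of_eq h).trans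
    ((eqToHom_comp_heq _ _).trans (comp_eqToHom_heq _ _)))

theorem jMap_unitCell {X Y : A} (f : X ⟶ Y) :
    jMap Jt f ◁ (jAlg Jt Y).unitCell ≍ (jAlg Jt X).unitCell ▷ jMap Jt f := by
  obtain ⟨hf, hf'⟩ := (Jt.map f).mem
  have h := (Jt.map f).hom.unit_cell
  rw [hf'] at h
  simp only [whiskerLeft_eqToHom, eqToHom_trans] at h
  exact ((eqToHom_comp_heq _ _).trans (comp_eqToHom_heq _ _)).symm.trans ((heq_of_eq h).trans
    ((eqToHom_comp_heq _ _).trans (comp_eqToHom_heq _ _)))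

end StrictMorphisms

/-! ### Transposition along `E ⊣ R` -/

namespace TwoAdjunction

variable {A : Type u₁} [Bicategory.{w₁, v₁} A] [Bicategory.Strict A]
  {B : Type u} [Bicategory.{w, v} B] [Bicategory.Strict B] {M : TwoMonad B}
  {Jt : StrictPseudofunctor A (LaxAlgS M)} {E : StrictPseudofunctor B A}
  (adj : TwoAdjunction E ((Jt.comp (strictIncl M)).comp (forgetPs M)))

/-- Transposition along the adjunction. -/
abbrev transpose (Z : B) (X : A) : (E.obj Z ⟶ X) ⥤ (Z ⟶ (jAlg Jt X).carrier) :=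
  arrowFunctor ((Jt.comp (strictIncl M)).comp (forgetPs M)) (adj.unit Z) X

theorem isIsoOfCats_transpose (Z : B) (X : A) : IsIsoOfCats (adj.transpose Z X) :=
  adj.isUniversalArrow_unit Z X

theorem transpose_obj {Z : B} {X : A} (f : E.obj Z ⟶ X) :
    (adj.transpose Z X).obj f = adj.rho Z ≫ jMap Jt f := rfl

theorem transpose_comp {Z : B} {X Y : A} (f : E.obj Z ⟶ X) (g : X ⟶ Y) :
    (adj.transpose Z Y).obj (f ≫ g) = (adj.transpose Z X).obj f ≫ jMap Jt g :=
  arrowFunctor_obj_comp _ f g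

theorem transpose_map_comp {Z Z' : B} {X : A} (g : Z ⟶ Z') (f : E.obj Z' ⟶ X) :
    (adj.transpose Z X).obj (E.map g ≫ f) = g ≫ (adj.transpose Z' X).obj f := by
  rw [transpose_comp, transpose_obj, transpose_obj, ← rho_naturality, Bicategory.Strict.assoc]

/-- Explains the form of `b_Z`: it is the `1`-cell whose transpose is `a_{JEZ} T(ρ_Z)`. -/
theorem transpose_actRho (Z : B) : (adj.transpose (M.T.obj Z) (E.obj Z)).obj (adj.actRho Z) =
    M.T.map (adj.rho Z) ≫ (jAlg Jt (E.obj Z)).act := by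
  unfold actRho
  rw [transpose_map_comp, transpose_obj, eps_rho, Bicategory.Strict.comp_id]

/-- Because `J f` commutes strictly with the actions, precomposing with `b_Z` corresponds to
applying `T` and then the action of `JX`. Hence `d¹` produces the source of a lax structure cell. -/
theorem transpose_actRho_comp {Z : B} {X : A} (f : E.obj Z ⟶ X) :
    (adj.transpose (M.T.obj Z) X).obj (adj.actRho Z ≫ f) =
      M.T.map ((adj.transpose Z X).obj f) ≫ (jAlg Jt X).act := by
  rw [transpose_comp, transpose_actRho, Bicategory.Strict.assoc, ← jMap_act, transpose_obj,
    M.map_map_comp]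

theorem transpose_whiskerLeft_map {Z Z' : B} {X : A} (g : Z ⟶ Z') {f f' : E.obj Z' ⟶ X}
    (η : f ⟶ f') :
    (adj.transpose Z X).map (E.map g ◁ η) ≍ g ◁ (adj.transpose Z' X).map η :=
  (arrowFunctor_map_whiskerLeft _ _ η).trans
    ((whiskerLeft_heq (adj.rho_naturality g).symm rfl rfl .rfl).trans (comp_whiskerLeft_heq _ _ _))

/-- The `2`-dimensional form of `transpose_actRho_comp`, with `jMap₂_act` in place of `jMap_act`. -/
theorem transpose_whiskerLeft_actRho {Z : B} {X : A} {f f' : E.obj Z ⟶ X} (η : f ⟶ f') :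
    (adj.transpose (M.T.obj Z) X).map (adj.actRho Z ◁ η) ≍
      M.T.map₂ ((adj.transpose Z X).map η) ▷ (jAlg Jt X).act := by
  refine (arrowFunctor_map_whiskerLeft _ _ η).trans ?_
  refine (whiskerLeft_heq (adj.transpose_actRho Z) rfl rfl .rfl).trans ?_
  refine (comp_whiskerLeft_heq _ _ _).trans ?_
  refine (whiskerLeft_heq rfl (jMap_act Jt f).symm (jMap_act Jt f').symm
    (jMap₂_act Jt η).symm).trans ?_
  refine (whisker_assoc_heq _ _ _).symm.trans ?_
  exact whiskerRight_heq rfl (M.T.map_comp _ _).symm (M.T.map_comp _ _).symm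
    (map₂_whiskerLeft_heq M.T _ _).symm

theorem transpose_map₂_whiskerRight {Z Z' : B} {X : A} {g g' : Z ⟶ Z'} (β : g ⟶ g')
    (f : E.obj Z' ⟶ X) :
    (adj.transpose Z X).map (E.map₂ β ▷ f) ≍ β ▷ (adj.transpose Z' X).obj f := by
  refine (arrowFunctor_map_whiskerRight _ _ f).trans ?_
  have h := adj.unit_naturality₂ β
  refine (whiskerRight_heq rfl (adj.rho_naturality g).symm (adj.rho_naturality g').symm
    ?_).trans (whiskerRight_comp_heq β (adj.rho Z') (jMap Jt f)).symm
  exact ((heq_of_eq h).trans ((eqToHom_comp_heq _ _).trans (comp_eqToHom_heq _ _))).symm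

theorem transpose_eps_comp {X Y : A} (f : X ⟶ Y) :
    (adj.transpose _ Y).obj (adj.eps X ≫ f) = jMap Jt f := by
  rw [transpose_comp, transpose_obj, eps_rho, Bicategory.Strict.id_comp]

/-- Suited to the images of `σ₂₁` and `n₁`, which have the form `E(β)` whiskered with the counit;
the triangle identity cancels the counit. -/
theorem transpose_map₂_eps {Z : B} {X Y : A} {g g' : Z ⟶ (jAlg Jt X).carrier} (β : g ⟶ g')
    (f : X ⟶ Y) :
    (adj.transpose Z Y).map ((E.map₂ β ▷ adj.eps X) ▷ f) ≍ β ▷ jMap Jt f :=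
  (functor_map_heq _ (Bicategory.Strict.assoc _ _ _) (Bicategory.Strict.assoc _ _ _)
    (whiskerRight_comp_heq _ _ _).symm).trans
    ((adj.transpose_map₂_whiskerRight β _).trans
      (whiskerRight_heq (adj.transpose_eps_comp f) rfl rfl .rfl))

end TwoAdjunction

/-! ### Codescent data for `𝒜_y` as lax morphisms -/

namespace TwoAdjunction

variable {A : Type u₁} [Bicategory.{w₁, v₁} A] [Bicategory.Strict A]
  {B : Type u} [Bicategory.{w, v} B] [Bicategory.Strict B] {M : TwoMonad B}
  {Jt : StrictPseudofunctor A (LaxAlgS M)} {E : StrictPseudofunctor B A}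
  (adj : TwoAdjunction E ((Jt.comp (strictIncl M)).comp (forgetPs M)))
  {y : LaxAlg M} {X : A}

theorem diagram_map_arr (y : LaxAlg M) {a b : DObj} (e : DArr a b) :
    ((adj.diagram y).map (arr e)).unop = ((adj.diagramPre y).map e).unop :=
  Bicategory.Strict.comp_id _

variable {f : E.obj y.carrier ⟶ X}

theorem genCell_s20 (y : LaxAlg M) (f : E.obj y.carrier ⟶ X) :
    ∃ e, genCell (adj.diagram y) .s20 ▷ f = eqToHom e := by
  have h : genCell (adj.diagram y) .s20 = eqToHom ((adj.diagramPre_path₂ y DArr.d0 DArr.p2).trans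
      ((adj.actRho_naturality y.act).trans (adj.diagramPre_path₂ y DArr.d1 DArr.p0).symm)) := by
    refine (congrArg (eqToHom _ ≫ ·) (Category.id_comp _)).trans ?_
    exact eqToHom_trans _ _
  exact ⟨_, (congrArg (· ▷ f) h).trans (eqToHom_whiskerRight _ _)⟩

theorem transpose_s00 (f : E.obj y.carrier ⟶ X) :
    (adj.transpose _ X).map (genCell (adj.diagram y) .s00 ▷ f) ≍
      y.mulCell ▷ (adj.transpose _ X).obj f :=
  (functor_map_heq (adj.transpose _ X)
    (congrArg (· ≫ f) ((adj.diagramPre_path₂ y DArr.d0 DArr.p0).trans (E.map_comp _ _).symm))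
    (congrArg (· ≫ f) ((adj.diagramPre_path₂ y DArr.d0 DArr.p1).trans (E.map_comp _ _).symm))
    (whiskerRight_heq rfl
      ((adj.diagramPre_path₂ y DArr.d0 DArr.p0).trans (E.map_comp _ _).symm)
      ((adj.diagramPre_path₂ y DArr.d0 DArr.p1).trans (E.map_comp _ _).symm)
      ((eqToHom_comp_heq _ _).trans (comp_eqToHom_heq _ _)))).trans
    (adj.transpose_map₂_whiskerRight y.mulCell f)

theorem transpose_n0 (f : E.obj y.carrier ⟶ X) :
    (adj.transpose _ X).map (genCell (adj.diagram y) .n0 ▷ f) ≍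
      y.unitCell ▷ (adj.transpose _ X).obj f :=
  (functor_map_heq (adj.transpose _ X)
    (congrArg (· ≫ f) (E.map_id _).symm)
    (congrArg (· ≫ f) ((adj.diagramPre_path₂ y DArr.d0 DArr.s0).trans (E.map_comp _ _).symm))
    (whiskerRight_heq rfl (E.map_id _).symm
      ((adj.diagramPre_path₂ y DArr.d0 DArr.s0).trans (E.map_comp _ _).symm)
      ((eqToHom_comp_heq _ _).trans (comp_eqToHom_heq _ _)))).trans
    (adj.transpose_map₂_whiskerRight y.unitCell f)

/-- The image of `σ₂₁` is built from the multiplication cell of `JEY`; transposing leaves this cell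
whiskered with `J f`, and `jMap_mulCell` moves it to the multiplication cell of `JX`. -/
theorem transpose_s21 (f : E.obj y.carrier ⟶ X) :
    (adj.transpose _ X).map (genCell (adj.diagram y) .s21 ▷ f) ≍
      M.T.map (M.T.map ((adj.transpose _ X).obj f)) ◁ (jAlg Jt X).mulCell := by
  have h₁ := (adj.diagramPre_path₂ y DArr.d1 DArr.p2).trans (adj.actRho_actRho y.carrier)
  have h₂ := (adj.diagramPre_path₂ y DArr.d1 DArr.p1).trans (adj.mul_actRho y.carrier).symm
  refine (functor_map_heq (adj.transpose _ X) (congrArg (· ≫ f) h₁) (congrArg (· ≫ f) h₂)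
    (whiskerRight_heq rfl h₁ h₂ ((eqToHom_comp_heq _ _).trans (comp_eqToHom_heq _ _)))).trans ?_
  refine (adj.transpose_map₂_eps _ f).trans ?_
  refine (whisker_assoc_heq _ _ _).trans ?_
  refine (whiskerLeft_heq rfl ?_ ?_ (jMap_mulCell Jt f).symm).trans ?_
  · rw [Bicategory.Strict.assoc, ← jMap_act, ← M.map_map_comp, ← jMap_act, M.map_map_comp]
  · rw [Bicategory.Strict.assoc, ← jMap_act, M.mul_naturality_assoc]
  · refine (comp_whiskerLeft_heq _ _ _).symm.trans (whiskerLeft_heq ?_ rfl rfl .rfl)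
    rw [transpose_obj, M.T.map_comp, M.T.map_comp]

/-- As for `σ₂₁`, with the unit cells and `jMap_unitCell`. -/
theorem transpose_n1 (f : E.obj y.carrier ⟶ X) :
    (adj.transpose _ X).map (genCell (adj.diagram y) .n1 ▷ f) ≍
      (adj.transpose _ X).obj f ◁ (jAlg Jt X).unitCell := by
  have h₁ := (adj.rho_eps y.carrier).symm.trans
    (congrArg (E.map · ≫ adj.eps _) (Bicategory.Strict.comp_id (adj.rho y.carrier)).symm)
  have h₂ := (adj.diagramPre_path₂ y DArr.d1 DArr.s0).trans (adj.unit_actRho y.carrier).symm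
  refine (functor_map_heq (adj.transpose _ X) (congrArg (· ≫ f) h₁) (congrArg (· ≫ f) h₂)
    (whiskerRight_heq rfl h₁ h₂ ((eqToHom_comp_heq _ _).trans (comp_eqToHom_heq _ _)))).trans ?_
  refine (adj.transpose_map₂_eps _ f).trans ?_
  refine (whisker_assoc_heq _ _ _).trans ?_
  refine (whiskerLeft_heq rfl ?_ ?_ (jMap_unitCell Jt f).symm).trans ?_
  · rw [Bicategory.Strict.id_comp, Bicategory.Strict.comp_id]
  · rw [Bicategory.Strict.assoc, ← jMap_act, M.unit_naturality_assoc]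
  · exact (comp_whiskerLeft_heq _ _ _).symm

variable (θ : ((adj.diagram y).map (arr .d1)).unop ≫ f ⟶ ((adj.diagram y).map (arr .d0)).unop ≫ f)

theorem transpose_d1 (y : LaxAlg M) (f : E.obj y.carrier ⟶ X) :
    (adj.transpose _ X).obj (((adj.diagram y).map (arr .d1)).unop ≫ f) =
      M.T.map ((adj.transpose _ X).obj f) ≫ (jAlg Jt X).act :=
  (congrArg (fun g => (adj.transpose _ X).obj (g ≫ f)) (adj.diagram_map_arr y .d1)).trans
    (adj.transpose_actRho_comp f)

theorem transpose_d0 (y : LaxAlg M) (f : E.obj y.carrier ⟶ X) :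
    (adj.transpose _ X).obj (((adj.diagram y).map (arr .d0)).unop ≫ f) =
      y.act ≫ (adj.transpose _ X).obj f :=
  (congrArg (fun g => (adj.transpose _ X).obj (g ≫ f)) (adj.diagram_map_arr y .d0)).trans
    (adj.transpose_map_comp y.act f)

/-- The transpose of a `2`-cell `d¹ f ⇒ d⁰ f`. -/
def transposeCell : M.T.map ((adj.transpose _ X).obj f) ≫ (jAlg Jt X).act ⟶
    y.act ≫ (adj.transpose _ X).obj f :=
  eqToHom (adj.transpose_d1 y f).symm ≫ (adj.transpose _ X).map θ ≫ eqToHom (adj.transpose_d0 y f)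

theorem transposeCell_heq : (adj.transpose _ X).map θ ≍ adj.transposeCell θ :=
  ((eqToHom_comp_heq _ _).trans (comp_eqToHom_heq _ _)).symm

/-- Transposition is an isomorphism of categories, so each codescent equation is equivalent to its
transpose. Term by term, `σ₂₁` and `n₁` yield the structure cells of `JX`, `σ₀₀` and `n₀` those of
`y`, `∂²` yields `T` of the transposed cell, and `σ₂₀` vanishes. -/
theorem isCodescentDatum_iff : IsCodescentDatum (adj.diagram y) f θ ↔
    M.T.map (M.T.map ((adj.transpose _ X).obj f)) ◁ (jAlg Jt X).mulCell ≫
        eqToHom (M.mul_naturality_assoc _ _) ≫ M.mul y.carrier ◁ adj.transposeCell θ =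
      eqToHom (M.map_map_comp _ _ _).symm ≫ M.T.map₂ (adj.transposeCell θ) ▷ (jAlg Jt X).act ≫
        eqToHom (M.map_map_comp _ _ _) ≫ M.T.map y.act ◁ adj.transposeCell θ ≫
          eqToHom (Bicategory.Strict.assoc _ _ _).symm ≫ y.mulCell ▷ (adj.transpose _ X).obj f ≫
            eqToHom (Bicategory.Strict.assoc _ _ _) ∧
    eqToHom (Bicategory.Strict.comp_id _).symm ≫
        (adj.transpose _ X).obj f ◁ (jAlg Jt X).unitCell ≫
        eqToHom (M.unit_naturality_assoc _ _) ≫ M.unit y.carrier ◁ adj.transposeCell θ =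
      eqToHom (Bicategory.Strict.id_comp _).symm ≫ y.unitCell ▷ (adj.transpose _ X).obj f ≫
        eqToHom (Bicategory.Strict.assoc _ _ _) := by
  have h₁ := adj.transposeCell_heq θ
  -- Covers `∂⁰`, `∂¹` and `s⁰` at once: all three are sent to `1`-cells in the image of `E`.
  have hE : ∀ {Z : B} (g : Z ⟶ M.T.obj y.carrier) {g' : E.obj Z ⟶ E.obj (M.T.obj y.carrier)}
      (hg : g' = E.map g), (adj.transpose Z X).map (g' ◁ θ) ≍ g ◁ adj.transposeCell θ :=
    fun g g' hg => by
      subst hg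
      exact (adj.transpose_whiskerLeft_map g θ).trans
        (whiskerLeft_heq rfl (adj.transpose_d1 y f) (adj.transpose_d0 y f) h₁)
  -- `∂²` is not in the image of `E` but is `b` at `T Y`, and this is how the term with `T` applied
  -- to the structure cell arises.
  have h₃ : (adj.transpose _ X).map (((adj.diagram y).map (arr .p2)).unop ◁ θ) ≍
      M.T.map₂ (adj.transposeCell θ) ▷ (jAlg Jt X).act := by
    refine (functor_map_heq _ ?_ ?_ (whiskerLeft_heq (adj.diagram_map_arr y .p2)
      rfl rfl .rfl)).trans ((adj.transpose_whiskerLeft_actRho θ).trans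
      (whiskerRight_heq rfl ?_ ?_ (map₂_heq M.T (adj.transpose_d1 y f) (adj.transpose_d0 y f) h₁)))
    · exact congrArg (· ≫ _) (adj.diagram_map_arr y .p2)
    · exact congrArg (· ≫ _) (adj.diagram_map_arr y .p2)
    · exact congrArg _ (adj.transpose_d1 y f)
    · exact congrArg _ (adj.transpose_d0 y f)
  obtain ⟨e, he⟩ := adj.genCell_s20 y f
  have hd : ∀ {Z : B} (g : Z ⟶ M.T.obj y.carrier) {g' : E.obj Z ⟶ E.obj (M.T.obj y.carrier)}
      (hg : g' = E.map g) (k : E.obj (M.T.obj y.carrier) ⟶ X),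
      (adj.transpose Z X).obj (g' ≫ k) = g ≫ (adj.transpose _ X).obj k :=
    fun g g' hg k => by subst hg; exact adj.transpose_map_comp g k
  have hp : ∀ k : E.obj (M.T.obj y.carrier) ⟶ X,
      (adj.transpose _ X).obj (((adj.diagram y).map (arr .p2)).unop ≫ k) =
        M.T.map ((adj.transpose _ X).obj k) ≫ (jAlg Jt X).act :=
    fun k => (congrArg (fun g => (adj.transpose _ X).obj (g ≫ k))
      (adj.diagram_map_arr y .p2)).trans (adj.transpose_actRho_comp k)
  have hact := fun k : y.carrier ⟶ (jAlg Jt X).carrier =>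
    M.map_map_comp (M.T.map k) (jAlg Jt X).act (jAlg Jt X).act
  have assoc_iff := transfer_comp₄ (adj.transpose _ X) (adj.isIsoOfCats_transpose _ _) e he
    (e₁ := map_path₂_comp (adj.diagram y) .d1 .p1 f) (e₂ := map_path₂_comp (adj.diagram y) .d1 .p2 f)
    (e₃ := (map_path₂_comp (adj.diagram y) .d0 .p2 f).symm)
    (e₄ := map_path₂_comp (adj.diagram y) .d1 .p0 f)
    (e₅ := (map_path₂_comp (adj.diagram y) .d0 .p0 f).symm)
    (e₆ := map_path₂_comp (adj.diagram y) .d0 .p1 f)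
    (k₁ := M.mul_naturality_assoc _ _) (k₂ := (M.map_map_comp _ _ _).symm)
    (k₃ := M.map_map_comp _ _ _) (k₅ := (Bicategory.Strict.assoc _ _ _).symm)
    (k₆ := Bicategory.Strict.assoc _ _ _)
    ((congrArg _ (map_path₂_comp (adj.diagram y) .d1 .p2 f)).trans
      ((hp _).trans ((congrArg (M.T.map · ≫ _) (adj.transpose_d1 y f)).trans (hact _))))
    ((congrArg _ (map_path₂_comp (adj.diagram y) .d1 .p1 f)).trans
      ((hd (M.mul _) (adj.diagram_map_arr y .p1) _).trans
        ((congrArg (M.mul _ ≫ ·) (adj.transpose_d1 y f)).trans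
          (M.mul_naturality_assoc _ _).symm)))
    ((hd (M.mul _) (adj.diagram_map_arr y .p1) _).trans
      (congrArg (M.mul _ ≫ ·) (adj.transpose_d0 y f)))
    ((hp _).trans (congrArg (M.T.map · ≫ _) (adj.transpose_d0 y f)))
    ((hd (M.T.map y.act) (adj.diagram_map_arr y .p0) _).trans
      (congrArg (M.T.map y.act ≫ ·) (adj.transpose_d0 y f)))
    (adj.transpose_s21 f) (hE (M.mul _) (adj.diagram_map_arr y .p1)) h₃
    (hE (M.T.map y.act) (adj.diagram_map_arr y .p0)) (adj.transpose_s00 f)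
  have unit_iff := transfer_comp (adj.transpose _ X) (adj.isIsoOfCats_transpose _ _)
    (e₁ := map_path₂_comp (adj.diagram y) .d1 .s0 f)
    (e₂ := map_path₂_comp (adj.diagram y) .d0 .s0 f)
    (k₀ := (Bicategory.Strict.comp_id _).symm) (k₁ := M.unit_naturality_assoc _ _)
    (k₂ := (Bicategory.Strict.id_comp _).symm) (k₃ := Bicategory.Strict.assoc _ _ _)
    ((congrArg (adj.transpose _ X).obj (Bicategory.Strict.id_comp f)).trans
      (Bicategory.Strict.comp_id _).symm)
    ((congrArg _ (map_path₂_comp (adj.diagram y) .d1 .s0 f)).trans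
      ((hd (M.unit _) (adj.diagram_map_arr y .s0) _).trans
        ((congrArg (M.unit _ ≫ ·) (adj.transpose_d1 y f)).trans
          (M.unit_naturality_assoc _ _).symm)))
    ((hd (M.unit _) (adj.diagram_map_arr y .s0) _).trans
      (congrArg (M.unit _ ≫ ·) (adj.transpose_d0 y f)))
    (adj.transpose_n1 f) (hE (M.unit _) (adj.diagram_map_arr y .s0)) (adj.transpose_n0 f)
  exact ⟨fun h => ⟨assoc_iff.1 h.assoc, unit_iff.1 h.unit⟩,
    fun h => ⟨assoc_iff.2 h.1, unit_iff.2 h.2⟩⟩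

end TwoAdjunction

theorem isIso_iff_of_heq {C : Type u} [Category.{v} C] {a b a' b' : C} {f : a ⟶ b} {f' : a' ⟶ b'}
    (ha : a = a') (hb : b = b') (h : f ≍ f') : IsIso f ↔ IsIso f' := by
  subst ha hb; cases h; rfl

theorem IsIsoOfCats.isIso_iff {C : Type u} [Category.{v} C] {D : Type u₁} [Category.{v₁} D]
    {F : C ⥤ D} (hF : IsIsoOfCats F) {a b : C} (f : a ⟶ b) : IsIso f ↔ IsIso (F.map f) := by
  refine ⟨fun _ => inferInstance, fun _ => ?_⟩
  obtain ⟨g, hg⟩ := hF.map_surjective (inv (F.map f))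
  exact ⟨g, hF.map_injective (by simp [hg]), hF.map_injective (by simp [hg])⟩

/-! ### Cocones and modifications in terms of legs -/

section Legs

variable {A : Type u₁} [Bicategory.{w₁, v₁} A] [Bicategory.Strict A]

namespace WeightedCocone

variable {i : Prop} {D : StrictPseudofunctor DeltaL Aᵒᵖ} {X : A}
  {φ ψ : WeightedCocone (descentWeight i) D X}

/-- The component at `d` of a modification. -/
abbrev legHom (Γ : φ ⟶ ψ) : φ.leg ⟶ ψ.leg := (Γ.app DObj.one).app pathD

/-- Naturality at `ϑ` of the component at `𝟤`, whose values at `d⁰d` and `d¹d` the modification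
axiom expresses through the value at `d`. -/
theorem legHom_comm (Γ : φ ⟶ ψ) :
    φ.legCell ≫ (D.map (arr .d0)).unop ◁ legHom Γ =
      (D.map (arr .d1)).unop ◁ legHom Γ ≫ ψ.legCell := by
  have h := (Γ.app DObj.two).naturality (theta i)
  have hΓ : ∀ e : DArr .one .two, (Γ.app DObj.two).app (path₂ DotArr.d (DotArr.of e)) ≍
      (D.map (arr e)).unop ◁ legHom Γ := fun e =>
    (heq_of_eq (Γ.comm (s := DObj.one) (t := DObj.two) (arr e) pathD)).trans
      ((eqToHom_comp_heq _ _).trans (comp_eqToHom_heq _ _))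
  refine eq_of_heq ((heq_comp (φ.onPath_comp (b := DObj.one) pathD (arr .d1)).symm
    (φ.onPath_comp (b := DObj.one) pathD (arr .d0)).symm
    (ψ.onPath_comp (b := DObj.one) pathD (arr .d0)).symm φ.legCell_heq.symm
    (hΓ .d0).symm).trans ((heq_of_eq h).trans ?_))
  exact heq_comp (φ.onPath_comp (b := DObj.one) pathD (arr .d1))
    (ψ.onPath_comp (b := DObj.one) pathD (arr .d1))
    (ψ.onPath_comp (b := DObj.one) pathD (arr .d0)) (hΓ .d1) ψ.legCell_heq

theorem exists_hom_of_comm (η : φ.leg ⟶ ψ.leg)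
    (hη : φ.legCell ≫ (D.map (arr .d0)).unop ◁ η = (D.map (arr .d1)).unop ◁ η ≫ ψ.legCell) :
    ∃ Γ : φ ⟶ ψ, legHom Γ = η := by
  refine exists_hom η (eq_of_heq ?_)
  refine HEq.trans ?_ ((heq_of_eq hη).trans (eqToHom_comp_heq _ _).symm)
  exact heq_comp (φ.onPath_comp (b := DObj.one) pathD (arr .d1))
    (φ.onPath_comp (b := DObj.one) pathD (arr .d0)) rfl φ.legCell_heq (eqToHom_comp_heq _ _)

theorem ext_of_legCell (h : φ.leg = ψ.leg) (hθ : φ.legCell ≍ ψ.legCell) : φ = ψ :=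
  ext_of_theta h (φ.legCell_heq.trans (hθ.trans ψ.legCell_heq.symm))

theorem isIso_legCell (φ : WeightedCocone (descentWeight i) D X) (hi : i) : IsIso φ.legCell := by
  have : IsIso (φ.onCell (b := DObj.two) (theta i)) := by
    refine ⟨φ.onCell (b := DObj.two) (Presented.mk₂ (.gen (.thetaInv hi))), ?_, ?_⟩
    · refine (φ.onCell_comp (b := DObj.two) _ _).symm.trans (Eq.trans ?_ (φ.onCell_id _))
      exact congrArg φ.onCell (Quot.sound (.rel (.theta_inv hi)))
    · refine (φ.onCell_comp (b := DObj.two) _ _).symm.trans (Eq.trans ?_ (φ.onCell_id _))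
      exact congrArg φ.onCell (Quot.sound (.rel (.inv_theta hi)))
  exact (isIso_iff_of_heq (φ.onPath_comp (b := DObj.one) pathD (arr .d1))
    (φ.onPath_comp (b := DObj.one) pathD (arr .d0)) φ.legCell_heq).1 this

theorem post_legCell_heq (φ : WeightedCocone (descentWeight i) D X) {Y : A} (k : X ⟶ Y) :
    (φ.post k).legCell ≍ φ.legCell ▷ k :=
  (φ.post k).legCell_heq.symm.trans (whiskerRight_heq rfl
    (φ.onPath_comp (b := DObj.one) pathD (arr .d1))
    (φ.onPath_comp (b := DObj.one) pathD (arr .d0)) φ.legCell_heq)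

end WeightedCocone

end Legs

/-! ### Equality of lax morphisms and composition with strict ones -/

namespace LaxAlg

variable {B : Type u} [Bicategory.{w, v} B] [Bicategory.Strict B] {M : TwoMonad B}

theorem Mor.ext_heq {y z : LaxAlg M} {f g : y ⟶ z} (h : f.hom = g.hom) (e : f.cell ≍ g.cell) :
    f = g := by
  obtain ⟨f, c, _, _⟩ := f
  obtain ⟨g, c', _, _⟩ := g
  obtain rfl : f = g := h
  cases e
  rfl

theorem Mor₂.heq_of_hom {y z : LaxAlg M} {f g f' g' : y ⟶ z} (hf : f = f') (hg : g = g')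
    {η : f ⟶ g} {η' : f' ⟶ g'} (e : η.hom ≍ η'.hom) : η ≍ η' := by
  subst hf hg
  exact heq_of_eq (Mor₂.ext (eq_of_heq e))

/-- The factor contributed by `g` to the composite structure cell is a whiskered identity. -/
theorem comp_cell_heq_of_strict {x y z : LaxAlg M} (f : x ⟶ y) (g : y ⟶ z)
    (hg : (strictMor M).mem g) : (f ≫ g).cell ≍ f.cell ▷ g.hom := by
  obtain ⟨h, hg⟩ := hg
  change eqToHom _ ≫ M.T.map f.hom ◁ g.cell ≫ eqToHom _ ≫ f.cell ▷ g.hom ≫ eqToHom _ ≍ _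
  rw [hg, whiskerLeft_eqToHom]
  exact (eqToHom_comp_heq _ _).trans ((eqToHom_comp_heq _ _).trans
    ((eqToHom_comp_heq _ _).trans (comp_eqToHom_heq _ _)))

end LaxAlg

theorem LocallyFull.Mor₂.heq_of_hom {B : Type u} [Bicategory.{w, v} B] {P : OneCells B}
    {y z : LocallyFull P} {f g f' g' : y ⟶ z} (hf : f = f') (hg : g = g')
    {η : f ⟶ g} {η' : f' ⟶ g'} (e : η.hom ≍ η'.hom) : η ≍ η' := by
  subst hf hg
  exact heq_of_eq (Mor₂.ext (eq_of_heq e))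

/-! ### Universal cocones and universal arrows -/

namespace TwoAdjunction

variable {A : Type u₁} [Bicategory.{w₁, v₁} A] [Bicategory.Strict A]
  {B : Type u} [Bicategory.{w, v} B] [Bicategory.Strict B] {M : TwoMonad B}
  {Jt : StrictPseudofunctor A (LaxAlgS M)} {E : StrictPseudofunctor B A}
  (adj : TwoAdjunction E ((Jt.comp (strictIncl M)).comp (forgetPs M)))
  {y : LaxAlg M} {X : A}

/-- Transposes the square characterising modifications into the axiom of a `T`-transformation:
whiskering with `d⁰` becomes whiskering with the action of `y`, and whiskering with `d¹` becomes `T`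
followed by the action of `JX`. -/
theorem transposeCell_comm_iff {f g : E.obj y.carrier ⟶ X}
    (θ : ((adj.diagram y).map (arr .d1)).unop ≫ f ⟶ ((adj.diagram y).map (arr .d0)).unop ≫ f)
    (κ : ((adj.diagram y).map (arr .d1)).unop ≫ g ⟶ ((adj.diagram y).map (arr .d0)).unop ≫ g)
    (η : f ⟶ g) :
    θ ≫ ((adj.diagram y).map (arr .d0)).unop ◁ η =
        ((adj.diagram y).map (arr .d1)).unop ◁ η ≫ κ ↔
      M.T.map₂ ((adj.transpose _ X).map η) ▷ (jAlg Jt X).act ≫ adj.transposeCell κ =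
        adj.transposeCell θ ≫ y.act ◁ (adj.transpose _ X).map η := by
  have h₀ : (adj.transpose _ X).map (((adj.diagram y).map (arr .d0)).unop ◁ η) ≍
      y.act ◁ (adj.transpose _ X).map η :=
    (functor_map_heq _ (congrArg (· ≫ f) (adj.diagram_map_arr y .d0))
      (congrArg (· ≫ g) (adj.diagram_map_arr y .d0))
      (whiskerLeft_heq (adj.diagram_map_arr y .d0) rfl rfl .rfl)).trans
      (adj.transpose_whiskerLeft_map y.act η)
  have h₁ : (adj.transpose _ X).map (((adj.diagram y).map (arr .d1)).unop ◁ η) ≍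
      M.T.map₂ ((adj.transpose _ X).map η) ▷ (jAlg Jt X).act :=
    (functor_map_heq _ (congrArg (· ≫ f) (adj.diagram_map_arr y .d1))
      (congrArg (· ≫ g) (adj.diagram_map_arr y .d1))
      (whiskerLeft_heq (adj.diagram_map_arr y .d1) rfl rfl .rfl)).trans
      (adj.transpose_whiskerLeft_actRho η)
  have e₁ := heq_comp (adj.transpose_d1 y f) (adj.transpose_d0 y f) (adj.transpose_d0 y g)
    (adj.transposeCell_heq θ) h₀
  have e₂ := heq_comp (adj.transpose_d1 y f) (adj.transpose_d1 y g) (adj.transpose_d0 y g)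
    h₁ (adj.transposeCell_heq κ)
  replace e₁ := (heq_of_eq ((adj.transpose _ X).map_comp θ _)).trans e₁
  replace e₂ := (heq_of_eq ((adj.transpose _ X).map_comp _ κ)).trans e₂
  refine ⟨fun h => ?_, fun h => (adj.isIsoOfCats_transpose _ X).map_injective ?_⟩
  · exact eq_of_heq (e₂.symm.trans
      ((heq_of_eq (congrArg (adj.transpose _ X).map h.symm)).trans e₁))
  · exact eq_of_heq (e₁.trans ((heq_of_eq h.symm).trans e₂.symm))

variable {i : Prop}

/-- The lax morphism `y ⟶ J X` corresponding to a cocone under `𝒜_y` with vertex `X`. -/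
def morOfCocone (φ : WeightedCocone (descentWeight i) (adj.diagram y) X) : y ⟶ jAlg Jt X :=
  LaxAlg.Mor.mk ((adj.transpose _ X).obj φ.leg) (adj.transposeCell φ.legCell)
    ((adj.isCodescentDatum_iff _).1 φ.isCodescentDatum).1
    ((adj.isCodescentDatum_iff _).1 φ.isCodescentDatum).2

/-- A cocone is determined by its leg and leg cell, and transposition is injective on both. -/
theorem morOfCocone_injective : Function.Injective
    (adj.morOfCocone : WeightedCocone (descentWeight i) (adj.diagram y) X → _) := by
  intro φ ψ h
  have hleg : φ.leg = ψ.leg := (adj.isIsoOfCats_transpose _ X).bijective.1 (congrArg (·.hom) h)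
  refine WeightedCocone.ext_of_legCell hleg ?_
  refine (adj.isIsoOfCats_transpose _ X).map_heq_injective (congrArg (_ ≫ ·) hleg)
    (congrArg (_ ≫ ·) hleg) ?_
  refine (adj.transposeCell_heq _).trans (HEq.trans ?_ (adj.transposeCell_heq _).symm)
  exact congr_arg_heq (fun f : y ⟶ jAlg Jt X => f.cell) h

theorem isIso_transposeCell_iff {f : E.obj y.carrier ⟶ X}
    (θ : ((adj.diagram y).map (arr .d1)).unop ≫ f ⟶ ((adj.diagram y).map (arr .d0)).unop ≫ f) :
    IsIso (adj.transposeCell θ) ↔ IsIso θ :=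
  (isIso_iff_of_heq (adj.transpose_d1 y f) (adj.transpose_d0 y f)
    (adj.transposeCell_heq θ)).symm.trans ((adj.isIsoOfCats_transpose _ X).isIso_iff θ).symm

/-- Both components of `u` are transposed back to a codescent datum, which extends to a cocone.
Invertibility of the structure cell is used only when `ϑ` has been made invertible. -/
theorem exists_morOfCocone (u : y ⟶ jAlg Jt X) (hu : i → IsIso u.cell) :
    ∃ φ : WeightedCocone (descentWeight i) (adj.diagram y) X, adj.morOfCocone φ = u := by
  obtain ⟨u, c, hc, hc'⟩ := u
  obtain ⟨f, rfl⟩ := (adj.isIsoOfCats_transpose _ X).bijective.2 u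
  obtain ⟨θ, hθ⟩ := (adj.isIsoOfCats_transpose _ X).map_surjective
    (a := ((adj.diagram y).map (arr .d1)).unop ≫ f) (b := ((adj.diagram y).map (arr .d0)).unop ≫ f)
    (eqToHom (adj.transpose_d1 y f) ≫ c ≫ eqToHom (adj.transpose_d0 y f).symm)
  -- The cell `θ` was chosen with its transpose equal to `c` up to the same conjugation as in
  -- `transposeCell`.
  obtain rfl : adj.transposeCell θ = c :=
    eq_of_heq ((adj.transposeCell_heq θ).symm.trans
      ((heq_of_eq hθ).trans ((eqToHom_comp_heq _ _).trans (comp_eqToHom_heq _ _))))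
  have h : IsCodescentDatum (adj.diagram y) f θ := (adj.isCodescentDatum_iff θ).2 ⟨hc, hc'⟩
  refine ⟨coconeOfDatum (adj.diagram y) f θ
    (fun hi => (adj.isIso_transposeCell_iff θ).1 (hu hi)) h, ?_⟩
  refine LaxAlg.Mor.ext_heq (congrArg (adj.transpose _ X).obj (coconeOfDatum_leg _ _ _ _ _)) ?_
  refine (adj.transposeCell_heq _).symm.trans (HEq.trans ?_ (adj.transposeCell_heq θ))
  exact functor_map_heq _ (congrArg (_ ≫ ·) (coconeOfDatum_leg _ _ _ _ _))
    (congrArg (_ ≫ ·) (coconeOfDatum_leg _ _ _ _ _)) (coconeOfDatum_legCell _ _ _ _ _)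

/-- Cocones under `𝒜_y` with vertex `X` as lax morphisms `y ⟶ J X`. -/
def coconeFunctor (i : Prop) (y : LaxAlg M) (X : A) :
    WeightedCocone (descentWeight i) (adj.diagram y) X ⥤ (y ⟶ jAlg Jt X) where
  obj φ := adj.morOfCocone φ
  map {φ ψ} Γ := LaxAlg.Mor₂.mk (f := adj.morOfCocone φ) (h := adj.morOfCocone ψ)
    ((adj.transpose _ X).map (WeightedCocone.legHom Γ))
    ((adj.transposeCell_comm_iff _ _ _).1 (WeightedCocone.legHom_comm Γ))
  map_id φ := LaxAlg.Mor₂.ext ((adj.transpose _ X).map_id φ.leg)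
  map_comp Γ Θ := LaxAlg.Mor₂.ext
    ((adj.transpose _ X).map_comp (WeightedCocone.legHom Γ) (WeightedCocone.legHom Θ))

theorem coconeFunctor_map_bijective (φ ψ : WeightedCocone (descentWeight i) (adj.diagram y) X) :
    Function.Bijective (fun Γ : φ ⟶ ψ => (adj.coconeFunctor i y X).map Γ) := by
  constructor
  · intro Γ Θ h
    exact WeightedCocone.hom_ext_of_pathD
      ((adj.isIsoOfCats_transpose _ X).map_injective (congrArg (·.hom) h))
  · rintro ⟨η, hη⟩
    obtain ⟨η, rfl⟩ := (adj.isIsoOfCats_transpose _ X).map_surjective η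
    obtain ⟨Γ, rfl⟩ := WeightedCocone.exists_hom_of_comm η ((adj.transposeCell_comm_iff _ _ _).2 hη)
    exact ⟨Γ, rfl⟩

theorem isIsoOfCats_coconeFunctor (y : LaxAlg M) (X : A) :
    IsIsoOfCats (adj.coconeFunctor False y X) :=
  .of_bijective ⟨adj.morOfCocone_injective, fun u => adj.exists_morOfCocone u False.elim⟩
    adj.coconeFunctor_map_bijective

/-- Postcomposing whiskers the leg cell by `k`. The composite with a general lax morphism would
carry a further structure cell, but that of `J k` is an identity. -/
theorem morOfCocone_post (φ : WeightedCocone (descentWeight i) (adj.diagram y) X) {Y : A}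
    (k : X ⟶ Y) : adj.morOfCocone (φ.post k) = adj.morOfCocone φ ≫ (Jt.map k).hom := by
  refine LaxAlg.Mor.ext_heq (adj.transpose_comp φ.leg k) ?_
  refine HEq.trans ?_ (LaxAlg.comp_cell_heq_of_strict _ _ (Jt.map k).mem).symm
  refine (adj.transposeCell_heq _).symm.trans ?_
  refine (functor_map_heq (adj.transpose _ Y) (Bicategory.Strict.assoc _ _ _).symm
    (Bicategory.Strict.assoc _ _ _).symm (φ.post_legCell_heq k)).trans ?_
  refine (arrowFunctor_map_whiskerRight _ _ k).trans ?_
  exact whiskerRight_heq rfl (adj.transpose_d1 y φ.leg) (adj.transpose_d0 y φ.leg)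
    (adj.transposeCell_heq _)

theorem postFunctor_coconeFunctor_map_heq (φ : WeightedCocone (descentWeight i) (adj.diagram y) X)
    {Y : A} {k l : X ⟶ Y} (η : k ⟶ l) :
    (adj.coconeFunctor i y Y).map ((φ.postFunctor Y).map η) ≍
      adj.morOfCocone φ ◁ (Jt.map₂ η).hom :=
  LaxAlg.Mor₂.heq_of_hom (adj.morOfCocone_post φ k) (adj.morOfCocone_post φ l)
    (arrowFunctor_map_whiskerLeft _ φ.leg η)

/-- For each vertex the functor induced by the cocone, followed by the isomorphism from cocones to
lax morphisms, is the functor induced by the corresponding `1`-cell; so one is an isomorphism of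
categories exactly when the other is. -/
theorem isUniversal_iff (φ : WeightedCocone (descentWeight False) (adj.diagram y) X) :
    φ.IsUniversal ↔
      IsUniversalArrow ((Jt.comp (strictIncl M)).comp (ell M)) (adj.morOfCocone φ) := by
  have h : ∀ Y, φ.postFunctor Y ⋙ adj.coconeFunctor False y Y =
      arrowFunctor ((Jt.comp (strictIncl M)).comp (ell M)) (adj.morOfCocone φ) Y := fun Y =>
    CategoryTheory.Functor.hext (adj.morOfCocone_post φ) fun _ _ η =>
      adj.postFunctor_coconeFunctor_map_heq φ η
  refine forall_congr' fun Y => ?_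
  rw [← h Y]
  exact ⟨fun h => IsIsoOfCats.comp h (adj.isIsoOfCats_coconeFunctor y Y),
    fun h => IsIsoOfCats.of_comp h (adj.isIsoOfCats_coconeFunctor y Y)⟩

theorem isStrictLaxCodescentObject_iff (y : LaxAlg M) (c : A) :
    IsStrictLaxCodescentObject (adj.diagram y) c ↔
      ∃ u : y ⟶ jAlg Jt c, IsUniversalArrow ((Jt.comp (strictIncl M)).comp (ell M)) u := by
  constructor
  · rintro ⟨φ, hφ⟩
    exact ⟨adj.morOfCocone φ, (adj.isUniversal_iff φ).1 hφ⟩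
  · rintro ⟨u, hu⟩
    obtain ⟨φ, rfl⟩ := adj.exists_morOfCocone (i := False) u False.elim
    exact ⟨φ, (adj.isUniversal_iff φ).2 hu⟩

/-- The pseudomorphism `y ⟶ J X` corresponding to a cocone under `𝒜_y` with vertex `X`. -/
def pseudoMorOfCocone (φ : WeightedCocone (descentWeight True) (adj.diagram y) X) :
    LocallyFull.mk y ⟶ (Jt.comp (strictIncl M)).obj X :=
  LocallyFull.Mor.mk (a := LocallyFull.mk y) (b := (Jt.comp (strictIncl M)).obj X)
    (adj.morOfCocone φ)
    ((adj.isIso_transposeCell_iff _).2 (φ.isIso_legCell trivial))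

/-- Cocones under `𝒜_y` with vertex `X` as pseudomorphisms `y ⟶ J X`. -/
def pseudoCoconeFunctor (y : LaxAlg M) (X : A) :
    WeightedCocone (descentWeight True) (adj.diagram y) X ⥤
      (LocallyFull.mk y ⟶ (Jt.comp (strictIncl M)).obj X) where
  obj φ := adj.pseudoMorOfCocone φ
  map {φ ψ} Γ := LocallyFull.Mor₂.mk (f := adj.pseudoMorOfCocone φ) (g := adj.pseudoMorOfCocone ψ)
    ((adj.coconeFunctor True y X).map Γ)
  map_id φ := LocallyFull.Mor₂.ext ((adj.coconeFunctor True y X).map_id φ)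
  map_comp Γ Θ := LocallyFull.Mor₂.ext ((adj.coconeFunctor True y X).map_comp Γ Θ)

theorem exists_pseudoMorOfCocone (u : LocallyFull.mk y ⟶ (Jt.comp (strictIncl M)).obj X) :
    ∃ φ, adj.pseudoMorOfCocone φ = u := by
  obtain ⟨φ, hφ⟩ := adj.exists_morOfCocone (i := True) u.hom fun _ => u.mem
  exact ⟨φ, LocallyFull.Mor.ext hφ⟩

/-- The inclusion of pseudomorphisms into lax morphisms is locally full, so only the bijection on
objects differs from the lax case; its image now consists of the morphisms with invertible structure
cell. -/
theorem isIsoOfCats_pseudoCoconeFunctor (y : LaxAlg M) (X : A) :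
    IsIsoOfCats (adj.pseudoCoconeFunctor y X) := by
  refine .of_bijective ⟨fun φ ψ h => adj.morOfCocone_injective (congrArg (·.hom) h),
    adj.exists_pseudoMorOfCocone⟩ fun φ ψ => ⟨fun Γ Θ h => ?_, fun η => ?_⟩
  · exact (adj.coconeFunctor_map_bijective φ ψ).1 (congrArg (·.hom) h)
  · obtain ⟨Γ, hΓ⟩ := (adj.coconeFunctor_map_bijective φ ψ).2 η.hom
    exact ⟨Γ, LocallyFull.Mor₂.ext hΓ⟩

theorem isUniversal_iff_pseudo (φ : WeightedCocone (descentWeight True) (adj.diagram y) X) :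
    φ.IsUniversal ↔ IsUniversalArrow (Jt.comp (strictIncl M)) (adj.pseudoMorOfCocone φ) := by
  have h : ∀ Y, φ.postFunctor Y ⋙ adj.pseudoCoconeFunctor y Y =
      arrowFunctor (Jt.comp (strictIncl M)) (adj.pseudoMorOfCocone φ) Y := fun Y =>
    CategoryTheory.Functor.hext (fun k => LocallyFull.Mor.ext (adj.morOfCocone_post φ k))
      fun _ _ η => LocallyFull.Mor₂.heq_of_hom
        (LocallyFull.Mor.ext (adj.morOfCocone_post φ _))
        (LocallyFull.Mor.ext (adj.morOfCocone_post φ _))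
        (adj.postFunctor_coconeFunctor_map_heq φ η)
  refine forall_congr' fun Y => ?_
  rw [← h Y]
  exact ⟨fun h => IsIsoOfCats.comp h (adj.isIsoOfCats_pseudoCoconeFunctor y Y),
    fun h => IsIsoOfCats.of_comp h (adj.isIsoOfCats_pseudoCoconeFunctor y Y)⟩

theorem isStrictCodescentObject_iff (y : LaxAlg M) (c : A) :
    IsStrictCodescentObject (adj.diagram y) c ↔
      ∃ u : LocallyFull.mk y ⟶ (Jt.comp (strictIncl M)).obj c,
        IsUniversalArrow (Jt.comp (strictIncl M)) u := by
  constructor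
  · rintro ⟨φ, hφ⟩
    exact ⟨adj.pseudoMorOfCocone φ, (adj.isUniversal_iff_pseudo φ).1 hφ⟩
  · rintro ⟨u, hu⟩
    obtain ⟨φ, rfl⟩ := adj.exists_pseudoMorOfCocone u
    exact ⟨φ, (adj.isUniversal_iff_pseudo φ).2 hu⟩

end TwoAdjunction

end LaxAlgebras

theorem mainTheorem3 {A : Type u₁} [Bicategory.{w₁, v₁} A] [Bicategory.Strict A]
    {B : Type u} [Bicategory.{w, v} B] [Bicategory.Strict B]
    (M : LaxAlgebras.TwoMonad B)
    (E : StrictPseudofunctor B A) (R : StrictPseudofunctor A B)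
    (adj : LaxAlgebras.TwoAdjunction E R)
    (J : StrictPseudofunctor A (LaxAlgebras.LaxAlgPs M))
    (Jt : StrictPseudofunctor A (LaxAlgebras.LaxAlgS M))
    (hR : J.comp (LaxAlgebras.forgetPs M) = R)
    (hJ : Jt.comp (LaxAlgebras.strictIncl M) = J) :
    ((∃ G : StrictPseudofunctor (LaxAlgebras.LaxAlg M) A,
        Nonempty (LaxAlgebras.TwoAdjunction G (J.comp (LaxAlgebras.ell M)))) ↔
      ∀ y : LaxAlgebras.LaxAlg M, ∃ c : A, LaxAlgebras.IsStrictLaxCodescentObject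
        (LaxAlgebras.codescentDiagram hJ hR adj y) c) ∧
    (∀ G : StrictPseudofunctor (LaxAlgebras.LaxAlg M) A,
      Nonempty (LaxAlgebras.TwoAdjunction G (J.comp (LaxAlgebras.ell M))) →
      ∀ y : LaxAlgebras.LaxAlg M, LaxAlgebras.IsStrictLaxCodescentObject
        (LaxAlgebras.codescentDiagram hJ hR adj y) (G.obj y)) ∧
    (∀ C : LaxAlgebras.LaxAlg M → A,
      (∀ y : LaxAlgebras.LaxAlg M, LaxAlgebras.IsStrictLaxCodescentObject
        (LaxAlgebras.codescentDiagram hJ hR adj y) (C y)) →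
      ∃ G : StrictPseudofunctor (LaxAlgebras.LaxAlg M) A, (∀ y, G.obj y = C y) ∧
        Nonempty (LaxAlgebras.TwoAdjunction G (J.comp (LaxAlgebras.ell M)))) ∧
    ((∃ G : StrictPseudofunctor (LaxAlgebras.LaxAlgPs M) A,
        Nonempty (LaxAlgebras.TwoAdjunction G J)) ↔
      ∀ y : LaxAlgebras.LaxAlg M, ∃ c : A, LaxAlgebras.IsStrictCodescentObject
        (LaxAlgebras.codescentDiagram hJ hR adj y) c) := by
  -- After this substitution the transport of the adjunction is trivial and `codescentDiagram` is
  -- `diagram` by definition.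
  subst hJ hR
  have lax (y) (c) : LaxAlgebras.IsStrictLaxCodescentObject
      (LaxAlgebras.codescentDiagram rfl rfl adj y) c ↔ ∃ u : y ⟶ LaxAlgebras.jAlg Jt c,
        LaxAlgebras.IsUniversalArrow
          ((Jt.comp (LaxAlgebras.strictIncl M)).comp (LaxAlgebras.ell M)) u :=
    adj.isStrictLaxCodescentObject_iff y c
  have of_adj (G : StrictPseudofunctor (LaxAlgebras.LaxAlg M) A)
      (h : Nonempty (LaxAlgebras.TwoAdjunction G
        ((Jt.comp (LaxAlgebras.strictIncl M)).comp (LaxAlgebras.ell M)))) (y) :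
      LaxAlgebras.IsStrictLaxCodescentObject
        (LaxAlgebras.codescentDiagram rfl rfl adj y) (G.obj y) := by
    obtain ⟨adj'⟩ := h
    exact (lax y _).2 ⟨adj'.unit y, adj'.isUniversalArrow_unit y⟩
  have to_adj (C : LaxAlgebras.LaxAlg M → A)
      (h : ∀ y, LaxAlgebras.IsStrictLaxCodescentObject
        (LaxAlgebras.codescentDiagram rfl rfl adj y) (C y)) :
      ∃ G : StrictPseudofunctor (LaxAlgebras.LaxAlg M) A, (∀ y, G.obj y = C y) ∧
        Nonempty (LaxAlgebras.TwoAdjunction G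
          ((Jt.comp (LaxAlgebras.strictIncl M)).comp (LaxAlgebras.ell M))) := by
    choose u hu using fun y => (lax y (C y)).1 (h y)
    exact LaxAlgebras.IsUniversalArrow.exists_adjunction u hu
  refine ⟨⟨fun ⟨G, hG⟩ y => ⟨G.obj y, of_adj G hG y⟩, fun h => ?_⟩, of_adj, to_adj, ?_, ?_⟩
  · choose C hC using h
    obtain ⟨G, -, hG⟩ := to_adj C hC
    exact ⟨G, hG⟩
  · rintro ⟨G, ⟨adj'⟩⟩ y
    exact ⟨G.obj ⟨y⟩, (adj.isStrictCodescentObject_iff y _).2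
      ⟨adj'.unit ⟨y⟩, adj'.isUniversalArrow_unit ⟨y⟩⟩⟩
  · intro h
    choose C hC using h
    choose u hu using fun y => (adj.isStrictCodescentObject_iff y (C y)).1 (hC y)
    -- Objects of the `2`-category of pseudomorphisms are wrapped lax algebras, so the chosen data
    -- are reindexed along the projection.
    obtain ⟨G, -, hG⟩ := LaxAlgebras.IsUniversalArrow.exists_adjunction
      (C := fun y : LaxAlgebras.LaxAlgPs M => C y.obj) (fun y => u y.obj) (fun y => hu y.obj)
    exact ⟨G, hG⟩
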